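/- Let $X$ be a compact oriented smooth $4$-manifold, let $(Y,\omega_Y)$ be a compact symplectic $4$-manifold, oriented by $\omega_Y\wedge\omega_Y$, and let $f:X\to Y$ be a symplectic branched covering. This means that $f$ is smooth and that for every $p\in X$ there are open sets $U\ni p$ in $X$ and $V\supset f(U)$ in $Y$ and orientation-preserving diffeomorphisms $\phi$ from $U$ and $\psi$ from $V$ onto open subsets of $\mathbb{C}^2$ such that $(\psi_*\omega_Y)(v,iv)>0$ for all $v\neq 0$, and such that $\psi\circ f\circ\phi^{-1}$ is one of the maps $$(u,v)\mapsto(u,v),\qquad (u,v)\mapsto(u^2,v),\qquad (u,v)\mapsto(u^3-uv,v).$$ Call such a pair $(\phi,\psi)$ adapted. Let $R\subset X$ be the ramification curve, i.e. the set of points where $df$ is not an isomorphism. For $p\in R$ the plane $K_p=\operatorname{Ker} df_p$ is a complex line in adapted coordinates $\phi$, and is oriented as such. Let $\mathcal{A}$ be the set of exact $2$-forms $\alpha$ on $X$ ($\alpha=d\beta$ with $\beta$ a smooth $1$-form) whose restriction to $K_p$ is nondegenerate and positive for every $p\in R$ (in all adapted coordinates at $p$). Call a symplectic form $\omega_X$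 on $X$ \emph{induced by $f$} if $\omega_X=f^*\omega_Y+\varepsilon\alpha$ for some $\alpha\in\mathcal{A}$ and some $\varepsilon>0$ such that $f^*\omega_Y+t\alpha$ is symplectic for all $t\in(0,\varepsilon]$. Then: 1. $X$ carries a symplectic form induced by $f$ (in particular $\mathcal{A}\neq\emptyset$). 2. Every symplectic form $\omega_X$ induced by $f$ satisfies $[\omega_X]=f^*[\omega_Y]$ in $H^2(X;\mathbb{R})$ (de Rham cohomology). 3. For every $\alpha\in\mathcal{A}$ there is $\varepsilon_0>0$ such that $f^*\omega_Y+\varepsilon\alpha$ is symplectic for all $\varepsilon\in(0,\varepsilon_0]$. 4. The induced form is unique up to symplectomorphism: if $\omega_1$ and $\omega_2$ are symplectic forms on $X$ induced by $f$, then there is a diffeomorphism $\Phi:X\to X$ with $\Phi^*\omega_2=\omega_1$. -/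

import Mathlib

open scoped Manifold ContDiff Topology

noncomputable section

namespace SymplecticCover

section Forms

variable {E : Type*} [NormedAddCommGroup E] [NormedSpace ℝ E]
  {F : Type*} [NormedAddCommGroup F] [NormedSpace ℝ F]
  {G : Type*} [NormedAddCommGroup G] [NormedSpace ℝ G]
  {M : Type*} [TopologicalSpace M] [ChartedSpace E M]
  {N : Type*} [TopologicalSpace N] [ChartedSpace F N]
  {P : Type*} [TopologicalSpace P] [ChartedSpace G P]
  {k : ℕ}

/-- A real differential `k`-form on a manifold `M` modelled on `E`, without regularity assumption:
an alternating `k`-linear form on each tangent space. -/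
abbrev Form (E : Type*) [NormedAddCommGroup E] [NormedSpace ℝ E]
    (M : Type*) [TopologicalSpace M] [ChartedSpace E M] (k : ℕ) : Type _ :=
  ∀ x : M, TangentSpace 𝓘(ℝ, E) x [⋀^Fin k]→L[ℝ] ℝ

instance : AddCommGroup (Form E M k) := inferInstance

/-- The pullback `f^* σ`. -/
def pullback (f : M → N) (σ : Form F N k) : Form E M k := fun x =>
  (σ (f x)).compContinuousLinearMap (mfderiv 𝓘(ℝ, E) 𝓘(ℝ, F) f x)

/-- The expression of a form in a chart `e`, i.e. `(e⁻¹)^* σ`; it is meaningful on `e.target`. -/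
def coordRep (e : OpenPartialHomeomorph M E) (σ : Form E M k) : E → E [⋀^Fin k]→L[ℝ] ℝ :=
  pullback (E := E) (M := E) e.symm σ

/-- A form is smooth if its expression in every chart of the atlas is smooth. -/
def IsSmooth (σ : Form E M k) : Prop :=
  ∀ e ∈ atlas E M, ContDiffOn ℝ ∞ (coordRep e σ) e.target

/-- The exterior derivative, computed at each point in the preferred chart at that point. -/
def extD (σ : Form E M k) : Form E M (k + 1) := fun x =>
  pullback (N := E) (chartAt E x) (extDeriv (coordRep (chartAt E x) σ)) x

theorem pullback_add (f : M → N) (σ η : Form F N k) :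
    pullback (E := E) f (σ + η) = pullback f σ + pullback f η := rfl

theorem pullback_smul (f : M → N) (c : ℝ) (σ : Form F N k) :
    pullback (E := E) f (c • σ) = c • pullback f σ := rfl

theorem coordRep_add (e : OpenPartialHomeomorph M E) (σ η : Form E M k) :
    coordRep e (σ + η) = coordRep e σ + coordRep e η := rfl

theorem coordRep_smul (e : OpenPartialHomeomorph M E) (c : ℝ) (σ : Form E M k) :
    coordRep e (c • σ) = c • coordRep e σ := rfl

theorem IsSmooth.add {σ η : Form E M k} (hσ : IsSmooth σ) (hη : IsSmooth η) :
    IsSmooth (σ + η) := fun e he => by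
  rw [coordRep_add]
  exact (hσ e he).add (hη e he)

theorem IsSmooth.smul {σ : Form E M k} (c : ℝ) (hσ : IsSmooth σ) : IsSmooth (c • σ) :=
  fun e he => by
    rw [coordRep_smul]
    exact contDiffOn_const.smul (hσ e he)

theorem coordRep_zero (e : OpenPartialHomeomorph M E) :
    coordRep e (0 : Form E M k) = 0 := rfl

theorem isSmooth_zero : IsSmooth (0 : Form E M k) := fun e _ => by
  rw [coordRep_zero]
  exact contDiffOn_const

theorem IsSmooth.contDiffAt {σ : Form E M k} (hσ : IsSmooth σ) (x : M) :
    ContDiffAt ℝ ∞ (coordRep (chartAt E x) σ) (chartAt E x x) :=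
  (hσ _ (chart_mem_atlas E x)).contDiffAt
    ((chartAt E x).open_target.mem_nhds (mem_chart_target E x))

theorem IsSmooth.differentiableAt {σ : Form E M k} (hσ : IsSmooth σ) (x : M) :
    DifferentiableAt ℝ (coordRep (chartAt E x) σ) (chartAt E x x) :=
  (hσ.contDiffAt x).differentiableAt (by simp)

theorem extD_add {σ η : Form E M k} (hσ : IsSmooth σ) (hη : IsSmooth η) :
    extD (σ + η) = extD σ + extD η := by
  funext x
  have h := extDeriv_add (hσ.differentiableAt x) (hη.differentiableAt x)
  simp only [extD, pullback, coordRep_add, Pi.add_apply]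
  rw [h]
  rfl

theorem extD_smul (c : ℝ) (σ : Form E M k) : extD (c • σ) = c • extD σ := by
  funext x
  have h := extDeriv_smul (x := chartAt E x x) c (coordRep (chartAt E x) σ)
  simp only [extD, pullback, coordRep_smul, Pi.smul_apply]
  rw [h]
  rfl

theorem extD_zero : extD (0 : Form E M k) = 0 := by
  simpa using extD_smul (0 : ℝ) (0 : Form E M k)

theorem pullback_congr {f g : M → N} {x : M} (h : f =ᶠ[𝓝 x] g) (σ : Form F N k) :
    pullback (E := E) f σ x = pullback g σ x := by
  have h1 : f x = g x := h.self_of_nhds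
  have h2 : (mfderiv 𝓘(ℝ, E) 𝓘(ℝ, F) f x : E →L[ℝ] F) = mfderiv 𝓘(ℝ, E) 𝓘(ℝ, F) g x :=
    h.mfderiv_eq
  let s : N → F [⋀^Fin k]→L[ℝ] ℝ := σ
  have key : ∀ (p q : N) (A B : E →L[ℝ] F), p = q → A = B →
      (s p).compContinuousLinearMap A = (s q).compContinuousLinearMap B := by
    rintro p _ A _ rfl rfl
    rfl
  exact key _ _ _ _ h1 h2

theorem pullback_congr_form (f : M → N) {x : M} {σ τ : Form F N k} (h : σ (f x) = τ (f x)) :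
    pullback (E := E) f σ x = pullback f τ x := by
  simp only [pullback, h]

theorem extD_apply (σ : Form E M k) (x : M) :
    extD σ x = pullback (N := E) (chartAt E x) (extDeriv (coordRep (chartAt E x) σ)) x := rfl

theorem pullback_comp {g : N → P} {f : M → N} {x : M}
    (hg : MDifferentiableAt 𝓘(ℝ, F) 𝓘(ℝ, G) g (f x))
    (hf : MDifferentiableAt 𝓘(ℝ, E) 𝓘(ℝ, F) f x) (σ : Form G P k) :
    pullback (E := E) (g ∘ f) σ x = pullback f (pullback (E := F) g σ) x := by
  simp only [pullback]
  rw [mfderiv_comp x hg hf]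
  rfl

theorem contDiffAt_alternating [FiniteDimensional ℝ E] {Φ : G → E [⋀^Fin k]→L[ℝ] ℝ} {y : G}
    (h : ∀ v : Fin k → E, ContDiffAt ℝ ∞ (fun z => Φ z v) y) : ContDiffAt ℝ ∞ Φ y := by
  let b := Module.finBasis ℝ E
  let L : (E [⋀^Fin k]→L[ℝ] ℝ) →ₗ[ℝ] ((Fin k → Fin (Module.finrank ℝ E)) → ℝ) :=
    { toFun := fun σ i => σ (fun j => b (i j))
      map_add' := fun _ _ => rfl
      map_smul' := fun _ _ => rfl }
  have hL : Function.Injective L := by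
    intro σ τ hst
    apply ContinuousAlternatingMap.toAlternatingMap_injective
    exact b.ext_alternating fun i _ => congrFun hst i
  obtain ⟨T, hT⟩ := L.exists_leftInverse_of_injective (LinearMap.ker_eq_bot.2 hL)
  have h1 : ContDiffAt ℝ ∞ (fun z => L (Φ z)) y := contDiffAt_pi.2 fun i => h _
  have h2 := T.toContinuousLinearMap.contDiff.contDiffAt.comp y h1
  refine h2.congr_of_eventuallyEq (Filter.Eventually.of_forall fun z => ?_)
  exact (LinearMap.congr_fun hT (Φ z)).symm

theorem contDiffAt_comp [FiniteDimensional ℝ E] {Φ : G → F [⋀^Fin k]→L[ℝ] ℝ}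
    {A : G → E →L[ℝ] F} {y : G} (hΦ : ContDiffAt ℝ ∞ Φ y) (hA : ContDiffAt ℝ ∞ A y) :
    ContDiffAt ℝ ∞ (fun z => (Φ z).compContinuousLinearMap (A z)) y := by
  refine contDiffAt_alternating fun v => ?_
  have h1 : ContDiffAt ℝ ∞ (fun z => (Φ z).toContinuousMultilinearMap) y :=
    (ContinuousAlternatingMap.toContinuousMultilinearMapCLM (𝕜 := ℝ) (E := F) (F := ℝ) (ι := Fin k) ℝ).contDiff.contDiffAt.comp y hΦ
  have h2 : ContDiffAt ℝ ∞ (fun z => ((fun _ : Fin k => A z), (Φ z).toContinuousMultilinearMap)) y :=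
    (contDiffAt_pi.2 fun _ => hA).prodMk h1
  have h3 := (ContinuousMultilinearMap.analyticAt_uncurry_compContinuousLinearMap (𝕜 := ℝ)
    (q := ((fun _ : Fin k => A y), (Φ y).toContinuousMultilinearMap))).contDiffAt (n := ∞)
  have h4 := h3.comp y h2
  exact (ContinuousMultilinearMap.apply ℝ (fun _ : Fin k => E) ℝ v).contDiff.contDiffAt.comp y h4

variable [IsManifold 𝓘(ℝ, E) ∞ M] [IsManifold 𝓘(ℝ, F) ∞ N]

/-- A map read in charts is smooth, and pullbacks of forms are computed by it. -/
theorem coordRep_pullback {f : M → N} (hf : ContMDiff 𝓘(ℝ, E) 𝓘(ℝ, F) ∞ f) (σ : Form F N k)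
    {e : OpenPartialHomeomorph M E} (he : e ∈ atlas E M)
    {e' : OpenPartialHomeomorph N F} (he' : e' ∈ atlas F N)
    {y : E} (hy : y ∈ e.target) (hfy : f (e.symm y) ∈ e'.source) :
    ContDiffAt ℝ ∞ (e' ∘ f ∘ e.symm) y ∧
    coordRep e (pullback f σ) =ᶠ[𝓝 y]
      fun z => (coordRep e' σ ((e' ∘ f ∘ e.symm) z)).compContinuousLinearMap
        (fderiv ℝ (e' ∘ f ∘ e.symm) z) := by
  have hem := IsManifold.subset_maximalAtlas (I := 𝓘(ℝ, E)) (n := ∞) he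
  have hem' := IsManifold.subset_maximalAtlas (I := 𝓘(ℝ, F)) (n := ∞) he'
  have hnhds : ∀ᶠ z in 𝓝 y, z ∈ e.target ∧ f (e.symm z) ∈ e'.source := by
    refine (e.open_target.eventually_mem hy).and ?_
    have hc : ContinuousAt (f ∘ e.symm) y :=
      hf.continuous.continuousAt.comp (e.symm.continuousAt hy)
    exact hc.preimage_mem_nhds (e'.open_source.mem_nhds hfy)
  have hsm : ∀ z, z ∈ e.target → ContMDiffAt 𝓘(ℝ, E) 𝓘(ℝ, E) ∞ e.symm z := fun z hz =>
    (contMDiffOn_symm_of_mem_maximalAtlas hem).contMDiffAt (e.open_target.mem_nhds hz)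
  have hsm' : ∀ p, p ∈ e'.source → ContMDiffAt 𝓘(ℝ, F) 𝓘(ℝ, F) ∞ e' p := fun p hp =>
    (contMDiffOn_of_mem_maximalAtlas hem').contMDiffAt (e'.open_source.mem_nhds hp)
  have hsm'' : ∀ p, p ∈ e'.target → ContMDiffAt 𝓘(ℝ, F) 𝓘(ℝ, F) ∞ e'.symm p := fun p hp =>
    (contMDiffOn_symm_of_mem_maximalAtlas hem').contMDiffAt (e'.open_target.mem_nhds hp)
  have hfe : ∀ z, z ∈ e.target → ContMDiffAt 𝓘(ℝ, E) 𝓘(ℝ, F) ∞ (f ∘ e.symm) z := fun z hz =>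
    hf.contMDiffAt.comp z (hsm z hz)
  have hF : ∀ z, z ∈ e.target → f (e.symm z) ∈ e'.source →
      ContMDiffAt 𝓘(ℝ, E) 𝓘(ℝ, F) ∞ (e' ∘ f ∘ e.symm) z := fun z hz hz' =>
    (hsm' _ hz').comp z (hfe z hz)
  refine ⟨(hF y hy hfy).contDiffAt, ?_⟩
  filter_upwards [hnhds.eventually_nhds] with z hz
  obtain ⟨hz1, hz2⟩ := hz.self_of_nhds
  have e1 : coordRep e (pullback f σ) z = pullback (E := E) (M := E) (f ∘ e.symm) σ z :=
    (pullback_comp (hf.contMDiffAt.mdifferentiableAt (by simp))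
      ((hsm z hz1).mdifferentiableAt (by simp)) σ).symm
  have e2 : pullback (E := E) (M := E) (f ∘ e.symm) σ z =
      pullback (E := E) (M := E) (e'.symm ∘ (e' ∘ f ∘ e.symm)) σ z := by
    refine pullback_congr ?_ σ
    filter_upwards [hz] with w hw
    exact (e'.left_inv hw.2).symm
  have e3 : pullback (E := E) (M := E) (e'.symm ∘ (e' ∘ f ∘ e.symm)) σ z =
      pullback (E := E) (M := E) (N := F) (e' ∘ f ∘ e.symm)
        (pullback (E := F) (M := F) e'.symm σ) z :=
    pullback_comp (f := e' ∘ f ∘ e.symm) ((hsm'' _ (e'.map_source hz2)).mdifferentiableAt (by simp))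
      ((hF z hz1 hz2).mdifferentiableAt (by simp)) σ
  rw [e1, e2, e3, ← mfderiv_eq_fderiv]
  rfl

theorem IsSmooth.pullback [FiniteDimensional ℝ E] {f : M → N}
    (hf : ContMDiff 𝓘(ℝ, E) 𝓘(ℝ, F) ∞ f) {σ : Form F N k} (hσ : IsSmooth σ) :
    IsSmooth (pullback (E := E) f σ) := by
  intro e he y hy
  obtain ⟨h1, h2⟩ := coordRep_pullback hf σ he (chart_mem_atlas F (f (e.symm y))) hy
    (mem_chart_source F _)
  refine ContDiffAt.contDiffWithinAt (ContDiffAt.congr_of_eventuallyEq ?_ h2)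
  have h3 := hσ.contDiffAt (f (e.symm y))
  exact contDiffAt_comp (ContDiffAt.comp y h3 h1) (h1.fderiv_right (m := ∞) (by simp))

theorem extD_pullback {f : M → N}
    (hf : ContMDiff 𝓘(ℝ, E) 𝓘(ℝ, F) ∞ f) {σ : Form F N k} (hσ : IsSmooth σ) :
    extD (pullback (E := E) f σ) = pullback f (extD σ) := by
  funext x
  set e := chartAt E x with he
  set e' := chartAt F (f x) with he'
  have hex : e.symm (e x) = x := e.left_inv (mem_chart_source E x)
  have hem := IsManifold.chart_mem_maximalAtlas (I := 𝓘(ℝ, E)) (n := ∞) x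
  have hem' := IsManifold.chart_mem_maximalAtlas (I := 𝓘(ℝ, F)) (n := ∞) (f x)
  obtain ⟨h1, h2⟩ := coordRep_pullback hf σ (chart_mem_atlas E x) (chart_mem_atlas F (f x))
    (mem_chart_target E x) (by rw [← he, hex]; exact mem_chart_source F _)
  have hFx : (e' ∘ f ∘ e.symm) (e x) = e' (f x) := by simp [hex]
  have h3 : DifferentiableAt ℝ (coordRep e' σ) ((e' ∘ f ∘ e.symm) (e x)) := by
    rw [hFx]; exact hσ.differentiableAt (f x)
  have h4 : extDeriv (coordRep e (pullback f σ)) (e x) =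
      (extDeriv (coordRep e' σ) ((e' ∘ f ∘ e.symm) (e x))).compContinuousLinearMap
        (fderiv ℝ (e' ∘ f ∘ e.symm) (e x)) := by
    rw [h2.extDeriv_eq]
    exact extDeriv_pullback h3 h1 (by simpa using (WithTop.coe_le_coe.2 (le_top : (2 : ℕ∞) ≤ ⊤)))
  have hes : MDifferentiableAt 𝓘(ℝ, E) 𝓘(ℝ, E) e x :=
    ((contMDiffOn_of_mem_maximalAtlas hem).contMDiffAt
      (e.open_source.mem_nhds (mem_chart_source E x))).mdifferentiableAt (by simp)
  have hes' : MDifferentiableAt 𝓘(ℝ, F) 𝓘(ℝ, F) e' (f x) :=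
    ((contMDiffOn_of_mem_maximalAtlas hem').contMDiffAt
      (e'.open_source.mem_nhds (mem_chart_source F _))).mdifferentiableAt (by simp)
  let D : Form F F (k + 1) := extDeriv (coordRep e' σ)
  have e1 : extD (pullback (E := E) f σ) x =
      pullback (E := E) (N := E) e (pullback (E := E) (N := F) (e' ∘ f ∘ e.symm) D) x := by
    have : extDeriv (coordRep e (pullback f σ)) (e x) =
        pullback (E := E) (N := F) (e' ∘ f ∘ e.symm) D (e x) := by
      rw [h4, ← mfderiv_eq_fderiv]; rfl
    exact congrArg (fun A : E [⋀^Fin (k + 1)]→L[ℝ] ℝ =>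
      A.compContinuousLinearMap (mfderiv 𝓘(ℝ, E) 𝓘(ℝ, E) e x : E →L[ℝ] E)) this
  have e2 : pullback (E := E) (N := E) e (pullback (E := E) (N := F) (e' ∘ f ∘ e.symm) D) x =
      pullback (E := E) (N := F) ((e' ∘ f ∘ e.symm) ∘ e) D x :=
    (pullback_comp (h1.contMDiffAt.mdifferentiableAt (by simp)) hes D).symm
  have e3 : pullback (E := E) (N := F) ((e' ∘ f ∘ e.symm) ∘ e) D x =
      pullback (E := E) (N := F) (e' ∘ f) D x := by
    refine pullback_congr ?_ D
    filter_upwards [e.open_source.mem_nhds (mem_chart_source E x)] with w hw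
    simp [e.left_inv hw]
  have e4 : pullback (E := E) (N := F) (e' ∘ f) D x =
      pullback (E := E) f (pullback (E := F) (N := F) e' D) x :=
    pullback_comp hes' (hf.contMDiffAt.mdifferentiableAt (by simp)) D
  have e5 : pullback (E := E) f (pullback (E := F) (N := F) e' D) x = pullback f (extD σ) x :=
    pullback_congr_form f (extD_apply σ (f x)).symm
  exact e1.trans (e2.trans (e3.trans (e4.trans e5)))

variable (E M k) in
/-- The closed smooth `k`-forms. -/
def closedForms : Submodule ℝ (Form E M k) where
  carrier := {σ | IsSmooth σ ∧ extD σ = 0}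
  add_mem' := fun hσ hη => ⟨hσ.1.add hη.1, by rw [extD_add hσ.1 hη.1, hσ.2, hη.2, add_zero]⟩
  zero_mem' := ⟨isSmooth_zero, extD_zero⟩
  smul_mem' := fun c _ hσ => ⟨hσ.1.smul c, by rw [extD_smul, hσ.2, smul_zero]⟩

variable (E M k) in
/-- The exact `(k + 1)`-forms: the exterior derivatives of smooth `k`-forms. -/
def exactForms : Submodule ℝ (Form E M (k + 1)) where
  carrier := {σ | ∃ β : Form E M k, IsSmooth β ∧ extD β = σ}
  add_mem' := by
    rintro _ _ ⟨β, hβ, rfl⟩ ⟨γ, hγ, rfl⟩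
    exact ⟨β + γ, hβ.add hγ, extD_add hβ hγ⟩
  zero_mem' := ⟨0, isSmooth_zero, extD_zero⟩
  smul_mem' := by
    rintro c _ ⟨β, hβ, rfl⟩
    exact ⟨c • β, hβ.smul c, extD_smul c β⟩

variable (E M) in
/-- The second de Rham cohomology `H²(M; ℝ)`: closed smooth `2`-forms modulo exact ones. -/
abbrev DeRhamH2 : Type _ :=
  closedForms E M 2 ⧸ (exactForms E M 1).comap (closedForms E M 2).subtype

/-- Pullback of closed forms by a smooth map. -/
def closedPullback [FiniteDimensional ℝ E] (f : C^∞⟮𝓘(ℝ, E), M; 𝓘(ℝ, F), N⟯) :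
    closedForms F N k →ₗ[ℝ] closedForms E M k where
  toFun σ := ⟨pullback f σ.1, σ.2.1.pullback f.contMDiff, by
    rw [extD_pullback f.contMDiff σ.2.1, σ.2.2]; rfl⟩
  map_add' _ _ := rfl
  map_smul' _ _ := rfl

/-- The map `f^* : H²(N; ℝ) → H²(M; ℝ)` induced by a smooth map `f : M → N`. -/
def cohomologyPullback [FiniteDimensional ℝ E] (f : C^∞⟮𝓘(ℝ, E), M; 𝓘(ℝ, F), N⟯) :
    DeRhamH2 F N →ₗ[ℝ] DeRhamH2 E M :=
  Submodule.mapQ _ _ (closedPullback f) (by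
    rintro σ ⟨β, hβ, hσ⟩
    refine ⟨pullback f β, hβ.pullback f.contMDiff, ?_⟩
    rw [extD_pullback f.contMDiff hβ, hσ]
    rfl)

end Forms

section Symplectic

variable {E : Type*} [NormedAddCommGroup E] [NormedSpace ℝ E]
  {M : Type*} [TopologicalSpace M] [ChartedSpace E M]

variable (E M) in
/-- A symplectic form on `M`: a smooth, closed, nondegenerate `2`-form. -/
structure SymplecticForm where
  form : Form E M 2
  smooth : IsSmooth form
  closed : extD form = 0
  nondegenerate : ∀ (x : M) (v : TangentSpace 𝓘(ℝ, E) x), (∀ w, form x ![v, w] = 0) → v = 0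

/-- The cohomology class of a symplectic form. -/
def SymplecticForm.cohomologyClass (σ : SymplecticForm E M) : DeRhamH2 E M :=
  Submodule.Quotient.mk ⟨σ.form, σ.smooth, σ.closed⟩

end Symplectic

/-- The model space `ℝ⁴`. -/
abbrev R4 : Type := EuclideanSpace ℝ (Fin 4)

section BranchedCover

variable {X : Type*} [TopologicalSpace X] [ChartedSpace R4 X]
  {Y : Type*} [TopologicalSpace Y] [ChartedSpace R4 Y]

/-- The family `v` is a basis of `V` that is positive for the orientation `o`. -/
def IsPositiveFrame {V : Type*} [AddCommGroup V] [Module ℝ V] (o : Orientation ℝ V (Fin 4))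
    (v : Fin 4 → V) : Prop :=
  ∃ b : Module.Basis (Fin 4) ℝ V, ⇑b = v ∧ b.orientation = o

variable (X) in
/-- An orientation of the smooth `4`-manifold `X`: an orientation of each tangent space such that
around each point there is a smooth chart whose coordinate frame is positive on its domain. -/
structure ManifoldOrientation where
  at_point : ∀ x : X, Orientation ℝ (TangentSpace (𝓡 4) x) (Fin 4)
  exists_chart : ∀ x : X, ∃ e ∈ IsManifold.maximalAtlas (𝓡 4) ∞ X, x ∈ e.source ∧
    ∀ y ∈ e.target, IsPositiveFrame (at_point (e.symm y))
      (fun i => mfderiv (𝓡 4) (𝓡 4) e.symm y (EuclideanSpace.single i (1 : ℝ)))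

/-- The standard oriented real basis `(1, 0), (i, 0), (0, 1), (0, i)` of `ℂ²`. -/
def complexFrame : Fin 4 → ℂ × ℂ := ![(1, 0), (Complex.I, 0), (0, 1), (0, Complex.I)]

/-- A diffeomorphism from an open subset `φ.source` of `X` onto an open subset of `ℂ²`. -/
def IsComplexChart (φ : OpenPartialHomeomorph X (ℂ × ℂ)) : Prop :=
  ContMDiffOn (𝓡 4) 𝓘(ℝ, ℂ × ℂ) ∞ φ φ.source ∧
    ContMDiffOn 𝓘(ℝ, ℂ × ℂ) (𝓡 4) ∞ φ.symm φ.target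

/-- The inverse differential `T_zℂ² = ℂ² → T_{φ⁻¹(z)}X` of a chart `φ` with values in `ℂ²`. -/
def invDiff (φ : OpenPartialHomeomorph X (ℂ × ℂ)) (z : ℂ × ℂ) :
    ℂ × ℂ →L[ℝ] TangentSpace (𝓡 4) (φ.symm z) :=
  mfderiv 𝓘(ℝ, ℂ × ℂ) (𝓡 4) φ.symm z

/-- The value of the `4`-form `σ ∧ σ` at `x` on four tangent vectors. -/
def wedgeSq (σ : Form R4 Y 2) (x : Y) (v : Fin 4 → TangentSpace (𝓡 4) x) : ℝ :=
  2 * (σ x ![v 0, v 1] * σ x ![v 2, v 3] - σ x ![v 0, v 2] * σ x ![v 1, v 3] +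
    σ x ![v 0, v 3] * σ x ![v 1, v 2])

/-- The three local models: local diffeomorphism, simple branching, cusp. -/
def IsLocalModel (g : ℂ × ℂ → ℂ × ℂ) : Prop :=
  (∀ u v, g (u, v) = (u, v)) ∨ (∀ u v, g (u, v) = (u ^ 2, v)) ∨
    (∀ u v, g (u, v) = (u ^ 3 - u * v, v))

/-- Local coordinates `φ` on `X` and `ψ` on `Y` in which `f` is given by one of the three local
models. Here `X` is oriented by `o` and `Y` by the volume form `ωY ∧ ωY`. -/
structure AdaptedCharts (o : ManifoldOrientation X) (ωY : Form R4 Y 2) (f : X → Y)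
    (φ : OpenPartialHomeomorph X (ℂ × ℂ)) (ψ : OpenPartialHomeomorph Y (ℂ × ℂ)) : Prop where
  chart_source : IsComplexChart φ
  chart_target : IsComplexChart ψ
  mapsTo : Set.MapsTo f φ.source ψ.source
  orientation_source : ∀ z ∈ φ.target,
    IsPositiveFrame (o.at_point (φ.symm z)) (fun i => invDiff φ z (complexFrame i))
  orientation_target : ∀ z ∈ ψ.target,
    0 < wedgeSq ωY (ψ.symm z) (fun i => invDiff ψ z (complexFrame i))
  /-- The standard complex structure is tamed by `ψ_* ωY`. -/
  tame : ∀ z ∈ ψ.target, ∀ v : ℂ × ℂ, v ≠ 0 →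
    0 < ωY (ψ.symm z) ![invDiff ψ z v, invDiff ψ z (Complex.I • v)]
  model : ∃ g, IsLocalModel g ∧ ∀ z ∈ φ.target, ψ (f (φ.symm z)) = g z

/-- The smooth map `f : X → (Y, ωY)` is a symplectic branched covering. -/
def IsSymplecticBranchedCover (o : ManifoldOrientation X) (ωY : SymplecticForm R4 Y)
    (f : C^∞⟮𝓡 4, X; 𝓡 4, Y⟯) : Prop :=
  ∀ p : X, ∃ (φ : OpenPartialHomeomorph X (ℂ × ℂ)) (ψ : OpenPartialHomeomorph Y (ℂ × ℂ)),
    p ∈ φ.source ∧ AdaptedCharts o ωY.form f φ ψ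

/-- The ramification curve: the points where `df` is not an isomorphism. -/
def ramificationCurve (f : X → Y) : Set X :=
  {p | ¬ Function.Bijective (mfderiv (𝓡 4) (𝓡 4) f p)}

/-- The restriction of `α` to `K_p = Ker df_p` is nondegenerate and positive at each point `p` of
the ramification curve, `K_p` being oriented as a complex line in adapted local coordinates. -/
def IsPositiveOnKernel (o : ManifoldOrientation X) (ωY : Form R4 Y 2) (f : X → Y)
    (α : Form R4 X 2) : Prop :=
  ∀ φ ψ, AdaptedCharts o ωY f φ ψ → ∀ z ∈ φ.target, φ.symm z ∈ ramificationCurve f →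
    ∀ v : ℂ × ℂ, v ≠ 0 → mfderiv (𝓡 4) (𝓡 4) f (φ.symm z) (invDiff φ z v) = 0 →
      0 < α (φ.symm z) ![invDiff φ z v, invDiff φ z (Complex.I • v)]

/-- The exact `2`-forms that are positive on `Ker df` along the ramification curve. -/
def admissibleForms (o : ManifoldOrientation X) (ωY : Form R4 Y 2) (f : X → Y) :
    Set (Form R4 X 2) :=
  {α | α ∈ exactForms R4 X 1 ∧ IsPositiveOnKernel o ωY f α}

/-- The symplectic forms `f^*ωY + ε α` on `X`, with `α` exact and positive on `Ker df` along the
ramification curve and `ε > 0` so small that `f^*ωY + t α` is symplectic for all `0 < t ≤ ε`. -/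
def IsInducedForm (o : ManifoldOrientation X) (ωY : SymplecticForm R4 Y) (f : X → Y)
    (ωX : SymplecticForm R4 X) : Prop :=
  ∃ α ∈ admissibleForms o ωY.form f, ∃ ε > (0 : ℝ),
    ωX.form = pullback f ωY.form + ε • α ∧
    ∀ t ∈ Set.Ioc 0 ε, ∃ η : SymplecticForm R4 X, η.form = pullback f ωY.form + t • α

end BranchedCover

end SymplecticCover

end

open SymplecticCover

open scoped Manifold ContDiff Topology

noncomputable section

/-! In adapted charts `df` is complex linear and `ωY` tames multiplication by `i`, so `f^*ωY (v, iv)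
≥ 0`, with equality exactly on `Ker df`. If `α` is positive on `Ker df` along the ramification
curve, then `f^*ωY + ε α` is positive on all pairs `(v, iv)`, `v ≠ 0`, for small `ε > 0`: near a
kernel vector `α` supplies the positivity, elsewhere `f^*ωY` dominates. Compactness of the unit
sphere and of `X` makes `ε` uniform (`eventually_chartValue_pos`, `exists_tamed`). A form that tames
a complex structure is nondegenerate, which gives part 3. Part 2 holds because `ε α` is exact.

For `𝒜 ≠ ∅`, exact forms that are nonnegative on the kernel everywhere and positive near one point
are summed. The sign on the kernel does not depend on the adapted chart, because it is the sign of
the top-degree form `f^*ωY ∧ α` on a positive frame (`AdaptedCharts.exists_pos_ratio`). Locally the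
form is a cut-off of `dx ∧ dy`, where `x + iy` is the first coordinate. Cutting off inside `d`
creates an error of unknown sign. It is absorbed by a multiple of `d(χ Re w) ∧ d(Im w)`, where `w`
is the Jacobian of the local model: on the curve `w = 0` this is `χ |∂w/∂u|²` on the kernel, and
`∂w/∂u` vanishes there at most at isolated points, the cusps (`ModelData.exists_jacobian_pos`).

For uniqueness, forms taming the same complex structure at a point are a convex set. So for one
small `ε` the segment from `f^*ωY + ε α₁` to `f^*ωY + ε α₂` is symplectic, while changing `ε` for
fixed `αᵢ` is harmless by the definition of an induced form. Moser's theorem is applied to these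
three segments.

Moser's theorem (`moser`) is obtained with flows in the model space only: a partition of unity
splits the primitive into pieces supported in charts, a small multiple of each piece is realised by
a compactly supported flow (`exists_flow`, `exists_local_moser`) extended by the identity, and
connectedness of `[0, 1]` chains the small steps. -/

namespace SymplecticCover

/-! ### Smoothness of the superposition operator `γ ↦ W ∘ γ` on continuous paths. -/

section Superposition

universe u

variable {K : Type*} [TopologicalSpace K] [CompactSpace K]

/-- Pointwise application of a continuous family of operators to a continuous family of vectors. -/
def pointwiseApply (K : Type*) [TopologicalSpace K] [CompactSpace K]
    (G F : Type*) [NormedAddCommGroup G] [NormedSpace ℝ G] [NormedAddCommGroup F]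
    [NormedSpace ℝ F] : C(K, G →L[ℝ] F) →L[ℝ] C(K, G) →L[ℝ] C(K, F) :=
  LinearMap.mkContinuous₂
    (LinearMap.mk₂ ℝ (fun (A : C(K, G →L[ℝ] F)) (h : C(K, G)) =>
        (⟨fun t => A t (h t), by fun_prop⟩ : C(K, F)))
      (fun _ _ _ => by ext; simp) (fun _ _ _ => by ext; simp)
      (fun _ _ _ => by ext; simp) (fun _ _ _ => by ext; simp)) 1
    (fun A h => by
      rw [ContinuousMap.norm_le _ (by positivity)]
      intro t
      rw [one_mul]
      exact ((A t).le_opNorm _).trans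
        (mul_le_mul (A.norm_coe_le_norm t) (h.norm_coe_le_norm t) (norm_nonneg _) (norm_nonneg A)))

/-- `W'` is uniformly continuous near the compact range of `γ`, so the mean value inequality on a
ball around each `γ t` bounds the remainder by `ε ‖h‖` uniformly in `t`. -/
theorem hasFDerivAt_postcomp {G F : Type*} [NormedAddCommGroup G] [NormedSpace ℝ G]
    [NormedAddCommGroup F] [NormedSpace ℝ F] (W : C(G, F)) (W' : C(G, G →L[ℝ] F))
    (hW : ∀ x, HasFDerivAt W (W' x) x) (γ : C(K, G)) :
    HasFDerivAt (fun γ : C(K, G) => W.comp γ) (pointwiseApply K G F (W'.comp γ)) γ := by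
  rw [hasFDerivAt_iff_isLittleO_nhds_zero, Asymptotics.isLittleO_iff]
  intro ε hε
  have hcomp : IsCompact (Set.range γ) := isCompact_range γ.continuous
  have hu := hcomp.uniformContinuousAt_of_continuousAt W'
    (fun x _ => W'.continuous.continuousAt) (Metric.dist_mem_uniformity hε)
  obtain ⟨δ, hδ, hδ'⟩ := Metric.mem_uniformity_dist.1 hu
  filter_upwards [Metric.ball_mem_nhds (0 : C(K, G)) hδ] with h hh
  rw [ContinuousMap.norm_le _ (by positivity)]
  intro t
  have hht : ‖h t‖ < δ := (h.norm_coe_le_norm t).trans_lt (by simpa using hh)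
  have hmv := (convex_ball (γ t) δ).norm_image_sub_le_of_norm_hasFDerivWithin_le' (f := W)
    (f' := fun x => W' x) (φ := W' (γ t)) (C := ε) (x := γ t) (y := γ t + h t)
    (fun x _ => (hW x).hasFDerivWithinAt)
    (fun x hx => by
      have := hδ' (a := γ t) (b := x) (by rw [dist_comm]; exact hx) ⟨t, rfl⟩
      rw [← dist_eq_norm, dist_comm]
      exact le_of_lt this)
    (Metric.mem_ball_self hδ) (by simpa using hht)
  have : ‖W (γ t + h t) - W (γ t) - W' (γ t) (h t)‖ ≤ ε * ‖h t‖ := by simpa using hmv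
  exact this.trans (mul_le_mul_of_nonneg_left (h.norm_coe_le_norm t) hε.le)

/-- Induction on `n`: the derivative is superposition by `W'` followed by a fixed bounded operator.
The target passes from `F` to `G →L[ℝ] F` in the induction, hence the common universe. -/
theorem contDiff_postcomp_nat {G : Type u} [NormedAddCommGroup G] [NormedSpace ℝ G] (n : ℕ) :
    ∀ {F : Type u} [NormedAddCommGroup F] [NormedSpace ℝ F] (W : C(G, F)),
    ContDiff ℝ n W → ContDiff ℝ n (fun γ : C(K, G) => W.comp γ) := by
  induction n with
  | zero =>
    intro F _ _ W _
    exact contDiff_zero.2 W.continuous_postcomp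
  | succ n ih =>
    intro F _ _ W hW
    have hW' : ContDiff ℝ n (fderiv ℝ W) := hW.fderiv_right (by norm_cast)
    let W' : C(G, G →L[ℝ] F) := ⟨fderiv ℝ W, hW'.continuous⟩
    have hd : ∀ x, HasFDerivAt W (W' x) x := fun x =>
      (hW.differentiable (by simp) x).hasFDerivAt
    have hB : ContDiff ℝ n (fun γ : C(K, G) => pointwiseApply K G F (W'.comp γ)) :=
      ContDiff.comp (g := pointwiseApply K G F) (ContinuousLinearMap.contDiff _) (ih W' hW')
    have := (contDiff_succ_iff_hasFDerivAt (𝕜 := ℝ) (n := n)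
      (f := fun γ : C(K, G) => W.comp γ)).2
      ⟨fun γ => pointwiseApply K G F (W'.comp γ), hB,
        hasFDerivAt_postcomp W W' hd⟩
    exact_mod_cast this

theorem contDiff_postcomp {G F : Type u} [NormedAddCommGroup G] [NormedSpace ℝ G]
    [NormedAddCommGroup F] [NormedSpace ℝ F] (W : C(G, F)) (hW : ContDiff ℝ ∞ W) :
    ContDiff ℝ ∞ (fun γ : C(K, G) => W.comp γ) :=
  contDiff_infty.2 fun n => contDiff_postcomp_nat n W (hW.of_le (by exact_mod_cast le_top))

end Superposition

/-! ### Global inversion of perturbations of the identity. -/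

section Perturbation

variable {B : Type*} [NormedAddCommGroup B] [NormedSpace ℝ B] [CompleteSpace B]

/-- A smooth perturbation of the identity by a strict contraction is a diffeomorphism. -/
theorem exists_homeomorph_add_contraction {N : B → B} (hN : ContDiff ℝ ∞ N) {c : NNReal}
    (hc : c < 1) (hL : LipschitzWith c N) :
    ∃ Ψ : B ≃ₜ B, (∀ x, Ψ x = x + N x) ∧ ContDiff ℝ ∞ Ψ ∧ ContDiff ℝ ∞ Ψ.symm := by
  -- The identity operator has norm 1 only on a nontrivial space.
  rcases subsingleton_or_nontrivial B with hB | hB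
  · refine ⟨Homeomorph.refl B, fun x => Subsingleton.elim _ _, contDiff_id, contDiff_id⟩
  have hA : ApproximatesLinearOn (fun x => x + N x)
      ((ContinuousLinearEquiv.refl ℝ B : B ≃L[ℝ] B) : B →L[ℝ] B) Set.univ c := by
    intro x _ y _
    have := hL.dist_le_mul x y
    rw [dist_eq_norm, dist_eq_norm] at this
    have h : x + N x - (y + N y) - (x - y) = N x - N y := by abel
    rw [← h] at this
    exact this
  have hc' : c < ‖(((ContinuousLinearEquiv.refl ℝ B).symm : B ≃L[ℝ] B) : B →L[ℝ] B)‖₊⁻¹ := by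
    have : ‖(((ContinuousLinearEquiv.refl ℝ B).symm : B ≃L[ℝ] B) : B →L[ℝ] B)‖₊ = 1 := by
      ext
      exact ContinuousLinearMap.norm_id
    rwa [this, inv_one]
  let Ψ : B ≃ₜ B := hA.toHomeomorph _ (Or.inr hc')
  have hΨ : ∀ x, Ψ x = x + N x := fun x => rfl
  have hs : ContDiff ℝ ∞ Ψ := contDiff_id.add hN
  refine ⟨Ψ, hΨ, hs, contDiff_iff_contDiffAt.2 fun y => ?_⟩
  have hNd : HasFDerivAt N (fderiv ℝ N (Ψ.symm y)) (Ψ.symm y) :=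
    (hN.differentiable (by simp) _).hasFDerivAt
  have hnorm : ‖-fderiv ℝ N (Ψ.symm y)‖ < 1 := by
    rw [norm_neg]
    exact (norm_fderiv_le_of_lipschitz ℝ hL).trans_lt (by exact_mod_cast hc)
  -- The derivative `1 - (-N')` is invertible by the Neumann series, so the inverse map is smooth.
  let U : (B →L[ℝ] B)ˣ := Units.oneSub _ hnorm
  have hd : HasFDerivAt Ψ.toOpenPartialHomeomorph
      ((ContinuousLinearEquiv.unitsEquiv ℝ B U : B ≃L[ℝ] B) : B →L[ℝ] B)
      (Ψ.toOpenPartialHomeomorph.symm y) := by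
    have h1 : HasFDerivAt (fun x => x + N x) (ContinuousLinearMap.id ℝ B + fderiv ℝ N (Ψ.symm y))
      (Ψ.symm y) := (hasFDerivAt_id _).add hNd
    have h2 : ((ContinuousLinearEquiv.unitsEquiv ℝ B U : B ≃L[ℝ] B) : B →L[ℝ] B) =
        ContinuousLinearMap.id ℝ B + fderiv ℝ N (Ψ.symm y) := by
      ext v
      simp [U]
    rw [h2]
    exact h1
  exact Ψ.toOpenPartialHomeomorph.contDiffAt_symm (Set.mem_univ _) hd hs.contDiffAt

end Perturbation

/-! ### Flows of time-dependent vector fields, as solutions of an integral equation. -/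

section Flow

variable {E : Type*} [NormedAddCommGroup E]

/-- A continuous path on the unit interval, extended to the real line by constants. -/
def extendPath (g : C(unitInterval, E)) (t : ℝ) : E := g (Set.projIcc 0 1 zero_le_one t)

theorem continuous_extendPath (g : C(unitInterval, E)) : Continuous (extendPath g) :=
  g.continuous.comp continuous_projIcc

theorem extendPath_coe (g : C(unitInterval, E)) (t : unitInterval) : extendPath g t = g t := by
  simp [extendPath]

theorem norm_extendPath_le (g : C(unitInterval, E)) (t : ℝ) : ‖extendPath g t‖ ≤ ‖g‖ :=
  g.norm_coe_le_norm _

variable [NormedSpace ℝ E]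

/-- The space-time path `t ↦ (t, γ t)`. -/
def graphPath (γ : C(unitInterval, E)) : C(unitInterval, ℝ × E) :=
  ⟨fun t => ((t : ℝ), γ t), by fun_prop⟩

theorem graphPath_eq : (graphPath (E := E)) = fun γ =>
    (ContinuousLinearMap.inr ℝ ℝ E).compLeftContinuous ℝ unitInterval γ + graphPath 0 := by
  funext γ
  ext t <;> simp [graphPath]

theorem contDiff_graphPath : ContDiff ℝ ∞ (graphPath (E := E)) := by
  rw [graphPath_eq]
  exact (ContinuousLinearMap.contDiff _).add contDiff_const

variable [CompleteSpace E]

theorem hasDerivAt_integral_extendPath (g : C(unitInterval, E)) (t : ℝ) :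
    HasDerivAt (fun u => ∫ s in (0 : ℝ)..u, extendPath g s) (extendPath g t) t :=
  ((continuous_extendPath g).integral_hasStrictDerivAt 0 t).hasDerivAt

variable (E) in
/-- The operator `g ↦ (t ↦ ∫₀ᵗ g)` on continuous paths. -/
def integralOperator : C(unitInterval, E) →L[ℝ] C(unitInterval, E) :=
  LinearMap.mkContinuous
    { toFun := fun g => ⟨fun t => ∫ s in (0 : ℝ)..t, extendPath g s, by
        have h : Continuous (fun u => ∫ s in (0 : ℝ)..u, extendPath g s) :=
          continuous_iff_continuousAt.2 fun t => (hasDerivAt_integral_extendPath g t).continuousAt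
        exact h.comp continuous_subtype_val⟩
      map_add' := fun g h => by
        ext t
        exact intervalIntegral.integral_add ((continuous_extendPath g).intervalIntegrable _ _)
          ((continuous_extendPath h).intervalIntegrable _ _)
      map_smul' := fun c g => by
        ext t
        exact intervalIntegral.integral_smul c _ } 1
    (fun g => by
      rw [one_mul, ContinuousMap.norm_le _ (norm_nonneg _)]
      intro t
      have h := intervalIntegral.norm_integral_le_of_norm_le_const (a := 0) (b := (t : ℝ))
        (f := extendPath g) (C := ‖g‖) (fun s _ => norm_extendPath_le g s)
      refine h.trans ?_
      rw [sub_zero, abs_of_nonneg t.2.1]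
      exact mul_le_of_le_one_right (norm_nonneg _) t.2.2)

theorem integralOperator_apply (g : C(unitInterval, E)) (t : unitInterval) :
    integralOperator E g t = ∫ s in (0 : ℝ)..t, extendPath g s := rfl

theorem norm_integralOperator_le (g : C(unitInterval, E)) : ‖integralOperator E g‖ ≤ ‖g‖ := by
  simpa using (integralOperator E).le_of_opNorm_le
    (LinearMap.mkContinuous_norm_le _ zero_le_one _) g

/-- Differentiating a path given by an integral. -/
theorem hasDerivWithinAt_of_eq_integralOperator {p g : C(unitInterval, E)} {x : E}
    (h : p = ContinuousMap.const _ x + integralOperator E g) {t : ℝ} (ht : t ∈ Set.Icc (0 : ℝ) 1) :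
    HasDerivWithinAt (extendPath p) (extendPath g t) (Set.Icc 0 1) t := by
  have h1 : HasDerivWithinAt (fun u => x + ∫ s in (0 : ℝ)..u, extendPath g s) (extendPath g t)
      (Set.Icc 0 1) t := ((hasDerivAt_integral_extendPath g t).const_add x).hasDerivWithinAt
  have h2 : ∀ u ∈ Set.Icc (0 : ℝ) 1, extendPath p u = x + ∫ s in (0 : ℝ)..u, extendPath g s := by
    intro u hu
    have := extendPath_coe p ⟨u, hu⟩
    rw [h] at this
    rw [h]
    exact this
  exact h1.congr h2 (h2 t ht)

/-- The solution through `x` is the preimage of the constant path `x` under `p ↦ p - ∫ V(s, p(s))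
ds`, a contraction perturbation of the identity on `C([0,1], E)`; hence it depends smoothly on `x`.
Here `γ x` is the trajectory, `D x v` its derivative in the initial condition and `Ψ` the time-one
map. The bound `1 / 2` makes `Ψ - id` a contraction too, so `Ψ` is a diffeomorphism without running
the flow backwards. Paths are constant outside `[0, 1]`, so the last two clauses hold for all real
`t`. -/
theorem exists_flow {V : ℝ × E → E} (hV : ContDiff ℝ ∞ V) {c : NNReal} (hc : c < 1 / 2)
    (hL : ∀ t, LipschitzWith c fun x => V (t, x)) :
    ∃ (γ : E → ℝ → E) (D : E → E → ℝ → E) (Ψ : E ≃ₜ E),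
      ContDiff ℝ ∞ Ψ ∧ ContDiff ℝ ∞ Ψ.symm ∧ (∀ x, γ x 0 = x) ∧ (∀ x, γ x 1 = Ψ x) ∧
      (∀ x v, D x v 0 = v) ∧ (∀ x v, D x v 1 = fderiv ℝ Ψ x v) ∧
      (∀ x, ∀ t ∈ Set.Icc (0 : ℝ) 1,
        HasDerivWithinAt (γ x) (V (t, γ x t)) (Set.Icc 0 1) t) ∧
      (∀ x v, ∀ t ∈ Set.Icc (0 : ℝ) 1,
        HasDerivWithinAt (D x v) (fderiv ℝ (fun y => V (t, y)) (γ x t) (D x v t))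
          (Set.Icc 0 1) t) ∧
      (∀ x, (∀ t, V (t, x) = 0) → ∀ t, γ x t = x) ∧
      (∀ x C, (∀ p, ‖V p‖ ≤ C) → ∀ t, ‖γ x t - x‖ ≤ C) := by
  let Vc : C(ℝ × E, E) := ⟨V, hV.continuous⟩
  let V' : C(ℝ × E, ℝ × E →L[ℝ] E) := ⟨fderiv ℝ V, (hV.fderiv_right (m := ∞) (by simp)).continuous⟩
  let S : C(unitInterval, E) → C(unitInterval, E) := fun γ => Vc.comp (graphPath γ)
  have hS : ContDiff ℝ ∞ S := (contDiff_postcomp Vc hV).comp contDiff_graphPath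
  have hSL : LipschitzWith c S := by
    refine LipschitzWith.of_dist_le_mul fun p q => ?_
    rw [ContinuousMap.dist_le (by positivity)]
    intro t
    exact ((hL t).dist_le_mul (p t) (q t)).trans
      (mul_le_mul_of_nonneg_left (ContinuousMap.dist_apply_le_dist t) c.2)
  let N : C(unitInterval, E) → C(unitInterval, E) := fun γ => -integralOperator E (S γ)
  have hN : ContDiff ℝ ∞ N := ((integralOperator E).contDiff.comp hS).neg
  have hNL : LipschitzWith c N := by
    refine LipschitzWith.of_dist_le_mul fun p q => ?_
    have h1 := hSL.dist_le_mul p q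
    rw [dist_eq_norm] at h1 ⊢
    have h2 : N p - N q = -(integralOperator E (S p - S q)) := by
      simp only [N, map_sub]; abel
    rw [h2, norm_neg]
    exact (norm_integralOperator_le _).trans h1
  obtain ⟨Θ, hΘ, hΘs, hΘs'⟩ := exists_homeomorph_add_contraction hN
    (hc.trans (by norm_num [div_lt_one])) hNL
  let κ : E →L[ℝ] C(unitInterval, E) := ContinuousLinearMap.const ℝ unitInterval
  have hκ : ∀ x t, κ x t = x := fun x t => rfl
  let P : E → C(unitInterval, E) := fun x => Θ.symm (κ x)
  have hP : ContDiff ℝ ∞ P := hΘs'.comp κ.contDiff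
  have hPeq : ∀ x, P x = κ x + integralOperator E (S (P x)) := by
    intro x
    have := hΘ (P x)
    rw [Θ.apply_symm_apply] at this
    rw [this]
    simp [N]
  -- Differentiating the integral equation in the initial condition gives the variational equation
  -- in integrated form.
  have hPder : ∀ x v, fderiv ℝ P x v = κ v + integralOperator E
      (pointwiseApply unitInterval (ℝ × E) E (V'.comp (graphPath (P x)))
        ((ContinuousLinearMap.inr ℝ ℝ E).compLeftContinuous ℝ unitInterval (fderiv ℝ P x v))) := by
    intro x v
    have h1 : HasFDerivAt P (fderiv ℝ P x) x := (hP.differentiable (by simp) x).hasFDerivAt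
    have h2 : HasFDerivAt (graphPath (E := E))
        ((ContinuousLinearMap.inr ℝ ℝ E).compLeftContinuous ℝ unitInterval) (P x) := by
      rw [graphPath_eq]
      exact (ContinuousLinearMap.hasFDerivAt _).add_const _
    have h3 : HasFDerivAt S _ (P x) := (hasFDerivAt_postcomp Vc V'
      (fun y => (hV.differentiable (by simp) y).hasFDerivAt) (graphPath (P x))).comp (P x) h2
    have h4 := (κ.hasFDerivAt (x := x)).add
      (((integralOperator E).hasFDerivAt (x := S (P x))).comp x (h3.comp x h1))
    have h5 := h1.unique (h4.congr_of_eventuallyEq (Filter.Eventually.of_forall hPeq))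
    exact congrArg (fun A : E →L[ℝ] C(unitInterval, E) => A v) h5
  have hev : ∀ t : unitInterval, ContDiff ℝ ∞ fun p : C(unitInterval, E) => p t := fun t =>
    ContinuousLinearMap.contDiff (ContinuousMap.evalCLM ℝ t : C(unitInterval, E) →L[ℝ] E)
  have h01 : (0 : ℝ) = ((0 : unitInterval) : ℝ) := rfl
  have h11 : (1 : ℝ) = ((1 : unitInterval) : ℝ) := rfl
  have hP0 : ∀ x, P x 0 = x := by
    intro x
    rw [hPeq x, ContinuousMap.add_apply, integralOperator_apply]
    simp [hκ]
  have hPL : ∀ x y, ‖P x - P y‖ ≤ ‖x - y‖ + c * ‖P x - P y‖ := by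
    intro x y
    have h1 : P x - P y = κ (x - y) + integralOperator E (S (P x) - S (P y)) := by
      conv_lhs => rw [hPeq x, hPeq y]
      rw [map_sub, map_sub]; abel
    have h2 : ‖κ (x - y)‖ ≤ ‖x - y‖ := (ContinuousMap.norm_le _ (norm_nonneg _)).2 fun t => le_rfl
    have h3 := hSL.dist_le_mul (P x) (P y)
    rw [dist_eq_norm, dist_eq_norm] at h3
    calc ‖P x - P y‖ = ‖κ (x - y) + integralOperator E (S (P x) - S (P y))‖ := by rw [← h1]
      _ ≤ _ := (norm_add_le _ _).trans (add_le_add h2 ((norm_integralOperator_le _).trans h3))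
  let Q : E → E := fun x => P x 1 - x
  have hQ : ContDiff ℝ ∞ Q := ((hev 1).comp hP).sub contDiff_id
  have hc2 : (c : ℝ) < 1 / 2 := by exact_mod_cast hc
  have hc1 : (0 : ℝ) < 1 - c := by linarith
  -- `P` is Lipschitz with constant `1 / (1 - c)`, and `Q` is the integral of the `c`-Lipschitz `S`
  -- along `P`.
  let c' : NNReal := ⟨c / (1 - c), div_nonneg c.2 hc1.le⟩
  have hc' : c' < 1 := by
    have : (c : ℝ) / (1 - c) < 1 := by rw [div_lt_one hc1]; linarith
    exact_mod_cast this
  have hQL : LipschitzWith c' Q := by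
    refine LipschitzWith.of_dist_le_mul fun x y => ?_
    rw [dist_eq_norm, dist_eq_norm]
    have h1 : Q x - Q y = integralOperator E (S (P x) - S (P y)) 1 := by
      have e : ∀ z, Q z = integralOperator E (S (P z)) 1 := by
        intro z
        change P z 1 - z = _
        conv_lhs => rw [hPeq z]
        simp [hκ]
      rw [e, e, map_sub]; rfl
    have h3 := hSL.dist_le_mul (P x) (P y)
    rw [dist_eq_norm, dist_eq_norm] at h3
    have h4 : ‖Q x - Q y‖ ≤ c * ‖P x - P y‖ := by
      rw [h1]
      exact (ContinuousMap.norm_coe_le_norm _ _).trans ((norm_integralOperator_le _).trans h3)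
    have h5 : ‖P x - P y‖ ≤ ‖x - y‖ / (1 - c) := by
      rw [le_div_iff₀ hc1]
      linarith [hPL x y]
    refine h4.trans ((mul_le_mul_of_nonneg_left h5 c.2).trans (le_of_eq ?_))
    change (c : ℝ) * (‖x - y‖ / (1 - c)) = (c / (1 - c)) * ‖x - y‖
    ring
  obtain ⟨Ψ, hΨ, hΨs, hΨs'⟩ := exists_homeomorph_add_contraction hQ hc' hQL
  have hΨ1 : ∀ x, Ψ x = P x 1 := fun x => by rw [hΨ]; simp [Q]
  refine ⟨fun x => extendPath (P x), fun x v => extendPath (fderiv ℝ P x v), Ψ, hΨs, hΨs',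
    ?_, ?_, ?_, ?_, ?_, ?_, ?_, ?_⟩
  · intro x
    beta_reduce
    rw [h01, extendPath_coe, hP0]
  · intro x
    beta_reduce
    rw [h11, extendPath_coe, hΨ1]
  · intro x v
    beta_reduce
    rw [h01, extendPath_coe, hPder, ContinuousMap.add_apply, integralOperator_apply]
    simp [hκ]
  · intro x v
    beta_reduce
    rw [h11, extendPath_coe]
    have h1 : HasFDerivAt P (fderiv ℝ P x) x := (hP.differentiable (by simp) x).hasFDerivAt
    have h2 : HasFDerivAt (fun x => P x 1) _ x :=
      HasFDerivAt.comp (g := fun p : C(unitInterval, E) => p 1) x (ContinuousLinearMap.hasFDerivAt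
        (ContinuousMap.evalCLM ℝ (1 : unitInterval) : C(unitInterval, E) →L[ℝ] E)) h1
    have h3 : (Ψ : E → E) = fun x => P x 1 := funext hΨ1
    rw [h3, h2.fderiv]
    rfl
  · intro x t ht
    have h := hasDerivWithinAt_of_eq_integralOperator (hPeq x) ht
    have e : extendPath (S (P x)) t = V (t, extendPath (P x) t) := by
      rw [show t = ((⟨t, ht⟩ : unitInterval) : ℝ) from rfl, extendPath_coe, extendPath_coe]
      rfl
    rwa [e] at h
  · intro x v t ht
    have h := hasDerivWithinAt_of_eq_integralOperator (hPder x v) ht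
    convert h using 1
    beta_reduce
    rw [show t = ((⟨t, ht⟩ : unitInterval) : ℝ) from rfl, extendPath_coe, extendPath_coe,
      extendPath_coe]
    have h1 : HasFDerivAt (fun y => V (t, y)) _ (P x ⟨t, ht⟩) :=
      ((hV.differentiable (by simp) (t, P x ⟨t, ht⟩)).hasFDerivAt).comp (P x ⟨t, ht⟩)
        (hasFDerivAt_prodMk_right t (P x ⟨t, ht⟩))
    change fderiv ℝ (fun y => V (t, y)) (P x ⟨t, ht⟩) _ = _
    rw [h1.fderiv]
    rfl
  · intro x hx t
    have h1 : Θ (κ x) = κ x := by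
      rw [hΘ]
      have : S (κ x) = 0 := by
        ext t
        exact hx t
      simp [N, this]
    have h2 : P x = κ x := by
      change Θ.symm (κ x) = κ x
      rw [Homeomorph.symm_apply_eq, h1]
    simp only [h2]
    rfl
  · intro x C hC t
    have h1 : P x (Set.projIcc 0 1 zero_le_one t) - x =
        integralOperator E (S (P x)) (Set.projIcc 0 1 zero_le_one t) := by
      conv_lhs => rw [hPeq x]
      simp [hκ]
    change ‖P x (Set.projIcc 0 1 zero_le_one t) - x‖ ≤ C
    rw [h1]
    refine (ContinuousMap.norm_coe_le_norm _ _).trans ((norm_integralOperator_le _).trans ?_)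
    exact (ContinuousMap.norm_le _ ((norm_nonneg _).trans (hC (0, x)))).2 fun t => hC _

end Flow

/-! ### Linear algebra of `1`- and `2`-forms and the infinitesimal Moser identity. -/

section Bilinear

variable {E : Type*} [NormedAddCommGroup E] [NormedSpace ℝ E]

variable (E) in
/-- A `1`-form as a linear functional. -/
def oneFormCLM : (E [⋀^Fin 1]→L[ℝ] ℝ) →L[ℝ] E →L[ℝ] ℝ :=
  ((ContinuousAlternatingMap.ofSubsingletonLIE (𝕜 := ℝ) (E := E) (F := ℝ) (0 : Fin 1)).symm.toContinuousLinearEquiv :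
    (E [⋀^Fin 1]→L[ℝ] ℝ) →L[ℝ] E →L[ℝ] ℝ)

theorem oneFormCLM_apply (β : E [⋀^Fin 1]→L[ℝ] ℝ) (b : E) : oneFormCLM E β b = β ![b] := by
  have : (![b] : Fin 1 → E) = fun _ => b := by
    funext i
    fin_cases i
    rfl
  rw [this]
  rfl

variable (E) in
/-- A `2`-form as a bilinear form. -/
def toBilin : (E [⋀^Fin 2]→L[ℝ] ℝ) →L[ℝ] E →L[ℝ] E →L[ℝ] ℝ :=
  (ContinuousLinearMap.compL ℝ E (E [⋀^Fin 1]→L[ℝ] ℝ) (E →L[ℝ] ℝ) (oneFormCLM E)) ∘L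
    (ContinuousAlternatingMap.curryLeftLI
      (𝕜 := ℝ) (E := E) (F := ℝ) (n := 1)).toContinuousLinearMap

theorem toBilin_apply (σ : E [⋀^Fin 2]→L[ℝ] ℝ) (a b : E) : toBilin E σ a b = σ ![a, b] := by
  change oneFormCLM E (σ.curryLeft a) b = _
  rw [oneFormCLM_apply, ContinuousAlternatingMap.curryLeft_apply_apply]

theorem toBilin_swap (σ : E [⋀^Fin 2]→L[ℝ] ℝ) (a b : E) :
    toBilin E σ a b = -toBilin E σ b a := by
  rw [toBilin_apply, toBilin_apply]
  have h := σ.map_swap ![b, a] (i := 0) (j := 1) (by simp)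
  have e : ![b, a] ∘ Equiv.swap (0 : Fin 2) 1 = ![a, b] := by
    funext i
    fin_cases i <;> rfl
  rw [e] at h
  exact h

theorem twoForm_ext {σ τ : E [⋀^Fin 2]→L[ℝ] ℝ} (h : ∀ a b, σ ![a, b] = τ ![a, b]) : σ = τ := by
  ext v
  have hv : v = ![v 0, v 1] := by
    funext i
    fin_cases i <;> rfl
  rw [hv]
  exact h _ _

theorem extDeriv_oneForm_apply (β : E → E [⋀^Fin 1]→L[ℝ] ℝ) (x a b : E) :
    extDeriv β x ![a, b] = fderiv ℝ β x a ![b] - fderiv ℝ β x b ![a] := by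
  rw [extDeriv, ContinuousAlternatingMap.alternatizeUncurryFin_apply, Fin.sum_univ_two]
  have h0 : Fin.removeNth 0 ![a, b] = ![b] := by
    funext i; fin_cases i; rfl
  have h1 : Fin.removeNth 1 ![a, b] = ![a] := by
    funext i; fin_cases i; rfl
  simp only [h0, h1]
  simp
  ring

theorem extDeriv_twoForm_apply (σ : E → E [⋀^Fin 2]→L[ℝ] ℝ) (x u a b : E) :
    extDeriv σ x ![u, a, b] =
      fderiv ℝ σ x u ![a, b] - fderiv ℝ σ x a ![u, b] + fderiv ℝ σ x b ![u, a] := by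
  rw [extDeriv, ContinuousAlternatingMap.alternatizeUncurryFin_apply, Fin.sum_univ_three]
  have h0 : Fin.removeNth 0 ![u, a, b] = ![a, b] := by
    funext i; fin_cases i <;> rfl
  have h1 : Fin.removeNth 1 ![u, a, b] = ![u, b] := by
    funext i; fin_cases i <;> rfl
  have h2 : Fin.removeNth 2 ![u, a, b] = ![u, a] := by
    funext i; fin_cases i <;> rfl
  simp only [h0, h1, h2]
  simp
  ring

/-- Nondegeneracy is injectivity of `E → E*`, and the dimensions agree. Invertibility is the form of
the condition that is visibly open. -/
theorem isInvertible_toBilin [FiniteDimensional ℝ E] {σ : E [⋀^Fin 2]→L[ℝ] ℝ}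
    (h : ∀ v, (∀ w, σ ![v, w] = 0) → v = 0) : (toBilin E σ).IsInvertible := by
  have hinj : Function.Injective (toBilin E σ) := by
    rw [injective_iff_map_eq_zero]
    intro v hv
    exact h v fun w => by rw [← toBilin_apply, hv]; rfl
  have hd : Module.finrank ℝ E = Module.finrank ℝ (E →L[ℝ] ℝ) := by
    rw [← (LinearMap.toContinuousLinearMap (𝕜 := ℝ) (E := E) (F' := ℝ)).finrank_eq]
    exact (Subspace.dual_finrank_eq (K := ℝ) (V := E)).symm
  let e := LinearEquiv.ofInjectiveOfFinrankEq (toBilin E σ : E →ₗ[ℝ] E →L[ℝ] ℝ) hinj hd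
  exact ⟨e.toContinuousLinearEquiv, by ext; rfl⟩

theorem nondegenerate_of_isInvertible {σ : E [⋀^Fin 2]→L[ℝ] ℝ} (h : (toBilin E σ).IsInvertible)
    (v : E) (hv : ∀ w, σ ![v, w] = 0) : v = 0 := by
  obtain ⟨e, he⟩ := h
  have h0 : toBilin E σ v = 0 := by
    ext w
    rw [toBilin_apply, hv]; rfl
  rw [← he] at h0
  exact e.map_eq_zero_iff.1 h0

/-- The infinitesimal Moser identity: `L_w σ + dβ = 0` if `σ` is closed and `ι_w σ = -β`. -/
theorem lieDerivative_add_extDeriv_eq_zero {σ : E → E [⋀^Fin 2]→L[ℝ] ℝ}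
    {β : E → E [⋀^Fin 1]→L[ℝ] ℝ} {w : E → E} {p : E} (hσ : DifferentiableAt ℝ σ p)
    (hβ : DifferentiableAt ℝ β p) (hw : DifferentiableAt ℝ w p) (hcl : extDeriv σ p = 0)
    (h : ∀ᶠ y in 𝓝 p, toBilin E (σ y) (w y) = -oneFormCLM E (β y)) (a b : E) :
    toBilin E (extDeriv β p) a b + toBilin E (fderiv ℝ σ p (w p)) a b +
      toBilin E (σ p) (fderiv ℝ w p a) b + toBilin E (σ p) a (fderiv ℝ w p b) = 0 := by
  -- The derivative of `ι_w σ = -β` in the direction `a`; antisymmetrising it in `a, b` and adding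
  -- `dσ(w, a, b) = 0` gives the claim.
  have key : ∀ a b, toBilin E (fderiv ℝ σ p a) (w p) b + toBilin E (σ p) (fderiv ℝ w p a) b =
      -oneFormCLM E (fderiv ℝ β p a) b := by
    intro a b
    have h1 : HasFDerivAt (fun y => toBilin E (σ y)) _ p :=
      HasFDerivAt.comp (g := toBilin E) p (ContinuousLinearMap.hasFDerivAt _) hσ.hasFDerivAt
    have h2 := h1.clm_apply hw.hasFDerivAt
    have h3 : HasFDerivAt (fun y => -oneFormCLM E (β y)) _ p :=
      (HasFDerivAt.comp (g := oneFormCLM E) p (ContinuousLinearMap.hasFDerivAt _)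
        hβ.hasFDerivAt).neg
    have h4 := h2.unique (h3.congr_of_eventuallyEq h)
    have h5 := congrArg (fun A : E →L[ℝ] E →L[ℝ] ℝ => A a b) h4
    simp at h5
    linarith
  have hab := key a b
  have hba := key b a
  have hc : extDeriv σ p ![w p, a, b] = 0 := by rw [hcl]; rfl
  rw [extDeriv_twoForm_apply] at hc
  have hsw := toBilin_swap (σ p) a (fderiv ℝ w p b)
  simp only [toBilin_apply, oneFormCLM_apply, extDeriv_oneForm_apply] at *
  linarith

end Bilinear

/-! ### Moser's argument on an open subset of the model space. -/

section LocalMoser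

variable {E : Type*} [NormedAddCommGroup E] [NormedSpace ℝ E]

theorem extDeriv_eq_zero_of_notMem_tsupport {k : ℕ} {β : E → E [⋀^Fin k]→L[ℝ] ℝ} {x : E}
    (hx : x ∉ tsupport β) : extDeriv β x = 0 := by
  have h : β =ᶠ[𝓝 x] fun _ => 0 := notMem_tsupport_iff_eventuallyEq.1 hx
  rw [h.extDeriv_eq]
  have h0 : fderiv ℝ (fun _ : E => (0 : E [⋀^Fin k]→L[ℝ] ℝ)) x = 0 := by simp
  ext v
  rw [extDeriv, ContinuousAlternatingMap.alternatizeUncurryFin_apply, h0]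
  simp

theorem contDiff_extDeriv {k : ℕ} {β : E → E [⋀^Fin k]→L[ℝ] ℝ} (hβ : ContDiff ℝ ∞ β) :
    ContDiff ℝ ∞ (extDeriv β) :=
  ContDiff.comp (g := ContinuousAlternatingMap.alternatizeUncurryFinCLM ℝ E ℝ)
    (ContinuousLinearMap.contDiff _) (hβ.fderiv_right (m := ∞) (by simp))

theorem extDeriv_add_smul_extDeriv {σ : E → E [⋀^Fin 2]→L[ℝ] ℝ} {β : E → E [⋀^Fin 1]→L[ℝ] ℝ}
    {p : E} (hσ : DifferentiableAt ℝ σ p) (hβ : ContDiff ℝ ∞ β) (τ : ℝ) :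
    extDeriv (σ + τ • extDeriv β) p = extDeriv σ p := by
  have h1 : DifferentiableAt ℝ (extDeriv β) p :=
    ((contDiff_extDeriv hβ).differentiable (by simp)) p
  have h2 : extDeriv (extDeriv β) p = 0 := by
    rw [extDeriv_extDeriv hβ (by simpa using (WithTop.coe_le_coe.2 (le_top : (2 : ℕ∞) ≤ ⊤)))]
    rfl
  rw [extDeriv_add hσ (h1.const_smul τ), extDeriv_smul, h2, smul_zero, add_zero]

variable [FiniteDimensional ℝ E]

theorem isOpen_setOf_isInvertible : IsOpen {A : E →L[ℝ] E →L[ℝ] ℝ | A.IsInvertible} := by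
  have : CompleteSpace E := FiniteDimensional.complete ℝ E
  exact ContinuousLinearEquiv.isOpen

variable {T : Set E} {σ : E → E [⋀^Fin 2]→L[ℝ] ℝ} {β : E → E [⋀^Fin 1]→L[ℝ] ℝ}

/-- A compactly supported time-dependent vector field solving Moser's equation
`ι_W (σ + τ dβ) = -β` for small times `τ`. -/
theorem exists_moser_vectorField (hT : IsOpen T) (hσ : ContDiffOn ℝ ∞ σ T)
    (hnd : ∀ x ∈ T, ∀ v, (∀ w, σ x ![v, w] = 0) → v = 0)
    (hβ : ContDiff ℝ ∞ β) (hc : HasCompactSupport β) (hβT : tsupport β ⊆ T) :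
    ∃ W : ℝ × E → E, ContDiff ℝ ∞ W ∧ HasCompactSupport W ∧
      (∀ τ, ∀ x ∉ tsupport β, W (τ, x) = 0) ∧
      ∃ r > 0, ∀ τ, |τ| ≤ r → ∀ x,
        toBilin E ((σ + τ • extDeriv β) x) (W (τ, x)) = -oneFormCLM E (β x) := by
  have hEc : CompleteSpace E := FiniteDimensional.complete ℝ E
  let B : ℝ × E → E →L[ℝ] E →L[ℝ] ℝ := fun q => toBilin E ((σ + q.1 • extDeriv β) q.2)
  have hB : ∀ q : ℝ × E, q.2 ∈ T → ContDiffAt ℝ ∞ B q := by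
    intro q hq
    have h1 : ContDiffAt ℝ ∞ (fun q : ℝ × E => σ q.2) q :=
      ((hσ.contDiffAt (hT.mem_nhds hq)).comp q contDiffAt_snd :)
    have h2 : ContDiffAt ℝ ∞ (fun q : ℝ × E => q.1 • extDeriv β q.2) q :=
      contDiffAt_fst.smul (((contDiff_extDeriv hβ).contDiffAt).comp q contDiffAt_snd :)
    exact ContDiffAt.comp (g := toBilin E) q (ContinuousLinearMap.contDiff _).contDiffAt
      (h1.add h2)
  have hev : ∀ᶠ τ in 𝓝 (0 : ℝ), ∀ x ∈ tsupport β, (B (τ, x)).IsInvertible := by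
    refine hc.isCompact.eventually_forall_of_forall_eventually
      (P := fun τ x => (B (τ, x)).IsInvertible) fun x hx => ?_
    refine (hB (0, x) (hβT hx)).continuousAt.preimage_mem_nhds
      (isOpen_setOf_isInvertible.mem_nhds ?_)
    have : B (0, x) = toBilin E (σ x) := by
      change toBilin E (σ x + (0 : ℝ) • extDeriv β x) = _
      rw [zero_smul, add_zero]
    change (B (0, x)).IsInvertible
    rw [this]
    exact isInvertible_toBilin (hnd x (hβT hx))
  obtain ⟨δ, hδ, hδ'⟩ := Metric.eventually_nhds_iff.1 hev
  -- The cutoff in time makes `W` global with compact support, so that it is bounded and Lipschitz;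
  -- Moser's equation is kept for `|τ| ≤ δ / 4`.
  let χ : ContDiffBump (0 : ℝ) := ⟨δ / 4, δ / 2, by positivity, by linarith⟩
  -- Where `B q` is not invertible its `inverse` is zero by convention; smoothness is not at stake
  -- there, since invertibility holds on the support of `β` for `|τ| < δ` and one of the other
  -- factors vanishes elsewhere.
  let W : ℝ × E → E := fun q => -(χ q.1 • (B q).inverse (oneFormCLM E (β q.2)))
  have hzero : ∀ τ, ∀ x ∉ tsupport β, W (τ, x) = 0 := by
    intro τ x hx
    simp [W, image_eq_zero_of_notMem_tsupport hx]
  refine ⟨W, ?_, ?_, hzero, δ / 4, by positivity, ?_⟩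
  · rw [contDiff_iff_contDiffAt]
    rintro ⟨τ, x⟩
    by_cases hx : x ∈ tsupport β
    · by_cases hτ : |τ| < δ
      · obtain ⟨e, he⟩ := hδ' (y := τ) (by simpa using hτ) x hx
        have h1 : ContDiffAt ℝ ∞ (fun q => (B q).inverse) (τ, x) := by
          refine ContDiffAt.comp (g := ContinuousLinearMap.inverse) (τ, x) ?_ (hB (τ, x) (hβT hx))
          rw [← he]
          exact contDiffAt_map_inverse e
        have h2 : ContDiffAt ℝ ∞ (fun q : ℝ × E => oneFormCLM E (β q.2)) (τ, x) :=
          ContDiffAt.comp (g := oneFormCLM E) (τ, x) (ContinuousLinearMap.contDiff _).contDiffAt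
            (hβ.contDiffAt.comp (τ, x) contDiffAt_snd)
        have h3 : ContDiffAt ℝ ∞ (fun q : ℝ × E => χ q.1) (τ, x) :=
          χ.contDiff.contDiffAt.comp (τ, x) contDiffAt_fst
        exact (h3.smul (h1.clm_apply h2)).neg
      · have : W =ᶠ[𝓝 (τ, x)] fun _ => 0 := by
          have : ∀ᶠ q : ℝ × E in 𝓝 (τ, x), δ / 2 < |q.1| :=
            (continuous_fst.abs.tendsto (τ, x)).eventually_const_lt (by simp; linarith)
          filter_upwards [this] with q hq
          have : χ q.1 = 0 := χ.zero_of_le_dist (by simpa [χ] using hq.le)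
          simp [W, this]
        exact contDiffAt_const.congr_of_eventuallyEq this
    · have : W =ᶠ[𝓝 (τ, x)] fun _ => 0 := by
        have : ∀ᶠ q : ℝ × E in 𝓝 (τ, x), q.2 ∉ tsupport β :=
          (continuous_snd.tendsto (τ, x)).eventually
            ((isClosed_tsupport β).isOpen_compl.mem_nhds hx)
        filter_upwards [this] with q hq
        exact hzero q.1 q.2 hq
      exact contDiffAt_const.congr_of_eventuallyEq this
  · refine HasCompactSupport.intro ((isCompact_closedBall (0 : ℝ) (δ / 2)).prod hc.isCompact) ?_
    rintro ⟨τ, x⟩ hq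
    by_cases hx : x ∈ tsupport β
    · have : χ τ = 0 := χ.zero_of_le_dist (by
        by_contra hlt
        refine hq ⟨?_, hx⟩
        exact (not_le.1 hlt).le)
      simp [W, this]
    · exact hzero τ x hx
  · intro τ hτ x
    by_cases hx : x ∈ tsupport β
    · have hinv : (B (τ, x)).IsInvertible := hδ' (y := τ) (by simp; linarith) x hx
      have h1 : χ τ = 1 := χ.one_of_mem_closedBall (by simpa [χ] using hτ)
      obtain ⟨e, he⟩ := hinv
      change B (τ, x) (-(χ τ • (B (τ, x)).inverse (oneFormCLM E (β x)))) = _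
      rw [← he, h1]
      simp
    · rw [hzero τ x hx, image_eq_zero_of_notMem_tsupport hx]
      simp

/-- Moser's theorem for a small compactly supported exact perturbation on an open set. -/
theorem exists_local_moser (hT : IsOpen T) (hσ : ContDiffOn ℝ ∞ σ T)
    (hcl : ∀ x ∈ T, extDeriv σ x = 0) (hnd : ∀ x ∈ T, ∀ v, (∀ w, σ x ![v, w] = 0) → v = 0)
    (hβ : ContDiff ℝ ∞ β) (hc : HasCompactSupport β) (hβT : tsupport β ⊆ T) :
    ∃ s₀ > 0, ∀ s : ℝ, |s| ≤ s₀ → ∃ Ψ : E ≃ₜ E, ContDiff ℝ ∞ Ψ ∧ ContDiff ℝ ∞ Ψ.symm ∧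
      (∀ x ∉ tsupport β, Ψ x = x) ∧
      ∀ x ∈ T, Ψ x ∈ T ∧
        ((σ + s • extDeriv β) (Ψ x)).compContinuousLinearMap (fderiv ℝ Ψ x) = σ x := by
  have hEc : CompleteSpace E := FiniteDimensional.complete ℝ E
  obtain ⟨W, hW, hWc, hWz, r, hr, hWr⟩ := exists_moser_vectorField hT hσ hnd hβ hc hβT
  obtain ⟨L, hL⟩ := hW.lipschitzWith_of_hasCompactSupport hWc (by simp)
  obtain ⟨C, hC⟩ := hWc.exists_bound_of_continuous hW.continuous
  have hC0 : 0 ≤ C := (norm_nonneg _).trans (hC 0)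
  obtain ⟨d, hd, hdT⟩ := hc.isCompact.exists_thickening_subset_open hT hβT
  -- The three bounds keep Moser's equation valid, keep trajectories starting in the support of `β`
  -- inside `T`, and keep the Lipschitz constant below `1 / 2`.
  refine ⟨min r (min (d / (2 * (C + 1))) (1 / (4 * (L + 1)))), by positivity, fun s hs => ?_⟩
  have hs1 : |s| ≤ r := hs.trans (min_le_left _ _)
  have hs2 : |s| * C < d := by
    have h := hs.trans ((min_le_right _ _).trans (min_le_left _ _))
    rw [le_div_iff₀ (by positivity)] at h
    nlinarith [abs_nonneg s]
  have hs3 : |s| * L < 1 / 2 := by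
    have h := hs.trans ((min_le_right _ _).trans (min_le_right _ _))
    rw [le_div_iff₀ (by positivity)] at h
    nlinarith [abs_nonneg s, L.2]
  -- Time is rescaled so that the parameter interval from `0` to `s` becomes `[0, 1]`.
  let V : ℝ × E → E := fun q => s • W (s * q.1, q.2)
  have hV : ContDiff ℝ ∞ V :=
    contDiff_const.smul (hW.comp ((contDiff_const.mul contDiff_fst).prodMk contDiff_snd))
  have hVL : ∀ t, LipschitzWith (‖s‖₊ * L) fun x => V (t, x) := by
    intro t
    refine LipschitzWith.of_dist_le_mul fun x y => ?_
    have h := hL.dist_le_mul (s * t, x) (s * t, y)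
    have h' : dist (s * t, x) (s * t, y) = dist x y := by simp [Prod.dist_eq]
    rw [h'] at h
    change dist (s • _) (s • _) ≤ _
    rw [dist_smul₀]
    push_cast
    rw [mul_assoc]
    exact mul_le_mul_of_nonneg_left h (norm_nonneg s)
  obtain ⟨γ, D, Ψ, hΨ, hΨ', hγ0, hγ1, hD0, hD1, hγd, hDd, hγc, hγb⟩ := exists_flow hV
    (c := ‖s‖₊ * L) (by rw [← NNReal.coe_lt_coe]; push_cast; simpa using hs3) hVL
  have hfix : ∀ x ∉ tsupport β, Ψ x = x := fun x hx => by
    rw [← hγ1]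
    exact hγc x (fun t => by simp [V, hWz _ x hx]) 1
  refine ⟨Ψ, hΨ, hΨ', hfix, fun x hxT => ?_⟩
  by_cases hx : x ∈ tsupport β
  swap
  · refine ⟨by rwa [hfix x hx], ?_⟩
    have h1 : (Ψ : E → E) =ᶠ[𝓝 x] id := by
      filter_upwards [(isClosed_tsupport β).isOpen_compl.mem_nhds hx] with y hy
      exact hfix y hy
    rw [h1.fderiv_eq, fderiv_id, hfix x hx]
    simp only [Pi.add_apply, Pi.smul_apply, extDeriv_eq_zero_of_notMem_tsupport hx, smul_zero,
      add_zero]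
    rfl
  have hγT : ∀ t, γ x t ∈ T := by
    intro t
    refine hdT (Metric.mem_thickening_iff.2 ⟨x, hx, ?_⟩)
    rw [dist_eq_norm]
    refine (hγb x (|s| * C) (fun q => ?_) t).trans_lt hs2
    rw [norm_smul]
    exact mul_le_mul_of_nonneg_left (hC _) (norm_nonneg s)
  refine ⟨by rw [← hγ1]; exact hγT 1, twoForm_ext fun a b => ?_⟩
  -- The pullback of `σ + st dβ` by the flow at time `t`, evaluated on `a, b`. Its derivative is `s`
  -- times the infinitesimal Moser identity, hence zero; comparing `t = 0` and `t = 1` gives the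
  -- theorem.
  let φ : ℝ → ℝ := fun t =>
    toBilin E (σ (γ x t) + (s * t) • extDeriv β (γ x t)) (D x a t) (D x b t)
  have hφ : ∀ t ∈ Set.Icc (0 : ℝ) 1, HasDerivWithinAt φ 0 (Set.Icc 0 1) t := by
    intro t ht
    have hst : |s * t| ≤ r := by
      rw [abs_mul, abs_of_nonneg ht.1]
      exact (mul_le_of_le_one_right (abs_nonneg s) ht.2).trans hs1
    have hσd : DifferentiableAt ℝ σ (γ x t) :=
      ((hσ.contDiffAt (hT.mem_nhds (hγT t))).differentiableAt (by simp))
    have hβd : DifferentiableAt ℝ (extDeriv β) (γ x t) :=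
      ((contDiff_extDeriv hβ).differentiable (by simp)) _
    have hσtd : DifferentiableAt ℝ (σ + (s * t) • extDeriv β) (γ x t) :=
      hσd.add (hβd.const_smul _)
    have hwd : DifferentiableAt ℝ (fun y => W (s * t, y)) (γ x t) :=
      ((hW.comp (contDiff_const.prodMk contDiff_id)).differentiable (by simp)) _
    have hid := lieDerivative_add_extDeriv_eq_zero hσtd (hβ.differentiable (by simp) _) hwd
      (by rw [extDeriv_add_smul_extDeriv hσd hβ, hcl _ (hγT t)])
      (Filter.Eventually.of_forall (hWr (s * t) hst)) (D x a t) (D x b t)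
    have hγ' := hγd x t ht
    have hf1 : HasDerivWithinAt (fun t => σ (γ x t)) _ (Set.Icc 0 1) t :=
      hσd.hasFDerivAt.comp_hasDerivWithinAt t hγ'
    have hf2 : HasDerivWithinAt (fun t => extDeriv β (γ x t)) _ (Set.Icc 0 1) t :=
      hβd.hasFDerivAt.comp_hasDerivWithinAt t hγ'
    have hf3 : HasDerivWithinAt (fun t => s * t) s (Set.Icc 0 1) t := by
      simpa using ((hasDerivAt_id t).const_mul s).hasDerivWithinAt
    have hf4 : HasDerivWithinAt
        (fun t => toBilin E (σ (γ x t) + (s * t) • extDeriv β (γ x t))) _ (Set.Icc 0 1) t :=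
      HasFDerivAt.comp_hasDerivWithinAt (l := toBilin E) t (ContinuousLinearMap.hasFDerivAt _)
        (hf1.add (hf3.smul hf2))
    have hf5 := (hf4.clm_apply (hDd x a t ht)).clm_apply (hDd x b t ht)
    refine hf5.congr_deriv ?_
    have hfd : fderiv ℝ (fun y => V (t, y)) (γ x t) =
        s • fderiv ℝ (fun y => W (s * t, y)) (γ x t) := fderiv_const_smul hwd s
    have hσ' : fderiv ℝ (σ + (s * t) • extDeriv β) (γ x t) =
        fderiv ℝ σ (γ x t) + (s * t) • fderiv ℝ (extDeriv β) (γ x t) := by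
      rw [fderiv_add hσd (hβd.const_smul _), fderiv_const_smul hβd]
    rw [hσ'] at hid
    rw [hfd]
    simp only [V, map_smul, map_add, add_apply, smul_apply,
      smul_eq_mul, Pi.add_apply, Pi.smul_apply] at hid ⊢
    linear_combination s * hid
  have hconst := constant_of_derivWithin_zero (f := φ) (a := 0) (b := 1)
    (fun t ht => (hφ t ht).differentiableWithinAt)
    (fun t ht => (hφ t (Set.Ico_subset_Icc_self ht)).derivWithin
      ((uniqueDiffOn_Icc zero_lt_one) t (Set.Ico_subset_Icc_self ht))) 1 (by simp)
  simp only [φ, hγ0, hγ1, hD0, hD1, mul_zero, zero_smul, add_zero, mul_one, toBilin_apply]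
    at hconst
  rw [← hconst]
  change ((σ + s • extDeriv β) (Ψ x)) (fderiv ℝ Ψ x ∘ ![a, b]) = _
  congr 1
  funext i
  fin_cases i <;> rfl

end LocalMoser

/-! ### Differential forms on a manifold read in charts. -/

section FormsInCharts

variable {E : Type*} [NormedAddCommGroup E] [NormedSpace ℝ E]
  {M : Type*} [TopologicalSpace M] [ChartedSpace E M] {k : ℕ}

theorem pullback_id (σ : Form E M k) : pullback (E := E) (id : M → M) σ = σ := by
  funext x
  simp only [pullback, mfderiv_id]
  ext v
  rfl

theorem pullback_eq_self_of_eventuallyEq_id {f : M → M} {x : M} (h : f =ᶠ[𝓝 x] id)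
    (σ : Form E M k) : pullback (E := E) f σ x = σ x := by
  rw [pullback_congr h, pullback_id]

theorem extDeriv_zero_of_eventuallyEq {σ : E → E [⋀^Fin k]→L[ℝ] ℝ} {x : E}
    (h : σ =ᶠ[𝓝 x] fun _ => 0) : extDeriv σ x = 0 :=
  extDeriv_eq_zero_of_notMem_tsupport (notMem_tsupport_iff_eventuallyEq.2 h)

theorem IsSmooth.contDiffAt_of_mem {σ : Form E M k} (hσ : IsSmooth σ)
    {e : OpenPartialHomeomorph M E} (he : e ∈ atlas E M) {y : E} (hy : y ∈ e.target) :
    ContDiffAt ℝ ∞ (coordRep e σ) y :=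
  (hσ e he).contDiffAt (e.open_target.mem_nhds hy)

theorem coordRep_eventuallyEq_zero {σ : Form E M k} {x : M} (h : ∀ᶠ z in 𝓝 x, σ z = 0)
    {e : OpenPartialHomeomorph M E} (hx : x ∈ e.source) :
    coordRep e σ =ᶠ[𝓝 (e x)] fun _ => 0 := by
  have hc : ContinuousAt e.symm (e x) := e.symm.continuousAt (e.map_source hx)
  have h' : ∀ᶠ y in 𝓝 (e x), σ (e.symm y) = 0 := by
    refine hc.eventually (p := fun z => σ z = 0) ?_
    rwa [e.left_inv hx]
  filter_upwards [h'] with y hy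
  simp only [coordRep, pullback, hy]
  rfl

theorem extD_eq_zero_of_eventually {σ : Form E M k} {x : M} (h : ∀ᶠ z in 𝓝 x, σ z = 0) :
    extD σ x = 0 := by
  rw [extD_apply]
  simp only [pullback]
  rw [extDeriv_zero_of_eventuallyEq (coordRep_eventuallyEq_zero h (mem_chart_source E x))]
  rfl

variable [IsManifold 𝓘(ℝ, E) ∞ M]

theorem contMDiffAt_of_mem_atlas {e : OpenPartialHomeomorph M E} (he : e ∈ atlas E M) {x : M}
    (hx : x ∈ e.source) : ContMDiffAt 𝓘(ℝ, E) 𝓘(ℝ, E) ∞ e x :=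
  (contMDiffOn_of_mem_maximalAtlas
    (IsManifold.subset_maximalAtlas (I := 𝓘(ℝ, E)) (n := ∞) he)).contMDiffAt
    (e.open_source.mem_nhds hx)

theorem contMDiffAt_symm_of_mem_atlas {e : OpenPartialHomeomorph M E} (he : e ∈ atlas E M) {y : E}
    (hy : y ∈ e.target) : ContMDiffAt 𝓘(ℝ, E) 𝓘(ℝ, E) ∞ e.symm y :=
  (contMDiffOn_symm_of_mem_maximalAtlas
    (IsManifold.subset_maximalAtlas (I := 𝓘(ℝ, E)) (n := ∞) he)).contMDiffAt
    (e.open_target.mem_nhds hy)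

theorem pullback_coordRep {e : OpenPartialHomeomorph M E} (he : e ∈ atlas E M) {x : M}
    (hx : x ∈ e.source) (σ : Form E M k) :
    pullback (E := E) (N := E) e (coordRep e σ) x = σ x := by
  have h := pullback_comp (E := E) (F := E) (G := E) (g := e.symm) (f := e) (x := x)
    ((contMDiffAt_symm_of_mem_atlas he (e.map_source hx)).mdifferentiableAt (by simp))
    ((contMDiffAt_of_mem_atlas he hx).mdifferentiableAt (by simp)) σ
  refine h.symm.trans (pullback_eq_self_of_eventuallyEq_id ?_ σ)
  filter_upwards [e.open_source.mem_nhds hx] with z hz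
  exact e.left_inv hz

theorem coordRep_change {e e' : OpenPartialHomeomorph M E} (he : e ∈ atlas E M)
    (he' : e' ∈ atlas E M) (σ : Form E M k) {y : E} (hy : y ∈ e.target)
    (hy' : e.symm y ∈ e'.source) :
    ContDiffAt ℝ ∞ (e' ∘ e.symm) y ∧ coordRep e σ =ᶠ[𝓝 y] fun z =>
      (coordRep e' σ ((e' ∘ e.symm) z)).compContinuousLinearMap (fderiv ℝ (e' ∘ e.symm) z) := by
  have h := coordRep_pullback (f := (id : M → M)) contMDiff_id σ he he' hy hy'
  rwa [pullback_id] at h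

/-- `extD` uses a different preferred chart at each point. Naturality of `extDeriv` under the change
of charts shows that every chart of the atlas computes it, which makes it possible to differentiate
`extD σ` again. -/
theorem coordRep_extD {σ : Form E M k} (hσ : IsSmooth σ) {e : OpenPartialHomeomorph M E}
    (he : e ∈ atlas E M) {y : E} (hy : y ∈ e.target) :
    coordRep e (extD σ) y = extDeriv (coordRep e σ) y := by
  set x := e.symm y with hx
  set e' := chartAt E x with he'
  have hxe' : x ∈ e'.source := mem_chart_source E x
  obtain ⟨h1, h2⟩ := coordRep_change he (chart_mem_atlas E x) σ hy hxe'
  have h3 : extDeriv (coordRep e σ) y =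
      (extDeriv (coordRep e' σ) ((e' ∘ e.symm) y)).compContinuousLinearMap
        (fderiv ℝ (e' ∘ e.symm) y) := by
    rw [h2.extDeriv_eq]
    exact extDeriv_pullback (hσ.differentiableAt x) h1
      (by simpa using (WithTop.coe_le_coe.2 (le_top : (2 : ℕ∞) ≤ ⊤)))
  have h4 := pullback_comp (E := E) (F := E) (G := E) (g := e') (f := e.symm) (x := y)
    ((contMDiffAt_of_mem_atlas (chart_mem_atlas E x) hxe').mdifferentiableAt (by simp))
    ((contMDiffAt_symm_of_mem_atlas he hy).mdifferentiableAt (by simp))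
    (extDeriv (coordRep e' σ) : Form E E (k + 1))
  have h5 : coordRep e (extD σ) y = pullback (E := E) (M := E) e.symm
      (pullback (E := E) (N := E) e' (extDeriv (coordRep e' σ) : Form E E (k + 1))) y :=
    pullback_congr_form e.symm (extD_apply σ x)
  rw [h5, ← h4, h3]
  simp only [pullback, mfderiv_eq_fderiv]
  rfl

theorem IsSmooth.extD {σ : Form E M k} (hσ : IsSmooth σ) : IsSmooth (extD σ) := by
  intro e he y hy
  refine ContDiffAt.contDiffWithinAt ?_
  have h1 : coordRep e (SymplecticCover.extD σ) =ᶠ[𝓝 y] extDeriv (coordRep e σ) := by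
    filter_upwards [e.open_target.mem_nhds hy] with z hz
    exact coordRep_extD hσ he hz
  refine ContDiffAt.congr_of_eventuallyEq ?_ h1
  exact ContDiffAt.comp (g := ContinuousAlternatingMap.alternatizeUncurryFinCLM ℝ E ℝ) y
    (ContinuousLinearMap.contDiff _).contDiffAt
    ((hσ.contDiffAt_of_mem he hy).fderiv_right (m := ∞) (by simp))

theorem extD_extD {σ : Form E M k} (hσ : IsSmooth σ) : extD (extD σ) = 0 := by
  funext x
  have h1 : coordRep (chartAt E x) (extD σ) =ᶠ[𝓝 (chartAt E x x)]
      extDeriv (coordRep (chartAt E x) σ) := by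
    filter_upwards [(chartAt E x).open_target.mem_nhds (mem_chart_target E x)] with z hz
    exact coordRep_extD hσ (chart_mem_atlas E x) hz
  have h2 : extDeriv (coordRep (chartAt E x) (extD σ)) (chartAt E x x) = 0 := by
    rw [h1.extDeriv_eq]
    exact extDeriv_extDeriv_apply (hσ.contDiffAt x)
      (by simpa using (WithTop.coe_le_coe.2 (le_top : (2 : ℕ∞) ≤ ⊤)))
  rw [extD_apply]
  simp only [pullback]
  rw [h2]
  rfl

end FormsInCharts

/-! ### Nondegeneracy of `2`-forms in charts. -/

section Nondegenerate

variable {E : Type*} [NormedAddCommGroup E] [NormedSpace ℝ E]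
  {M : Type*} [TopologicalSpace M] [ChartedSpace E M]

/-- A `2`-form is nondegenerate if no nonzero tangent vector is orthogonal to all others. -/
def IsNondegenerate (σ : Form E M 2) : Prop :=
  ∀ (x : M) (v : TangentSpace 𝓘(ℝ, E) x), (∀ w, σ x ![v, w] = 0) → v = 0

theorem compContinuousLinearMap_pair {F : Type*} [NormedAddCommGroup F] [NormedSpace ℝ F]
    (σ : F [⋀^Fin 2]→L[ℝ] ℝ) (A : E →L[ℝ] F) (a b : E) :
    σ.compContinuousLinearMap A ![a, b] = σ ![A a, A b] := by
  change σ (A ∘ ![a, b]) = _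
  congr 1
  funext i
  fin_cases i <;> rfl

theorem pullback_pair {F : Type*} [NormedAddCommGroup F] [NormedSpace ℝ F]
    {N : Type*} [TopologicalSpace N] [ChartedSpace F N] (f : M → N) (σ : Form F N 2) (x : M)
    (a b : TangentSpace 𝓘(ℝ, E) x) : pullback (E := E) f σ x ![a, b] =
      σ (f x) ![mfderiv 𝓘(ℝ, E) 𝓘(ℝ, F) f x a, mfderiv 𝓘(ℝ, E) 𝓘(ℝ, F) f x b] :=
  compContinuousLinearMap_pair (E := E) (F := F) (σ (f x)) (mfderiv 𝓘(ℝ, E) 𝓘(ℝ, F) f x) a b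

theorem coordRep_pair (e : OpenPartialHomeomorph M E) (σ : Form E M 2) (y a b : E) :
    coordRep e σ y ![a, b] = σ (e.symm y)
      ![mfderiv 𝓘(ℝ, E) 𝓘(ℝ, E) e.symm y a, mfderiv 𝓘(ℝ, E) 𝓘(ℝ, E) e.symm y b] :=
  pullback_pair (M := E) e.symm σ y a b

variable [IsManifold 𝓘(ℝ, E) ∞ M]

theorem mfderiv_symm_mfderiv {e : OpenPartialHomeomorph M E} (he : e ∈ atlas E M) {x : M}
    (hx : x ∈ e.source) (v : TangentSpace 𝓘(ℝ, E) x) :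
    mfderiv 𝓘(ℝ, E) 𝓘(ℝ, E) e.symm (e x) (mfderiv 𝓘(ℝ, E) 𝓘(ℝ, E) e x v) = v := by
  have h := mfderiv_comp (I := 𝓘(ℝ, E)) (I' := 𝓘(ℝ, E)) (I'' := 𝓘(ℝ, E)) x
    ((contMDiffAt_symm_of_mem_atlas he (e.map_source hx)).mdifferentiableAt (by simp))
    ((contMDiffAt_of_mem_atlas he hx).mdifferentiableAt (by simp))
  have h2 : e.symm ∘ e =ᶠ[𝓝 x] id := by
    filter_upwards [e.open_source.mem_nhds hx] with z hz
    exact e.left_inv hz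
  have h3 : (mfderiv 𝓘(ℝ, E) 𝓘(ℝ, E) (e.symm ∘ e) x : E →L[ℝ] E) =
      mfderiv 𝓘(ℝ, E) 𝓘(ℝ, E) (id : M → M) x := h2.mfderiv_eq
  rw [mfderiv_id] at h3
  have h4 : (mfderiv 𝓘(ℝ, E) 𝓘(ℝ, E) (e.symm ∘ e) x : E →L[ℝ] E) v = v := by rw [h3]; rfl
  rw [h] at h4
  exact h4

theorem mfderiv_mfderiv_symm {e : OpenPartialHomeomorph M E} (he : e ∈ atlas E M) {y : E}
    (hy : y ∈ e.target) (v : E) :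
    mfderiv 𝓘(ℝ, E) 𝓘(ℝ, E) e (e.symm y) (mfderiv 𝓘(ℝ, E) 𝓘(ℝ, E) e.symm y v) = v := by
  have h := mfderiv_comp (I := 𝓘(ℝ, E)) (I' := 𝓘(ℝ, E)) (I'' := 𝓘(ℝ, E)) (f := e.symm) (g := e) y
    ((contMDiffAt_of_mem_atlas he (e.map_target hy)).mdifferentiableAt (by simp))
    ((contMDiffAt_symm_of_mem_atlas he hy).mdifferentiableAt (by simp))
  have h2 : e ∘ e.symm =ᶠ[𝓝 y] id := by
    filter_upwards [e.open_target.mem_nhds hy] with z hz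
    exact e.right_inv hz
  have h3 : (mfderiv 𝓘(ℝ, E) 𝓘(ℝ, E) (e ∘ e.symm) y : E →L[ℝ] E) =
      mfderiv 𝓘(ℝ, E) 𝓘(ℝ, E) (id : E → E) y := h2.mfderiv_eq
  rw [mfderiv_id] at h3
  have h4 : (mfderiv 𝓘(ℝ, E) 𝓘(ℝ, E) (e ∘ e.symm) y : E →L[ℝ] E) v = v := by rw [h3]; rfl
  rw [h] at h4
  exact h4

theorem coordRep_nondegenerate {e : OpenPartialHomeomorph M E} (he : e ∈ atlas E M) {y : E}
    (hy : y ∈ e.target) {σ : Form E M 2}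
    (h : ∀ v : TangentSpace 𝓘(ℝ, E) (e.symm y), (∀ w, σ (e.symm y) ![v, w] = 0) → v = 0)
    (v : E) (hv : ∀ w, coordRep e σ y ![v, w] = 0) : v = 0 := by
  have h1 := h (mfderiv 𝓘(ℝ, E) 𝓘(ℝ, E) e.symm y v) fun w => by
    have h2 := (coordRep_pair e σ y v _).symm.trans
      (hv (mfderiv 𝓘(ℝ, E) 𝓘(ℝ, E) e (e.symm y) w))
    have h3 := mfderiv_symm_mfderiv he (e.map_target hy) w
    rw [e.right_inv hy] at h3
    exact (congrArg (fun u : E => (σ (e.symm y) : E [⋀^Fin 2]→L[ℝ] ℝ)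
      ![mfderiv 𝓘(ℝ, E) 𝓘(ℝ, E) e.symm y v, u]) h3).symm.trans h2
  have h2 := mfderiv_mfderiv_symm he hy v
  rw [h1] at h2
  rw [← h2]
  exact map_zero _

theorem nondegenerate_of_coordRep {e : OpenPartialHomeomorph M E} (he : e ∈ atlas E M) {x : M}
    (hx : x ∈ e.source) {σ : Form E M 2}
    (h : ∀ v, (∀ w, coordRep e σ (e x) ![v, w] = 0) → v = 0)
    (v : TangentSpace 𝓘(ℝ, E) x) (hv : ∀ w, σ x ![v, w] = 0) : v = 0 := by
  have h1 := h (mfderiv 𝓘(ℝ, E) 𝓘(ℝ, E) e x v) fun w => by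
    -- The point is made a variable so that `e.symm (e x) = x` can be substituted in the dependent
    -- type of the form.
    have key : ∀ (p : M) (_ : p = x) (v' w' : E) (_ : v' = v),
        (σ p : E [⋀^Fin 2]→L[ℝ] ℝ) ![v', w'] = 0 := by
      rintro p rfl v' w' rfl
      exact hv w'
    exact (coordRep_pair e σ (e x) _ w).trans
      (key _ (e.left_inv hx) _ _ (mfderiv_symm_mfderiv he hx v))
  have h2 := mfderiv_symm_mfderiv he hx v
  rw [h1] at h2
  rw [← h2]
  exact map_zero _

end Nondegenerate

/-! ### Transporting compactly supported diffeomorphisms from a chart to the manifold. -/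

section ExtendByIdentity

variable {E : Type*} [TopologicalSpace E] {M : Type*} [TopologicalSpace M]

open Classical in
/-- A self-map of the model space, transported to `M` by the chart `e` and extended by the
identity. -/
def extendById (e : OpenPartialHomeomorph M E) (ψ : E → E) (x : M) : M :=
  if x ∈ e.source then e.symm (ψ (e x)) else x

variable {e : OpenPartialHomeomorph M E} {ψ : E → E} {K : Set E}

theorem extendById_of_mem {x : M} (hx : x ∈ e.source) :
    extendById e ψ x = e.symm (ψ (e x)) := if_pos hx

theorem extendById_eventuallyEq {x : M} (hx : x ∈ e.source) :
    extendById e ψ =ᶠ[𝓝 x] e.symm ∘ ψ ∘ e := by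
  filter_upwards [e.open_source.mem_nhds hx] with z hz
  exact extendById_of_mem hz

/-- The compact set carried into `M` by the chart is closed because `M` is Hausdorff, and off this
set the map is the identity. This gives smoothness at the boundary of the chart domain. -/
theorem extendById_eventuallyEq_id [T2Space M] (hK : IsCompact K) (hKe : K ⊆ e.target)
    (hψ : ∀ y ∉ K, ψ y = y) {x : M} (hx : x ∉ e.source) : extendById e ψ =ᶠ[𝓝 x] id := by
  have hc : IsCompact (e.symm '' K) := hK.image_of_continuousOn (e.symm.continuousOn.mono hKe)
  have hx' : x ∉ e.symm '' K := by
    rintro ⟨y, hy, rfl⟩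
    exact hx (e.map_target (hKe hy))
  filter_upwards [hc.isClosed.isOpen_compl.mem_nhds hx'] with z hz
  by_cases hze : z ∈ e.source
  · rw [extendById_of_mem hze, hψ, e.left_inv hze]
    · rfl
    · exact fun h => hz ⟨e z, h, e.left_inv hze⟩
  · exact if_neg hze

theorem extendById_leftInverse {ψ' : E → E} (h : Function.LeftInverse ψ' ψ)
    (hm : Set.MapsTo ψ e.target e.target) :
    Function.LeftInverse (extendById e ψ') (extendById e ψ) := by
  intro x
  by_cases hx : x ∈ e.source
  · have h1 := hm (e.map_source hx)
    rw [extendById_of_mem hx, extendById_of_mem (e.map_target h1), e.right_inv h1, h, e.left_inv hx]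
  · have h1 : ∀ φ, extendById e φ x = x := fun φ => if_neg hx
    rw [h1, h1]

theorem contMDiff_extendById {E : Type*} [NormedAddCommGroup E] [NormedSpace ℝ E] [ChartedSpace E M]
    [IsManifold 𝓘(ℝ, E) ∞ M] [T2Space M] {e : OpenPartialHomeomorph M E} {ψ : E → E} {K : Set E}
    (he : e ∈ atlas E M)
    (hK : IsCompact K) (hKe : K ⊆ e.target) (hψ : ∀ y ∉ K, ψ y = y) (hs : ContDiff ℝ ∞ ψ)
    (hm : Set.MapsTo ψ e.target e.target) :
    ContMDiff 𝓘(ℝ, E) 𝓘(ℝ, E) ∞ (extendById e ψ) := by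
  intro x
  by_cases hx : x ∈ e.source
  · refine ContMDiffAt.congr_of_eventuallyEq ?_ (extendById_eventuallyEq hx)
    exact (contMDiffAt_symm_of_mem_atlas he (hm (e.map_source hx))).comp x
      (hs.contMDiff.contMDiffAt.comp x (contMDiffAt_of_mem_atlas he hx))
  · exact contMDiffAt_id.congr_of_eventuallyEq (extendById_eventuallyEq_id hK hKe hψ hx)

end ExtendByIdentity

/-! ### Equivalence of forms under diffeomorphisms. -/

section Equivalence

variable {E : Type*} [NormedAddCommGroup E] [NormedSpace ℝ E]
  {M : Type*} [TopologicalSpace M] [ChartedSpace E M] {k : ℕ}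

/-- Two forms are equivalent if a diffeomorphism pulls one back to the other. -/
def DiffeoEquiv (σ τ : Form E M k) : Prop :=
  ∃ Φ : M ≃ₘ^∞⟮𝓘(ℝ, E), 𝓘(ℝ, E)⟯ M, pullback Φ τ = σ

theorem DiffeoEquiv.refl (σ : Form E M k) : DiffeoEquiv σ σ :=
  ⟨Diffeomorph.refl _ _ _, pullback_id σ⟩

theorem DiffeoEquiv.trans {σ τ η : Form E M k} (h₁ : DiffeoEquiv σ τ) (h₂ : DiffeoEquiv τ η) :
    DiffeoEquiv σ η := by
  obtain ⟨Φ, hΦ⟩ := h₁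
  obtain ⟨Ψ, hΨ⟩ := h₂
  refine ⟨Φ.trans Ψ, ?_⟩
  funext x
  have h := pullback_comp (g := Ψ) (f := Φ) (x := x) (Ψ.contMDiff.mdifferentiable (by simp) _)
    (Φ.contMDiff.mdifferentiable (by simp) _) η
  rw [hΨ, hΦ] at h
  exact h

theorem DiffeoEquiv.symm {σ τ : Form E M k} (h : DiffeoEquiv σ τ) : DiffeoEquiv τ σ := by
  obtain ⟨Φ, hΦ⟩ := h
  refine ⟨Φ.symm, ?_⟩
  funext x
  have h := pullback_comp (g := Φ) (f := Φ.symm) (x := x)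
    (Φ.contMDiff.mdifferentiable (by simp) _) (Φ.symm.contMDiff.mdifferentiable (by simp) _) τ
  rw [hΦ] at h
  rw [← h]
  refine pullback_eq_self_of_eventuallyEq_id (Filter.Eventually.of_forall fun z => ?_) τ
  exact Φ.apply_symm_apply z

/-- An equivalence relation on `[0, 1]` that relates every point to its neighbours relates all
points, by connectedness. Thus the step `δ` may depend on `t` without any uniformity. -/
theorem diffeoEquiv_of_forall_small {σ η : Form E M 2}
    (h : ∀ t ∈ Set.Icc (0 : ℝ) 1, ∃ δ > 0, ∀ s : ℝ, |s| ≤ δ →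
      DiffeoEquiv (σ + t • η) (σ + t • η + s • η)) : DiffeoEquiv σ (σ + η) := by
  have h01 := (isPreconnected_Icc (a := (0 : ℝ)) (b := 1)).induction₂'
    (fun t u => DiffeoEquiv (σ + t • η) (σ + u • η)) (fun t ht => ?_)
    (fun _ _ _ _ _ _ h₁ h₂ => h₁.trans h₂) (x := 0) (y := 1) (by simp) (by simp)
  · simpa using h01
  · obtain ⟨δ, hδ, hs⟩ := h t ht
    filter_upwards [mem_nhdsWithin_of_mem_nhds (Metric.ball_mem_nhds t hδ)] with u hu
    have h1 := hs (u - t) (by rw [← Real.dist_eq]; exact (Metric.mem_ball.1 hu).le)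
    rw [add_assoc, ← add_smul, add_sub_cancel] at h1
    exact ⟨h1, h1.symm⟩

end Equivalence

/-! ### Moser's theorem for a primitive supported in one chart. -/

section ChartMoser

variable {E : Type*} [NormedAddCommGroup E] [NormedSpace ℝ E]
  {M : Type*} [TopologicalSpace M] [ChartedSpace E M]

/-- A form supported in a chart is a compactly supported form on the model space. -/
theorem exists_coordRep_compactSupport {k : ℕ} {β : Form E M k} (hβ : IsSmooth β)
    {e : OpenPartialHomeomorph M E} (he : e ∈ atlas E M) {K : Set M} (hK : IsCompact K)
    (hKe : K ⊆ e.source) (hβK : ∀ x ∉ K, β x = 0) :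
    ∃ b : E → E [⋀^Fin k]→L[ℝ] ℝ, ContDiff ℝ ∞ b ∧ HasCompactSupport b ∧ tsupport b ⊆ e.target ∧
      ∀ y ∈ e.target, b =ᶠ[𝓝 y] coordRep e β := by
  classical
  have hKc : IsCompact (e '' K) := hK.image_of_continuousOn (e.continuousOn.mono hKe)
  have hKt : e '' K ⊆ e.target := by
    rintro _ ⟨x, hx, rfl⟩
    exact e.map_source (hKe hx)
  let b : E → E [⋀^Fin k]→L[ℝ] ℝ := fun y => if y ∈ e.target then coordRep e β y else 0
  have hb0 : ∀ y ∉ e '' K, b y = 0 := by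
    intro y hy
    by_cases hyt : y ∈ e.target
    · have h1 : β (e.symm y) = 0 := hβK _ fun h => hy ⟨e.symm y, h, e.right_inv hyt⟩
      rw [show b y = coordRep e β y from if_pos hyt]
      simp only [coordRep, pullback, h1]
      rfl
    · exact if_neg hyt
  have hbt : ∀ y ∈ e.target, b =ᶠ[𝓝 y] coordRep e β := by
    intro y hy
    filter_upwards [e.open_target.mem_nhds hy] with z hz
    exact if_pos hz
  have hbc : HasCompactSupport b := HasCompactSupport.intro hKc hb0
  have hsupp : tsupport b ⊆ e '' K :=
    closure_minimal (Function.support_subset_iff'.2 hb0) hKc.isClosed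
  refine ⟨b, contDiff_iff_contDiffAt.2 fun y => ?_, hbc, hsupp.trans hKt, hbt⟩
  by_cases hy : y ∈ e.target
  · exact (hβ.contDiffAt_of_mem he hy).congr_of_eventuallyEq (hbt y hy)
  · have h1 : b =ᶠ[𝓝 y] fun _ => 0 :=
      notMem_tsupport_iff_eventuallyEq.1 fun h => hy (hKt (hsupp h))
    exact contDiffAt_const.congr_of_eventuallyEq h1

variable [FiniteDimensional ℝ E] [T2Space M] [IsManifold 𝓘(ℝ, E) ∞ M]

/-- The diffeomorphism of `exists_local_moser` is the identity off a compact subset of the chart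
target, so it extends by the identity to `M`; outside the chart domain `dβ` vanishes. -/
theorem exists_diffeoEquiv_small {σ : Form E M 2} (hσ : IsSmooth σ) (hcl : extD σ = 0)
    (hnd : IsNondegenerate σ) {β : Form E M 1} (hβ : IsSmooth β)
    {e : OpenPartialHomeomorph M E} (he : e ∈ atlas E M) {K : Set M} (hK : IsCompact K)
    (hKe : K ⊆ e.source) (hβK : ∀ x ∉ K, β x = 0) :
    ∃ s₀ > 0, ∀ s : ℝ, |s| ≤ s₀ → DiffeoEquiv σ (σ + s • extD β) := by
  obtain ⟨b, hb, hbc, hbT, hbeq⟩ := exists_coordRep_compactSupport hβ he hK hKe hβK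
  have hcl' : ∀ y ∈ e.target, extDeriv (coordRep e σ) y = 0 := by
    intro y hy
    rw [← coordRep_extD hσ he hy, hcl]
    rfl
  obtain ⟨s₀, hs₀, h⟩ := exists_local_moser e.open_target (hσ e he) hcl'
    (fun y hy v hv => coordRep_nondegenerate he hy (hnd (e.symm y)) v hv) hb hbc hbT
  refine ⟨s₀, hs₀, fun s hs => ?_⟩
  obtain ⟨Ψ, hΨ, hΨ', hfix, hT⟩ := h s hs
  have hm : Set.MapsTo Ψ e.target e.target := fun y hy => (hT y hy).1
  have hfix' : ∀ y ∉ tsupport b, Ψ.symm y = y := fun y hy => by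
    rw [Homeomorph.symm_apply_eq, hfix y hy]
  -- A preimage outside the target would lie off the support, hence be fixed by `Ψ`, hence equal
  -- `y`.
  have hm' : Set.MapsTo Ψ.symm e.target e.target := by
    intro y hy
    by_contra hn
    have h1 := hfix (Ψ.symm y) fun hmem => hn (hbT hmem)
    rw [Ψ.apply_symm_apply] at h1
    exact hn (h1 ▸ hy)
  let Φ : M ≃ₘ^∞⟮𝓘(ℝ, E), 𝓘(ℝ, E)⟯ M :=
    { toFun := extendById e Ψ
      invFun := extendById e Ψ.symm
      left_inv := extendById_leftInverse Ψ.symm_apply_apply hm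
      right_inv := extendById_leftInverse Ψ.apply_symm_apply hm'
      contMDiff_toFun := contMDiff_extendById he hbc.isCompact hbT hfix hΨ hm
      contMDiff_invFun := contMDiff_extendById he hbc.isCompact hbT hfix' hΨ' hm' }
  refine ⟨Φ, ?_⟩
  funext x
  change pullback (extendById e Ψ) (σ + s • extD β) x = σ x
  by_cases hx : x ∈ e.source
  · have hy : e x ∈ e.target := e.map_source hx
    have hΨm : ∀ y, MDifferentiableAt 𝓘(ℝ, E) 𝓘(ℝ, E) Ψ y :=
      hΨ.contMDiff.mdifferentiable (by simp)
    have hem : MDifferentiableAt 𝓘(ℝ, E) 𝓘(ℝ, E) e x :=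
      (contMDiffAt_of_mem_atlas he hx).mdifferentiableAt (by simp)
    have hesm : MDifferentiableAt 𝓘(ℝ, E) 𝓘(ℝ, E) e.symm (Ψ (e x)) :=
      (contMDiffAt_symm_of_mem_atlas he (hm hy)).mdifferentiableAt (by simp)
    rw [pullback_congr (extendById_eventuallyEq hx)]
    have h1 := pullback_comp (E := E) (F := E) (G := E) (g := e.symm) (f := Ψ ∘ e) (x := x)
      hesm ((hΨm _).comp x hem) (σ + s • extD β)
    have h2 := pullback_comp (E := E) (F := E) (G := E) (g := Ψ) (f := e) (x := x)
      (hΨm _) hem (coordRep e (σ + s • extD β) : Form E E 2)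
    have h3 : pullback (E := E) (M := E) (N := E) Ψ (coordRep e (σ + s • extD β) : Form E E 2)
        (e x) = coordRep e σ (e x) := by
      have h4 : coordRep e (σ + s • extD β) (Ψ (e x)) =
          (coordRep e σ + s • extDeriv b) (Ψ (e x)) := by
        rw [coordRep_add, coordRep_smul]
        simp only [Pi.add_apply, Pi.smul_apply]
        rw [coordRep_extD hβ he (hm hy), (hbeq _ (hm hy)).extDeriv_eq]
      rw [← (hT _ hy).2]
      simp only [pullback, mfderiv_eq_fderiv]
      rw [h4]
      rfl
    exact h1.trans (h2.trans ((pullback_congr_form e h3).trans (pullback_coordRep he hx σ)))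
  · rw [pullback_eq_self_of_eventuallyEq_id
      (extendById_eventuallyEq_id hbc.isCompact hbT hfix hx)]
    have h1 : extD β x = 0 := extD_eq_zero_of_eventually (by
      filter_upwards [hK.isClosed.isOpen_compl.mem_nhds fun h => hx (hKe h)] with z hz
      exact hβK z hz)
    simp [h1]

end ChartMoser

/-! ### Finite sums and function multiples of smooth forms. -/

section FiniteSums

variable {E : Type*} [NormedAddCommGroup E] [NormedSpace ℝ E]
  {M : Type*} [TopologicalSpace M] [ChartedSpace E M] {k : ℕ} {ι : Type*}

theorem coordRep_sum (e : OpenPartialHomeomorph M E) (s : Finset ι) (σ : ι → Form E M k) :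
    coordRep e (∑ i ∈ s, σ i) = ∑ i ∈ s, coordRep e (σ i) := by
  classical
  induction s using Finset.induction with
  | empty => simp [coordRep_zero]
  | insert a s ha ih => rw [Finset.sum_insert ha, Finset.sum_insert ha, coordRep_add, ih]

theorem IsSmooth.sum {s : Finset ι} {σ : ι → Form E M k} (h : ∀ i ∈ s, IsSmooth (σ i)) :
    IsSmooth (∑ i ∈ s, σ i) := by
  classical
  induction s using Finset.induction with
  | empty => simpa using isSmooth_zero
  | insert a s ha ih =>
    rw [Finset.sum_insert ha]
    exact (h a (by simp)).add (ih fun i hi => h i (by simp [hi]))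

theorem extD_sum [IsManifold 𝓘(ℝ, E) ∞ M] {s : Finset ι} {σ : ι → Form E M k}
    (h : ∀ i ∈ s, IsSmooth (σ i)) : extD (∑ i ∈ s, σ i) = ∑ i ∈ s, extD (σ i) := by
  classical
  induction s using Finset.induction with
  | empty => simpa using extD_zero
  | insert a s ha ih =>
    have h' : ∀ i ∈ s, IsSmooth (σ i) := fun i hi => h i (by simp [hi])
    rw [Finset.sum_insert ha, Finset.sum_insert ha, extD_add (h a (by simp)) (IsSmooth.sum h'),
      ih h']

theorem IsSmooth.fun_smul [IsManifold 𝓘(ℝ, E) ∞ M] {β : Form E M k} (hβ : IsSmooth β) {ρ : M → ℝ}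
    (hρ : ContMDiff 𝓘(ℝ, E) 𝓘(ℝ, ℝ) ∞ ρ) : IsSmooth (fun x => ρ x • β x : Form E M k) := by
  intro e he y hy
  have h1 : ContDiffAt ℝ ∞ (fun y => ρ (e.symm y)) y :=
    (hρ.contMDiffAt.comp y (contMDiffAt_symm_of_mem_atlas he hy)).contDiffAt
  exact (h1.smul (hβ.contDiffAt_of_mem he hy)).contDiffWithinAt

end FiniteSums

/-! ### Moser's theorem on a compact manifold. -/

section Moser

variable {E : Type*} [NormedAddCommGroup E] [NormedSpace ℝ E] [FiniteDimensional ℝ E]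
  {M : Type*} [TopologicalSpace M] [ChartedSpace E M] [IsManifold 𝓘(ℝ, E) ∞ M]

/-- Invertibility is open jointly in the coefficients and the point, and `M` is compact. Several
coefficients are allowed so as to control all partial sums of a decomposition at once. -/
theorem eventually_isNondegenerate [CompactSpace M] {ι : Type*} [Fintype ι] {σ : Form E M 2}
    (hσ : IsSmooth σ) (hnd : IsNondegenerate σ) {η : ι → Form E M 2} (hη : ∀ i, IsSmooth (η i)) :
    ∀ᶠ c : ι → ℝ in 𝓝 0, IsNondegenerate (σ + ∑ i, c i • η i) := by
  suffices h : ∀ᶠ c : ι → ℝ in 𝓝 0, ∀ x ∈ (Set.univ : Set M),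
      ∀ v : TangentSpace 𝓘(ℝ, E) x, (∀ w, (σ + ∑ i, c i • η i) x ![v, w] = 0) → v = 0 by
    filter_upwards [h] with c hc x
    exact hc x (Set.mem_univ x)
  refine isCompact_univ.eventually_forall_of_forall_eventually
    (P := fun (c : ι → ℝ) x => ∀ v : TangentSpace 𝓘(ℝ, E) x,
      (∀ w, (σ + ∑ i, c i • η i) x ![v, w] = 0) → v = 0) fun x _ => ?_
  set e := chartAt E x with he
  have hea : e ∈ atlas E M := chart_mem_atlas E x
  have hxe : x ∈ e.source := mem_chart_source E x
  let B : (ι → ℝ) × M → E →L[ℝ] E →L[ℝ] ℝ := fun q =>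
    toBilin E (coordRep e σ (e q.2) + ∑ i, q.1 i • coordRep e (η i) (e q.2))
  have hcont : ∀ {τ : Form E M 2}, IsSmooth τ →
      ContinuousAt (fun q : (ι → ℝ) × M => coordRep e τ (e q.2)) (0, x) := by
    intro τ hτ
    have h1 : ContinuousAt (fun z => coordRep e τ (e z)) x :=
      ContinuousAt.comp (g := coordRep e τ)
        (hτ.contDiffAt_of_mem hea (e.map_source hxe)).continuousAt (e.continuousAt hxe)
    exact ContinuousAt.comp (g := fun z => coordRep e τ (e z)) (f := Prod.snd) (x := ((0 : ι → ℝ), x))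
      h1 continuousAt_snd
  have hB : ContinuousAt B (0, x) := by
    refine ContinuousAt.comp (g := toBilin E) (toBilin E).continuous.continuousAt ?_
    refine (hcont hσ).add (tendsto_finsetSum _ fun i _ => ?_)
    exact ((continuous_apply i).comp continuous_fst).continuousAt.smul (hcont (hη i))
  have hB0 : (B (0, x)).IsInvertible := by
    have h1 : B (0, x) = toBilin E (coordRep e σ (e x)) := by
      simp only [B, Pi.zero_apply, zero_smul, Finset.sum_const_zero, add_zero]
    rw [h1]
    exact isInvertible_toBilin fun v hv =>
      coordRep_nondegenerate hea (e.map_source hxe) (hnd (e.symm (e x))) v hv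
  have h1 : ∀ᶠ q in 𝓝 ((0 : ι → ℝ), x), (B q).IsInvertible :=
    hB.preimage_mem_nhds (isOpen_setOf_isInvertible.mem_nhds hB0)
  have h2 : ∀ᶠ q in 𝓝 ((0 : ι → ℝ), x), q.2 ∈ e.source :=
    (continuous_snd.tendsto _).eventually (e.open_source.mem_nhds hxe)
  filter_upwards [h1, h2] with q hq1 hq2
  refine nondegenerate_of_coordRep hea hq2 fun v hv => ?_
  refine nondegenerate_of_isInvertible hq1 v fun w => ?_
  rw [← hv w, coordRep_add, coordRep_sum]
  simp only [coordRep_smul, Pi.add_apply, Finset.sum_apply, Pi.smul_apply]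

variable [T2Space M]

theorem diffeoEquiv_of_supported_in_chart {σ : Form E M 2} (hσ : IsSmooth σ) (hcl : extD σ = 0)
    {β : Form E M 1} (hβ : IsSmooth β) {e : OpenPartialHomeomorph M E} (he : e ∈ atlas E M)
    {K : Set M} (hK : IsCompact K) (hKe : K ⊆ e.source) (hβK : ∀ x ∉ K, β x = 0)
    (hnd : ∀ t ∈ Set.Icc (0 : ℝ) 1, IsNondegenerate (σ + t • extD β)) :
    DiffeoEquiv σ (σ + extD β) :=
  diffeoEquiv_of_forall_small fun t ht =>
    exists_diffeoEquiv_small (hσ.add (hβ.extD.smul t))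
      (by rw [extD_add hσ (hβ.extD.smul t), hcl, extD_smul, extD_extD hβ, smul_zero, add_zero])
      (hnd t ht) hβ he hK hKe hβK

variable [CompactSpace M]

theorem exists_finite_decomposition {β : Form E M 1} (hβ : IsSmooth β) :
    ∃ (s : Finset M) (b : s → Form E M 1), (∀ i, IsSmooth (b i)) ∧ ∑ i, b i = β ∧
      ∀ i : s, ∃ K : Set M, IsCompact K ∧ K ⊆ (chartAt E (i : M)).source ∧ ∀ x ∉ K, b i x = 0 := by
  obtain ⟨ρ, hρ⟩ := SmoothPartitionOfUnity.exists_isSubordinate_chartAt_source 𝓘(ℝ, E) M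
  have hfin := ρ.locallyFinite.finite_nonempty_of_compact
  refine ⟨hfin.toFinset, fun i x => ρ (i : M) x • β x, fun i => hβ.fun_smul (ρ i).contMDiff, ?_,
    fun i => ⟨tsupport (ρ (i : M)), (isClosed_tsupport _).isCompact, hρ i, fun x hx => ?_⟩⟩
  · funext x
    have h1 : ∑ᶠ i, ρ i x = 1 := ρ.sum_eq_one (Set.mem_univ x)
    rw [finsum_eq_sum_of_support_subset (s := hfin.toFinset) _ (fun i hi => by
      simp only [Set.Finite.coe_toFinset, Set.mem_ofPred_eq]
      exact ⟨x, hi⟩)] at h1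
    rw [Finset.sum_apply]
    rw [← Finset.sum_smul, Finset.sum_coe_sort hfin.toFinset (fun i => ρ i x), h1, one_smul]
  · change ρ (i : M) x • β x = 0
    rw [image_eq_zero_of_notMem_tsupport hx, zero_smul]

/-- The pieces `t dβᵢ` are added one at a time, each by a diffeomorphism coming from a single chart.
For small `t` all intermediate forms are nondegenerate. -/
theorem exists_diffeoEquiv_small_of_compact {σ : Form E M 2} (hσ : IsSmooth σ) (hcl : extD σ = 0)
    (hnd : IsNondegenerate σ) {β : Form E M 1} (hβ : IsSmooth β) :
    ∃ δ > 0, ∀ t : ℝ, |t| ≤ δ → DiffeoEquiv σ (σ + t • extD β) := by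
  classical
  obtain ⟨s, b, hb, hsum, hK⟩ := exists_finite_decomposition hβ
  have hev := eventually_isNondegenerate hσ hnd (η := fun i => extD (b i)) fun i => (hb i).extD
  obtain ⟨δ, hδ, hδ'⟩ := Metric.eventually_nhds_iff.1 hev
  refine ⟨δ / 2, by positivity, fun t ht => ?_⟩
  have key : ∀ A : Finset s, DiffeoEquiv σ (σ + ∑ i ∈ A, t • extD (b i)) := by
    intro A
    induction A using Finset.induction with
    | empty => simpa using DiffeoEquiv.refl σ
    | insert j A hj ih =>
      refine ih.trans ?_
      obtain ⟨K, hKc, hKe, hKz⟩ := hK j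
      have hAs : IsSmooth (∑ i ∈ A, t • extD (b i)) :=
        IsSmooth.sum fun i _ => (hb i).extD.smul t
      have h := diffeoEquiv_of_supported_in_chart (σ := σ + ∑ i ∈ A, t • extD (b i))
        (hσ.add hAs)
        (by
          rw [extD_add hσ hAs, hcl, extD_sum fun i _ => (hb i).extD.smul t, zero_add]
          exact Finset.sum_eq_zero fun i _ => by rw [extD_smul, extD_extD (hb i), smul_zero])
        ((hb j).smul t) (chart_mem_atlas E (j : M)) hKc hKe
        (fun x hx => by
          change t • b j x = 0
          rw [hKz x hx, smul_zero])
        (fun u hu => by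
          -- Coefficients of an intermediate form: the pieces in `A` are complete and the piece `j`
          -- is partly added. Since `j ∉ A`, all are at most `δ / 2` in absolute value.
          let c : s → ℝ := fun i => (if i ∈ A then t else 0) + if i = j then u * t else 0
          have hc : ∑ i, c i • extD (b i) =
              ∑ i ∈ A, t • extD (b i) + u • extD (t • b j) := by
            simp only [c, add_smul, ite_smul, zero_smul, Finset.sum_add_distrib,
              Finset.sum_ite_mem, Finset.univ_inter, Finset.sum_ite_eq', Finset.mem_univ, if_true,
              extD_smul, smul_smul]
          have hcn : dist c 0 < δ := by
            refine lt_of_le_of_lt ((dist_pi_le_iff (by positivity)).2 fun i => ?_)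
              (half_lt_self hδ)
            rw [Pi.zero_apply, Real.dist_eq, sub_zero]
            have hut : |u * t| ≤ δ / 2 := by
              rw [abs_mul, abs_of_nonneg hu.1]
              exact (mul_le_of_le_one_left (abs_nonneg t) hu.2).trans ht
            by_cases hij : i = j
            · subst hij
              simpa [c, hj] using hut
            · by_cases hiA : i ∈ A
              · simpa [c, hij, hiA] using ht
              · simp [c, hij, hiA]; positivity
          have h1 := hδ' hcn
          rw [hc, ← add_assoc] at h1
          exact h1)
      rw [extD_smul] at h
      rwa [Finset.sum_insert hj, add_comm (t • extD (b j)), ← add_assoc]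
  have h := key Finset.univ
  rwa [← Finset.smul_sum, ← extD_sum fun i _ => hb i, hsum] at h

/-- **Moser's theorem** for a segment of cohomologous symplectic forms on a compact manifold. -/
theorem moser {σ : Form E M 2} (hσ : IsSmooth σ) (hcl : extD σ = 0) {β : Form E M 1}
    (hβ : IsSmooth β) (hnd : ∀ t ∈ Set.Icc (0 : ℝ) 1, IsNondegenerate (σ + t • extD β)) :
    DiffeoEquiv σ (σ + extD β) :=
  diffeoEquiv_of_forall_small fun t ht =>
    exists_diffeoEquiv_small_of_compact (hσ.add (hβ.extD.smul t))
      (by rw [extD_add hσ (hβ.extD.smul t), hcl, extD_smul, extD_extD hβ, smul_zero, add_zero])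
      (hnd t ht) hβ

end Moser

/-! ### Charts with values in `ℂ²`, which are not members of the atlas modelled on `ℝ⁴`. -/

section ComplexCharts

variable {X : Type*} [TopologicalSpace X] [ChartedSpace R4 X]
  {φ : OpenPartialHomeomorph X (ℂ × ℂ)}

theorem IsComplexChart.contMDiffAt (hφ : IsComplexChart φ) {x : X} (hx : x ∈ φ.source) :
    ContMDiffAt (𝓡 4) 𝓘(ℝ, ℂ × ℂ) ∞ φ x :=
  hφ.1.contMDiffAt (φ.open_source.mem_nhds hx)

theorem IsComplexChart.contMDiffAt_symm (hφ : IsComplexChart φ) {z : ℂ × ℂ} (hz : z ∈ φ.target) :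
    ContMDiffAt 𝓘(ℝ, ℂ × ℂ) (𝓡 4) ∞ φ.symm z :=
  hφ.2.contMDiffAt (φ.open_target.mem_nhds hz)

theorem IsComplexChart.mfderiv_invDiff (hφ : IsComplexChart φ) {z : ℂ × ℂ} (hz : z ∈ φ.target)
    (v : ℂ × ℂ) : mfderiv (𝓡 4) 𝓘(ℝ, ℂ × ℂ) φ (φ.symm z) (invDiff φ z v) = v := by
  have h := mfderiv_comp (I := 𝓘(ℝ, ℂ × ℂ)) (I' := 𝓡 4) (I'' := 𝓘(ℝ, ℂ × ℂ)) (f := φ.symm)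
    (g := φ) z ((hφ.contMDiffAt (φ.map_target hz)).mdifferentiableAt (by simp))
    ((hφ.contMDiffAt_symm hz).mdifferentiableAt (by simp))
  have h2 : φ ∘ φ.symm =ᶠ[𝓝 z] id := by
    filter_upwards [φ.open_target.mem_nhds hz] with y hy
    exact φ.right_inv hy
  have h3 : (mfderiv 𝓘(ℝ, ℂ × ℂ) 𝓘(ℝ, ℂ × ℂ) (φ ∘ φ.symm) z : ℂ × ℂ →L[ℝ] ℂ × ℂ) =
      mfderiv 𝓘(ℝ, ℂ × ℂ) 𝓘(ℝ, ℂ × ℂ) (id : ℂ × ℂ → ℂ × ℂ) z := h2.mfderiv_eq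
  rw [mfderiv_id] at h3
  have h4 : (mfderiv 𝓘(ℝ, ℂ × ℂ) 𝓘(ℝ, ℂ × ℂ) (φ ∘ φ.symm) z : ℂ × ℂ →L[ℝ] ℂ × ℂ) v = v := by
    rw [h3]; rfl
  rw [h] at h4
  exact h4

theorem IsComplexChart.invDiff_mfderiv (hφ : IsComplexChart φ) {z : ℂ × ℂ} (hz : z ∈ φ.target)
    (w : TangentSpace (𝓡 4) (φ.symm z)) :
    invDiff φ z (mfderiv (𝓡 4) 𝓘(ℝ, ℂ × ℂ) φ (φ.symm z) w) = w := by
  have hx := φ.map_target hz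
  have hs : MDifferentiableAt 𝓘(ℝ, ℂ × ℂ) (𝓡 4) φ.symm (φ (φ.symm z)) := by
    rw [φ.right_inv hz]
    exact (hφ.contMDiffAt_symm hz).mdifferentiableAt (by simp)
  have h := mfderiv_comp (I := 𝓡 4) (I' := 𝓘(ℝ, ℂ × ℂ)) (I'' := 𝓡 4) (f := φ) (g := φ.symm)
    (φ.symm z) hs ((hφ.contMDiffAt hx).mdifferentiableAt (by simp))
  have h2 : φ.symm ∘ φ =ᶠ[𝓝 (φ.symm z)] id := by
    filter_upwards [φ.open_source.mem_nhds hx] with y hy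
    exact φ.left_inv hy
  have h3 : (mfderiv (𝓡 4) (𝓡 4) (φ.symm ∘ φ) (φ.symm z) : R4 →L[ℝ] R4) =
      mfderiv (𝓡 4) (𝓡 4) (id : X → X) (φ.symm z) := h2.mfderiv_eq
  rw [mfderiv_id] at h3
  have h4 : (mfderiv (𝓡 4) (𝓡 4) (φ.symm ∘ φ) (φ.symm z) : R4 →L[ℝ] R4) w = w := by
    rw [h3]; rfl
  rw [h, φ.right_inv hz] at h4
  exact h4

/-- The expression of a form in a complex chart, meaningful on `φ.target`. -/
def chartRep {k : ℕ} (φ : OpenPartialHomeomorph X (ℂ × ℂ)) (α : Form R4 X k) :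
    ℂ × ℂ → (ℂ × ℂ) [⋀^Fin k]→L[ℝ] ℝ :=
  pullback (E := ℂ × ℂ) (M := ℂ × ℂ) φ.symm α

/-- Smoothness is defined through the atlas, so the expression in `φ` is rewritten as the pullback,
by a smooth transition map, of the expression in an atlas chart. -/
theorem contDiffAt_chartRep [IsManifold (𝓡 4) ∞ X] {k : ℕ} {α : Form R4 X k}
    (hα : IsSmooth α) (hφ : IsComplexChart φ) {z : ℂ × ℂ} (hz : z ∈ φ.target) :
    ContDiffAt ℝ ∞ (chartRep φ α) z := by
  set e := chartAt R4 (φ.symm z) with he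
  have hea : e ∈ atlas R4 X := chart_mem_atlas R4 _
  have hze : φ.symm z ∈ e.source := mem_chart_source R4 _
  have hnhds : ∀ᶠ y in 𝓝 z, y ∈ φ.target ∧ φ.symm y ∈ e.source :=
    (φ.open_target.eventually_mem hz).and
      ((φ.symm.continuousAt hz).preimage_mem_nhds (e.open_source.mem_nhds hze))
  have hT : ∀ y, y ∈ φ.target → φ.symm y ∈ e.source →
      ContMDiffAt 𝓘(ℝ, ℂ × ℂ) (𝓡 4) ∞ (e ∘ φ.symm) y := fun y hy hy' =>
    (contMDiffAt_of_mem_atlas hea hy').comp y (hφ.contMDiffAt_symm hy)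
  have h1 : chartRep φ α =ᶠ[𝓝 z] fun y =>
      (coordRep e α ((e ∘ φ.symm) y)).compContinuousLinearMap (fderiv ℝ (e ∘ φ.symm) y) := by
    filter_upwards [hnhds.eventually_nhds] with y hy
    obtain ⟨hy1, hy2⟩ := hy.self_of_nhds
    have e2 : chartRep φ α y =
        pullback (E := ℂ × ℂ) (M := ℂ × ℂ) (e.symm ∘ (e ∘ φ.symm)) α y := by
      refine pullback_congr ?_ α
      filter_upwards [hy] with u hu
      exact (e.left_inv hu.2).symm
    have e3 := pullback_comp (E := ℂ × ℂ) (F := R4) (G := R4) (g := e.symm) (f := e ∘ φ.symm)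
      (x := y)
      ((contMDiffAt_symm_of_mem_atlas hea (e.map_source hy2)).mdifferentiableAt (by simp))
      ((hT y hy1 hy2).mdifferentiableAt (by simp)) α
    rw [e2, e3, ← mfderiv_eq_fderiv]
    rfl
  refine ContDiffAt.congr_of_eventuallyEq ?_ h1
  have h2 : ContDiffAt ℝ ∞ (e ∘ φ.symm) z := (hT z hz hze).contDiffAt
  exact contDiffAt_comp (ContDiffAt.comp z (hα.contDiffAt_of_mem hea (e.map_source hze)) h2)
    (h2.fderiv_right (m := ∞) (by simp))

/-- The value of a `2`-form on two vectors given in a complex chart. -/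
def chartValue (φ : OpenPartialHomeomorph X (ℂ × ℂ)) (α : Form R4 X 2) (z a b : ℂ × ℂ) : ℝ :=
  α (φ.symm z) ![invDiff φ z a, invDiff φ z b]

theorem chartValue_eq_toBilin (φ : OpenPartialHomeomorph X (ℂ × ℂ)) (α : Form R4 X 2)
    (z a b : ℂ × ℂ) : chartValue φ α z a b =
      toBilin (ℂ × ℂ) (chartRep φ α z) a b :=
  (pullback_pair (E := ℂ × ℂ) (M := ℂ × ℂ) φ.symm α z a b).symm.trans
    (toBilin_apply (E := ℂ × ℂ) _ a b).symm

theorem continuousAt_chartValue [IsManifold (𝓡 4) ∞ X] {α : Form R4 X 2} (hα : IsSmooth α)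
    (hφ : IsComplexChart φ) {z v : ℂ × ℂ} (hz : z ∈ φ.target) :
    ContinuousAt (fun q : (ℂ × ℂ) × (ℂ × ℂ) =>
      chartValue φ α q.1 q.2 (Complex.I • q.2)) (z, v) := by
  simp only [chartValue_eq_toBilin]
  have h1 : ContinuousAt (fun q : (ℂ × ℂ) × (ℂ × ℂ) => toBilin (ℂ × ℂ) (chartRep φ α q.1)) (z, v) := by
    have h2 := (contDiffAt_chartRep hα hφ hz).continuousAt
    exact (toBilin (ℂ × ℂ)).continuous.continuousAt.comp
      (ContinuousAt.comp (f := Prod.fst) (x := (z, v)) h2 continuousAt_fst)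
  exact (h1.clm_apply continuousAt_snd).clm_apply (continuousAt_snd.const_smul Complex.I)

end ComplexCharts

/-! ### The three local models: identity, fold and cusp. -/

section LocalModels

/-- The differential of `(u, v) ↦ (G (u, v), v)` in terms of the partial derivatives `a`, `b`
of `G`. -/
def modelDiff (a b : ℂ) : ℂ × ℂ →L[ℂ] ℂ × ℂ :=
  (a • ContinuousLinearMap.fst ℂ ℂ ℂ + b • ContinuousLinearMap.snd ℂ ℂ ℂ).prod
    (ContinuousLinearMap.snd ℂ ℂ ℂ)

theorem modelDiff_apply (a b : ℂ) (v : ℂ × ℂ) :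
    modelDiff a b v = (a * v.1 + b * v.2, v.2) := rfl

/-- The holomorphic data of a local model `g`: the partial derivatives `w`, `b` of its first
component, and the derivative `wu` of `w` in the first variable, which does not vanish at the
zeros of `w` apart from isolated points. -/
structure ModelData (g : ℂ × ℂ → ℂ × ℂ) where
  w : ℂ × ℂ → ℂ
  b : ℂ × ℂ → ℂ
  wu : ℂ × ℂ → ℂ
  hasFDerivAt : ∀ z, HasFDerivAt g (modelDiff (w z) (b z)) z
  smooth_w : ContDiff ℝ ∞ w
  continuous_wu : Continuous wu
  fderiv_w_one : ∀ z, fderiv ℝ w z (1, 0) = wu z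
  fderiv_w_I : ∀ z, fderiv ℝ w z (Complex.I, 0) = Complex.I * wu z
  isolated : ∀ z₀, ∀ᶠ z in 𝓝[≠] z₀, w z = 0 → wu z ≠ 0

/-- `w` is `1`, `2u` or `3u² - v`, and `wu` is `0`, `2` or `6u`. Common zeros occur only for the
cusp model, at the origin. -/
theorem exists_modelData {g : ℂ × ℂ → ℂ × ℂ} (hg : IsLocalModel g) : Nonempty (ModelData g) := by
  have hfst : ∀ z : ℂ × ℂ, HasFDerivAt (fun z : ℂ × ℂ => z.1) (ContinuousLinearMap.fst ℂ ℂ ℂ) z :=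
    fun z => hasFDerivAt_fst
  have hsnd : ∀ z : ℂ × ℂ, HasFDerivAt (fun z : ℂ × ℂ => z.2) (ContinuousLinearMap.snd ℂ ℂ ℂ) z :=
    fun z => hasFDerivAt_snd
  rcases hg with hg | hg | hg
  · have hg' : g = fun z => (z.1, z.2) := funext fun z => hg z.1 z.2
    refine ⟨⟨fun _ => 1, fun _ => 0, fun _ => 0, fun z => ?_, contDiff_const, continuous_const,
      fun z => by simp, fun z => by simp, fun z₀ => by simp⟩⟩
    rw [hg']
    refine ((hfst z).prodMk (hsnd z)).congr_fderiv ?_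
    ext <;> simp [modelDiff]
  · have hg' : g = fun z => (z.1 ^ 2, z.2) := funext fun z => hg z.1 z.2
    have hw : ∀ z : ℂ × ℂ, HasFDerivAt (fun z : ℂ × ℂ => 2 * z.1)
        ((2 : ℂ) • ContinuousLinearMap.fst ℂ ℂ ℂ) z := fun z => (hfst z).const_mul 2
    refine ⟨⟨fun z => 2 * z.1, fun _ => 0, fun _ => 2, fun z => ?_, contDiff_const.mul contDiff_fst,
      continuous_const, fun z => ?_, fun z => ?_, fun z₀ => by simp⟩⟩
    · rw [hg']
      refine (((hfst z).pow 2).prodMk (hsnd z)).congr_fderiv ?_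
      ext <;> simp [modelDiff]
    · rw [((hw z).restrictScalars ℝ).fderiv]; simp
    · rw [((hw z).restrictScalars ℝ).fderiv]; simp [mul_comm]
  · have hg' : g = fun z => (z.1 ^ 3 - z.1 * z.2, z.2) := funext fun z => hg z.1 z.2
    have hw : ∀ z : ℂ × ℂ, HasFDerivAt (fun z : ℂ × ℂ => 3 * z.1 ^ 2 - z.2)
        ((6 * z.1) • ContinuousLinearMap.fst ℂ ℂ ℂ - ContinuousLinearMap.snd ℂ ℂ ℂ) z := fun z => by
      refine ((((hfst z).pow 2).const_mul 3).sub (hsnd z)).congr_fderiv ?_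
      ext <;> simp
      ring
    refine ⟨⟨fun z => 3 * z.1 ^ 2 - z.2, fun z => -z.1, fun z => 6 * z.1, fun z => ?_,
      (contDiff_const.mul (contDiff_fst.pow 2)).sub contDiff_snd, by fun_prop, fun z => ?_,
      fun z => ?_, fun z₀ => ?_⟩⟩
    · rw [hg']
      refine ((((hfst z).pow 3).sub ((hfst z).mul (hsnd z))).prodMk (hsnd z)).congr_fderiv ?_
      ext <;> simp [modelDiff]
    · rw [((hw z).restrictScalars ℝ).fderiv]; simp
    · rw [((hw z).restrictScalars ℝ).fderiv]; simp [mul_comm]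
    · have key : ∀ z : ℂ × ℂ, z ≠ 0 → 3 * z.1 ^ 2 - z.2 = 0 → 6 * z.1 ≠ 0 := by
        intro z hz h1 h2
        have h3 : z.1 = 0 := by simpa using h2
        rw [h3] at h1
        exact hz (Prod.ext h3 (by simpa using h1))
      by_cases h0 : z₀ = 0
      · subst h0
        filter_upwards [self_mem_nhdsWithin] with z hz
        exact key z hz
      · filter_upwards [mem_nhdsWithin_of_mem_nhds (isOpen_ne.mem_nhds h0)] with z hz
        exact key z hz

end LocalModels

/-! ### The map and the pulled-back symplectic form in adapted charts. -/

section Adapted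

variable {X : Type*} [TopologicalSpace X] [ChartedSpace R4 X]
  {Y : Type*} [TopologicalSpace Y] [ChartedSpace R4 Y]
  {o : ManifoldOrientation X} {ωY : Form R4 Y 2} {f : X → Y}
  {φ : OpenPartialHomeomorph X (ℂ × ℂ)} {ψ : OpenPartialHomeomorph Y (ℂ × ℂ)}
  {g : ℂ × ℂ → ℂ × ℂ}

theorem AdaptedCharts.model_mem_target (h : AdaptedCharts o ωY f φ ψ)
    (hg : ∀ z ∈ φ.target, ψ (f (φ.symm z)) = g z) {z : ℂ × ℂ} (hz : z ∈ φ.target) :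
    g z ∈ ψ.target := by
  rw [← hg z hz]
  exact ψ.map_source (h.mapsTo (φ.map_target hz))

theorem AdaptedCharts.symm_model (h : AdaptedCharts o ωY f φ ψ)
    (hg : ∀ z ∈ φ.target, ψ (f (φ.symm z)) = g z) {z : ℂ × ℂ} (hz : z ∈ φ.target) :
    ψ.symm (g z) = f (φ.symm z) := by
  rw [← hg z hz]
  exact ψ.left_inv (h.mapsTo (φ.map_target hz))

/-- In adapted charts `df` is the differential of the local model. -/
theorem AdaptedCharts.mfderiv_eq (h : AdaptedCharts o ωY f φ ψ)
    (hf : ContMDiff (𝓡 4) (𝓡 4) ∞ f) (hg : ∀ z ∈ φ.target, ψ (f (φ.symm z)) = g z)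
    (D : ModelData g) {z : ℂ × ℂ} (hz : z ∈ φ.target) (v : ℂ × ℂ) :
    (mfderiv (𝓡 4) (𝓡 4) f (φ.symm z) (invDiff φ z v) : R4) =
      invDiff ψ (g z) (modelDiff (D.w z) (D.b z) v) := by
  have hgd : HasFDerivAt g ((modelDiff (D.w z) (D.b z)).restrictScalars ℝ) z :=
    (D.hasFDerivAt z).restrictScalars ℝ
  have h1 := mfderiv_comp (I := 𝓘(ℝ, ℂ × ℂ)) (I' := 𝓡 4) (I'' := 𝓡 4) (f := φ.symm) (g := f) z
    (hf.contMDiffAt.mdifferentiableAt (by simp))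
    ((h.chart_source.contMDiffAt_symm hz).mdifferentiableAt (by simp))
  have h2 := mfderiv_comp (I := 𝓘(ℝ, ℂ × ℂ)) (I' := 𝓘(ℝ, ℂ × ℂ)) (I'' := 𝓡 4) (f := g)
    (g := ψ.symm) z
    ((h.chart_target.contMDiffAt_symm (h.model_mem_target hg hz)).mdifferentiableAt (by simp))
    hgd.differentiableAt.mdifferentiableAt
  have h3 : f ∘ φ.symm =ᶠ[𝓝 z] ψ.symm ∘ g := by
    filter_upwards [φ.open_target.mem_nhds hz] with y hy
    exact (h.symm_model hg hy).symm
  have h4 : (mfderiv 𝓘(ℝ, ℂ × ℂ) (𝓡 4) (f ∘ φ.symm) z : ℂ × ℂ →L[ℝ] R4) =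
      mfderiv 𝓘(ℝ, ℂ × ℂ) (𝓡 4) (ψ.symm ∘ g) z := h3.mfderiv_eq
  rw [h1, h2, mfderiv_eq_fderiv, hgd.fderiv] at h4
  exact congrArg (fun A : ℂ × ℂ →L[ℝ] R4 => A v) h4

theorem AdaptedCharts.chartValue_pullback (h : AdaptedCharts o ωY f φ ψ)
    (hf : ContMDiff (𝓡 4) (𝓡 4) ∞ f) (hg : ∀ z ∈ φ.target, ψ (f (φ.symm z)) = g z)
    (D : ModelData g) {z : ℂ × ℂ} (hz : z ∈ φ.target) (a b : ℂ × ℂ) :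
    chartValue φ (pullback f ωY) z a b =
      chartValue ψ ωY (g z) (modelDiff (D.w z) (D.b z) a) (modelDiff (D.w z) (D.b z) b) := by
  have key : ∀ (p q : Y) (a b a' b' : R4), p = q → a = a' → b = b' →
      (ωY p : R4 [⋀^Fin 2]→L[ℝ] ℝ) ![a, b] = (ωY q : R4 [⋀^Fin 2]→L[ℝ] ℝ) ![a', b'] := by
    rintro p _ a b _ _ rfl rfl rfl
    rfl
  exact (pullback_pair f ωY (φ.symm z) (invDiff φ z a) (invDiff φ z b)).trans
    (key _ _ _ _ _ _ (h.symm_model hg hz).symm (h.mfderiv_eq hf hg D hz a)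
      (h.mfderiv_eq hf hg D hz b))

/-- The model differential is `(w v₁ + b v₂, v₂)`. So the kernel is the line `ℂ × 0` where `w = 0`
and is trivial elsewhere. -/
theorem AdaptedCharts.mfderiv_eq_zero_iff (h : AdaptedCharts o ωY f φ ψ)
    (hf : ContMDiff (𝓡 4) (𝓡 4) ∞ f) (hg : ∀ z ∈ φ.target, ψ (f (φ.symm z)) = g z)
    (D : ModelData g) {z : ℂ × ℂ} (hz : z ∈ φ.target) (v : ℂ × ℂ) :
    mfderiv (𝓡 4) (𝓡 4) f (φ.symm z) (invDiff φ z v) = 0 ↔ D.w z * v.1 = 0 ∧ v.2 = 0 := by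
  have h1 := h.mfderiv_eq hf hg D hz v
  have h2 : (mfderiv (𝓡 4) (𝓡 4) f (φ.symm z) (invDiff φ z v) : R4) = 0 ↔
      modelDiff (D.w z) (D.b z) v = 0 := by
    rw [h1]
    constructor
    · intro h0
      have h3 := h.chart_target.mfderiv_invDiff (h.model_mem_target hg hz)
        (modelDiff (D.w z) (D.b z) v)
      rw [h0] at h3
      rw [← h3]
      exact map_zero _
    · intro h0
      rw [h0]
      exact map_zero _
  refine h2.trans ?_
  rw [modelDiff_apply, Prod.mk_eq_zero]
  constructor
  · rintro ⟨h3, h4⟩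
    exact ⟨by simpa [h4] using h3, h4⟩
  · rintro ⟨h3, h4⟩
    exact ⟨by simp [h3, h4], h4⟩

/-- The model differential commutes with `i`, so taming on `Y` pulls back to semi-positivity on `X`,
strict off the kernel. -/
theorem AdaptedCharts.chartValue_pullback_nonneg (h : AdaptedCharts o ωY f φ ψ)
    (hf : ContMDiff (𝓡 4) (𝓡 4) ∞ f) (hg : ∀ z ∈ φ.target, ψ (f (φ.symm z)) = g z)
    (D : ModelData g) {z : ℂ × ℂ} (hz : z ∈ φ.target) (v : ℂ × ℂ) :
    (modelDiff (D.w z) (D.b z) v ≠ 0 →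
      0 < chartValue φ (pullback f ωY) z v (Complex.I • v)) ∧
    0 ≤ chartValue φ (pullback f ωY) z v (Complex.I • v) := by
  have h1 := h.chartValue_pullback hf hg D hz v (Complex.I • v)
  rw [map_smul] at h1
  have hpos : modelDiff (D.w z) (D.b z) v ≠ 0 →
      0 < chartValue φ (pullback f ωY) z v (Complex.I • v) := by
    intro h0
    rw [h1]
    exact h.tame (g z) (h.model_mem_target hg hz) _ h0
  refine ⟨hpos, ?_⟩
  by_cases h0 : modelDiff (D.w z) (D.b z) v = 0
  · rw [h1, h0, chartValue_eq_toBilin, map_zero]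
    exact le_rfl
  · exact (hpos h0).le

end Adapted

/-! ### Small perturbations tame the complex structures of adapted charts. -/

section Tamed

variable {X : Type*} [TopologicalSpace X] [ChartedSpace R4 X] [IsManifold (𝓡 4) ∞ X]
  {Y : Type*} [TopologicalSpace Y] [ChartedSpace R4 Y] [IsManifold (𝓡 4) ∞ Y]
  {o : ManifoldOrientation X} {f : X → Y}
  {φ : OpenPartialHomeomorph X (ℂ × ℂ)} {ψ : OpenPartialHomeomorph Y (ℂ × ℂ)}

/-- Near a point of `X`, all forms `f^*ωY + ε α` with small `ε > 0` tame the complex structure of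
an adapted chart. -/
theorem eventually_chartValue_pos {ωY : Form R4 Y 2} (hω : IsSmooth ωY)
    (hf : ContMDiff (𝓡 4) (𝓡 4) ∞ f) {α : Form R4 X 2} (hα : IsSmooth α)
    (hpos : IsPositiveOnKernel o ωY f α) (h : AdaptedCharts o ωY f φ ψ) {z₀ : ℂ × ℂ}
    (hz₀ : z₀ ∈ φ.target) :
    ∀ᶠ q : ℝ × (ℂ × ℂ) in 𝓝 (0, z₀), 0 < q.1 → ∀ v ≠ 0,
      0 < chartValue φ (pullback f ωY + q.1 • α) q.2 v (Complex.I • v) := by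
  obtain ⟨g, hgm, hg⟩ := h.model
  obtain ⟨D⟩ := exists_modelData hgm
  let σ : Form R4 X 2 := pullback f ωY
  have hσ : IsSmooth σ := hω.pullback hf
  have hadd : ∀ (ε : ℝ) (z a b : ℂ × ℂ), chartValue φ (σ + ε • α) z a b =
      chartValue φ σ z a b + ε * chartValue φ α z a b := fun ε z a b => rfl
  -- By homogeneity unit vectors suffice, and by compactness of the sphere it is enough to argue
  -- near each `v`.
  have hsphere : ∀ᶠ q : ℝ × (ℂ × ℂ) in 𝓝 (0, z₀), ∀ v ∈ Metric.sphere (0 : ℂ × ℂ) 1, 0 < q.1 →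
      0 < chartValue φ (σ + q.1 • α) q.2 v (Complex.I • v) := by
    refine (isCompact_sphere (0 : ℂ × ℂ) 1).eventually_forall_of_forall_eventually
      (P := fun (q : ℝ × (ℂ × ℂ)) v => 0 < q.1 → 0 < chartValue φ (σ + q.1 • α) q.2 v (Complex.I • v))
      fun v hv => ?_
    have hv0 : v ≠ 0 := by
      rintro rfl
      simp at hv
    have hπ : ContinuousAt (fun q : (ℝ × (ℂ × ℂ)) × (ℂ × ℂ) => (q.1.2, q.2)) ((0, z₀), v) := by
      fun_prop
    have hcont : ∀ {τ : Form R4 X 2}, IsSmooth τ →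
        ContinuousAt (fun q : (ℝ × (ℂ × ℂ)) × (ℂ × ℂ) =>
          chartValue φ τ q.1.2 q.2 (Complex.I • q.2)) ((0, z₀), v) := fun hτ =>
      ContinuousAt.comp (f := fun q : (ℝ × (ℂ × ℂ)) × (ℂ × ℂ) => (q.1.2, q.2))
        (continuousAt_chartValue hτ h.chart_source hz₀) hπ
    -- At a kernel vector `α` is positive, hence also nearby, and `f^*ωY` is nonnegative on all
    -- neighbouring vectors. At any other vector `f^*ωY` is positive and the sum is continuous at `ε
    -- = 0`.
    by_cases hk : modelDiff (D.w z₀) (D.b z₀) v = 0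
    · have hk' : mfderiv (𝓡 4) (𝓡 4) f (φ.symm z₀) (invDiff φ z₀ v) = 0 := by
        rw [h.mfderiv_eq_zero_iff hf hg D hz₀]
        rw [modelDiff_apply, Prod.mk_eq_zero] at hk
        exact ⟨by simpa [hk.2] using hk.1, hk.2⟩
      have hram : φ.symm z₀ ∈ ramificationCurve f := by
        intro hbij
        have h1 : (invDiff φ z₀ v : R4) = 0 := hbij.1 (hk'.trans (map_zero _).symm)
        have h2 := h.chart_source.mfderiv_invDiff hz₀ v
        rw [h1] at h2
        exact hv0 (h2.symm.trans (map_zero _))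
      have hα0 : 0 < chartValue φ α z₀ v (Complex.I • v) :=
        hpos φ ψ h z₀ hz₀ hram v hv0 hk'
      have h1 := (hcont hα).eventually (lt_mem_nhds hα0)
      have h2 : ∀ᶠ q : (ℝ × (ℂ × ℂ)) × (ℂ × ℂ) in 𝓝 ((0, z₀), v), q.1.2 ∈ φ.target := by
        have : ContinuousAt (fun q : (ℝ × (ℂ × ℂ)) × (ℂ × ℂ) => q.1.2) ((0, z₀), v) := by fun_prop
        exact this.eventually (φ.open_target.mem_nhds hz₀)
      filter_upwards [h1, h2] with q hq1 hq2 hε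
      rw [hadd]
      have h3 := (h.chartValue_pullback_nonneg hf hg D hq2 q.2).2
      exact add_pos_of_nonneg_of_pos h3 (mul_pos hε hq1)
    · have hσ0 := (h.chartValue_pullback_nonneg hf hg D hz₀ v).1 hk
      have h1 : ContinuousAt (fun q : (ℝ × (ℂ × ℂ)) × (ℂ × ℂ) =>
          chartValue φ (σ + q.1.1 • α) q.1.2 q.2 (Complex.I • q.2)) ((0, z₀), v) := by
        simp only [hadd]
        have : ContinuousAt (fun q : (ℝ × (ℂ × ℂ)) × (ℂ × ℂ) => q.1.1) ((0, z₀), v) := by fun_prop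
        exact (hcont hσ).add (this.mul (hcont hα))
      have h2 : 0 < chartValue φ (σ + (0 : ℝ) • α) z₀ v (Complex.I • v) := by
        rw [hadd, zero_mul, add_zero]
        exact hσ0
      filter_upwards [h1.eventually (lt_mem_nhds h2)] with q hq _
      exact hq
  filter_upwards [hsphere] with q hq hε v hv
  have hn : 0 < ‖v‖ := norm_pos_iff.2 hv
  have h1 := hq (‖v‖⁻¹ • v) (by simp [norm_smul, hn.ne']) hε
  have h2 : Complex.I • (‖v‖⁻¹ • v) = ‖v‖⁻¹ • (Complex.I • v) := smul_comm _ _ _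
  rw [h2] at h1
  generalize Complex.I • v = u at h1 ⊢
  rw [chartValue_eq_toBilin, map_smul, map_smul, smul_apply, smul_eq_mul, smul_eq_mul,
    ← chartValue_eq_toBilin] at h1
  have hi : 0 < ‖v‖⁻¹ := inv_pos.2 hn
  exact pos_of_mul_pos_right (pos_of_mul_pos_right h1 hi.le) hi.le

/-- A `2`-form on a tangent space tames the complex structure transported by `A : ℂ² → TX`. -/
def TamedBy (A : ℂ × ℂ →L[ℝ] R4) (η : R4 [⋀^Fin 2]→L[ℝ] ℝ) : Prop :=
  ∀ v ≠ 0, 0 < η ![A v, A (Complex.I • v)]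

theorem TamedBy.nondegenerate {A : ℂ × ℂ →L[ℝ] R4} (hA : Function.Surjective A)
    {η : R4 [⋀^Fin 2]→L[ℝ] ℝ} (h : TamedBy A η) (v : R4) (hv : ∀ w, η ![v, w] = 0) : v = 0 := by
  obtain ⟨a, rfl⟩ := hA v
  by_contra h0
  have ha : a ≠ 0 := by
    rintro rfl
    exact h0 (map_zero A)
  exact (h a ha).ne' (hv _)

theorem TamedBy.convex {A : ℂ × ℂ →L[ℝ] R4} {η₁ η₂ : R4 [⋀^Fin 2]→L[ℝ] ℝ} (h₁ : TamedBy A η₁)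
    (h₂ : TamedBy A η₂) {t : ℝ} (ht : t ∈ Set.Icc (0 : ℝ) 1) :
    TamedBy A ((1 - t) • η₁ + t • η₂) := by
  intro v hv
  change 0 < (1 - t) * _ + t * _
  rcases ht.1.eq_or_lt with h0 | h0
  · rw [← h0]
    simpa using h₁ v hv
  · exact add_pos_of_nonneg_of_pos (mul_nonneg (by linarith [ht.2]) (h₁ v hv).le)
      (mul_pos h0 (h₂ v hv))

/-- Local taming and compactness of `X`. A single `A` serves both forms at each point, which is what
convexity needs; no continuity of `A` in `x` is required. -/
theorem exists_tamed [CompactSpace X] {ωY : SymplecticForm R4 Y} (f : C^∞⟮𝓡 4, X; 𝓡 4, Y⟯)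
    (hf : IsSymplecticBranchedCover o ωY f) {α₁ α₂ : Form R4 X 2} (hα₁ : IsSmooth α₁)
    (hα₂ : IsSmooth α₂) (h₁ : IsPositiveOnKernel o ωY.form f α₁)
    (h₂ : IsPositiveOnKernel o ωY.form f α₂) :
    ∃ ε₀ > (0 : ℝ), ∀ ε ∈ Set.Ioc 0 ε₀, ∀ x : X, ∃ A : ℂ × ℂ →L[ℝ] R4, Function.Surjective A ∧
      TamedBy A (pullback f ωY.form x + ε • α₁ x) ∧ TamedBy A (pullback f ωY.form x + ε • α₂ x) := by
  have hev : ∀ᶠ ε in 𝓝 (0 : ℝ), ∀ x ∈ (Set.univ : Set X), 0 < ε → ∃ A : ℂ × ℂ →L[ℝ] R4,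
      Function.Surjective A ∧ TamedBy A (pullback f ωY.form x + ε • α₁ x) ∧
        TamedBy A (pullback f ωY.form x + ε • α₂ x) := by
    refine isCompact_univ.eventually_forall_of_forall_eventually
      (P := fun (ε : ℝ) (x : X) => 0 < ε → ∃ A : ℂ × ℂ →L[ℝ] R4, Function.Surjective A ∧
        TamedBy A (pullback f ωY.form x + ε • α₁ x) ∧
          TamedBy A (pullback f ωY.form x + ε • α₂ x)) fun p _ => ?_
    obtain ⟨φ, ψ, hp, h⟩ := hf p
    have hz := φ.map_source hp
    have e1 := (eventually_chartValue_pos ωY.smooth f.contMDiff hα₁ h₁ h hz).and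
      (eventually_chartValue_pos ωY.smooth f.contMDiff hα₂ h₂ h hz)
    have hc : ContinuousAt (fun q : ℝ × X => (q.1, φ q.2)) (0, p) :=
      continuousAt_fst.prodMk
        (ContinuousAt.comp (f := Prod.snd) (φ.continuousAt hp) continuousAt_snd)
    have hs : ∀ᶠ q : ℝ × X in 𝓝 (0, p), q.2 ∈ φ.source :=
      (continuous_snd.tendsto _).eventually (φ.open_source.mem_nhds hp)
    filter_upwards [hc.eventually e1, hs] with q hq hqs hε
    have key : ∀ (x : X), φ.symm (φ q.2) = x → ∃ A : ℂ × ℂ →L[ℝ] R4, Function.Surjective A ∧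
        TamedBy A (pullback f ωY.form x + q.1 • α₁ x) ∧
          TamedBy A (pullback f ωY.form x + q.1 • α₂ x) := by
      rintro x rfl
      exact ⟨invDiff φ (φ q.2),
        fun w => ⟨_, h.chart_source.invDiff_mfderiv (φ.map_source hqs) w⟩, hq.1 hε, hq.2 hε⟩
    exact key q.2 (φ.left_inv hqs)
  obtain ⟨δ, hδ, hδ'⟩ := Metric.eventually_nhds_iff.1 hev
  refine ⟨δ / 2, by positivity, fun ε hε x => hδ' (y := ε) ?_ x (Set.mem_univ x) hε.1⟩
  rw [Real.dist_eq, sub_zero, abs_of_pos hε.1]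
  linarith [hε.2]

end Tamed

/-! ### Exterior products in dimension four and positive frames. -/

section WedgeProduct

variable {V : Type*} [AddCommGroup V] [Module ℝ V]

/-- The `4`-form `S ∧ A` of two alternating bilinear forms. -/
def wedgeForm (S A : V →ₗ[ℝ] V →ₗ[ℝ] ℝ) (hS : ∀ a b, S a b = -S b a)
    (hA : ∀ a b, A a b = -A b a) : V [⋀^Fin 4]→ₗ[ℝ] ℝ where
  toFun v := S (v 0) (v 1) * A (v 2) (v 3) - S (v 0) (v 2) * A (v 1) (v 3) +
    S (v 0) (v 3) * A (v 1) (v 2) + S (v 1) (v 2) * A (v 0) (v 3) -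
    S (v 1) (v 3) * A (v 0) (v 2) + S (v 2) (v 3) * A (v 0) (v 1)
  map_update_add' := by
    intro inst v i x y
    obtain rfl : inst = instDecidableEqFin 4 := Subsingleton.elim _ _
    fin_cases i <;> simp <;> ring
  map_update_smul' := by
    intro inst v i c x
    obtain rfl : inst = instDecidableEqFin 4 := Subsingleton.elim _ _
    fin_cases i <;> simp <;> ring
  map_eq_zero_of_eq' := by
    intro v i j h hij
    have hS0 : ∀ a, S a a = 0 := fun a => by linarith [hS a a]
    have hA0 : ∀ a, A a a = 0 := fun a => by linarith [hA a a]
    fin_cases i <;> fin_cases j <;> first | exact absurd rfl hij | skip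
    all_goals
      simp only [Fin.isValue, Fin.mk_one, Fin.zero_eta, Fin.reduceFinMk] at h
      rw [h]
      grind

/-- Top-degree forms are multiples of the determinant. The ratio is the determinant of the change of
frame, positive as both frames induce `o` and independent of `τ`. -/
theorem exists_pos_ratio_of_isPositiveFrame {o : Orientation ℝ V (Fin 4)} {v₁ v₂ : Fin 4 → V}
    (h₁ : IsPositiveFrame o v₁) (h₂ : IsPositiveFrame o v₂) :
    ∃ c > 0, ∀ τ : V [⋀^Fin 4]→ₗ[ℝ] ℝ, τ v₂ = c * τ v₁ := by
  obtain ⟨b₁, rfl, ho₁⟩ := h₁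
  obtain ⟨b₂, rfl, ho₂⟩ := h₂
  refine ⟨b₁.det b₂, (b₁.orientation_eq_iff_det_pos b₂).1 (ho₁.trans ho₂.symm), fun τ => ?_⟩
  conv_lhs => rw [τ.eq_smul_basis_det b₁]
  simp [mul_comm]

end WedgeProduct

/-! ### Alternating forms as algebraic bilinear forms. -/

section BilinearForms

variable {E : Type*} [NormedAddCommGroup E] [NormedSpace ℝ E]

/-- An alternating `2`-form as a bilinear form. -/
def bilinOf (σ : E [⋀^Fin 2]→L[ℝ] ℝ) : E →ₗ[ℝ] E →ₗ[ℝ] ℝ :=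
  LinearMap.mk₂ ℝ (fun a b => toBilin E σ a b) (by simp) (by simp) (by simp) (by simp)

theorem bilinOf_apply (σ : E [⋀^Fin 2]→L[ℝ] ℝ) (a b : E) : bilinOf σ a b = σ ![a, b] := by
  rw [bilinOf, LinearMap.mk₂_apply, toBilin_apply]

theorem bilinOf_swap (σ : E [⋀^Fin 2]→L[ℝ] ℝ) (a b : E) : bilinOf σ a b = -bilinOf σ b a := by
  rw [bilinOf, LinearMap.mk₂_apply, LinearMap.mk₂_apply, toBilin_swap]

end BilinearForms

/-! ### Independence of the kernel orientation from the adapted chart. -/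

section KernelSign

variable {X : Type*} [TopologicalSpace X] [ChartedSpace R4 X]
  {Y : Type*} [TopologicalSpace Y] [ChartedSpace R4 Y]
  {o : ManifoldOrientation X} {ωY : Form R4 Y 2} {f : X → Y}
  {φ : OpenPartialHomeomorph X (ℂ × ℂ)} {ψ : OpenPartialHomeomorph Y (ℂ × ℂ)}
  {g : ℂ × ℂ → ℂ × ℂ}

/-- The `2`-form `α` at `x` as a bilinear form on the model space. -/
def bilinAt (α : Form R4 X 2) (x : X) : R4 →ₗ[ℝ] R4 →ₗ[ℝ] ℝ :=
  bilinOf (E := R4) (α x)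

theorem bilinAt_apply (α : Form R4 X 2) (x : X) (a b : R4) :
    bilinAt α x a b = (α x : R4 [⋀^Fin 2]→L[ℝ] ℝ) ![a, b] := bilinOf_apply (E := R4) (α x) a b

theorem bilinAt_swap (α : Form R4 X 2) (x : X) (a b : R4) :
    bilinAt α x a b = -bilinAt α x b a := bilinOf_swap (E := R4) (α x) a b

/-- The `4`-form `σ ∧ α` at `x`. -/
def wedgeAt (σ α : Form R4 X 2) (x : X) : R4 [⋀^Fin 4]→ₗ[ℝ] ℝ :=
  wedgeForm (bilinAt σ x) (bilinAt α x) (bilinAt_swap σ x) (bilinAt_swap α x)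

/-- At a ramification point, `f^*ωY ∧ α` evaluated on the frame of an adapted chart is a positive
multiple of the value of `α` on the frame of the kernel. -/
theorem AdaptedCharts.wedgeAt_frame (h : AdaptedCharts o ωY f φ ψ)
    (hf : ContMDiff (𝓡 4) (𝓡 4) ∞ f) (hg : ∀ z ∈ φ.target, ψ (f (φ.symm z)) = g z)
    (D : ModelData g) {z : ℂ × ℂ} (hz : z ∈ φ.target) (hw : D.w z = 0) :
    ∃ c > 0, ∀ α : Form R4 X 2, wedgeAt (pullback f ωY) α (φ.symm z)
      (fun i => invDiff φ z (complexFrame i)) = c * chartValue φ α z (1, 0) (Complex.I, 0) := by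
  have hval : ∀ (η : Form R4 X 2) (a b : ℂ × ℂ),
      bilinAt η (φ.symm z) (invDiff φ z a) (invDiff φ z b) = chartValue φ η z a b :=
    fun η a b => bilinAt_apply η _ _ _
  -- `f^*ωY` kills the first two frame vectors, so of the six terms of the wedge product only `f^*ωY
  -- (e₂, e₃) · α (e₀, e₁)` survives.
  have hker : ∀ (u : ℂ) (b : ℂ × ℂ), chartValue φ (pullback f ωY) z (u, 0) b = 0 := by
    intro u b
    rw [h.chartValue_pullback hf hg D hz]
    have h0 : modelDiff (D.w z) (D.b z) (u, 0) = 0 := by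
      rw [modelDiff_apply, hw]
      simp
    rw [h0, chartValue_eq_toBilin, map_zero]
    rfl
  have hpos : 0 < chartValue φ (pullback f ωY) z (0, 1) (0, Complex.I) := by
    have h1 := (h.chartValue_pullback_nonneg hf hg D hz (0, 1)).1 (by
      rw [modelDiff_apply]
      simp)
    simpa using h1
  refine ⟨_, hpos, fun α => ?_⟩
  simp only [wedgeAt, wedgeForm, AlternatingMap.coe_mk, MultilinearMap.coe_mk, complexFrame]
  change bilinAt _ _ (invDiff φ z (1, 0)) (invDiff φ z (Complex.I, 0)) *
      bilinAt _ _ (invDiff φ z (0, 1)) (invDiff φ z (0, Complex.I)) -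
    bilinAt _ _ (invDiff φ z (1, 0)) (invDiff φ z (0, 1)) *
      bilinAt _ _ (invDiff φ z (Complex.I, 0)) (invDiff φ z (0, Complex.I)) +
    bilinAt _ _ (invDiff φ z (1, 0)) (invDiff φ z (0, Complex.I)) *
      bilinAt _ _ (invDiff φ z (Complex.I, 0)) (invDiff φ z (0, 1)) +
    bilinAt _ _ (invDiff φ z (Complex.I, 0)) (invDiff φ z (0, 1)) *
      bilinAt _ _ (invDiff φ z (1, 0)) (invDiff φ z (0, Complex.I)) -
    bilinAt _ _ (invDiff φ z (Complex.I, 0)) (invDiff φ z (0, Complex.I)) *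
      bilinAt _ _ (invDiff φ z (1, 0)) (invDiff φ z (0, 1)) +
    bilinAt _ _ (invDiff φ z (0, 1)) (invDiff φ z (0, Complex.I)) *
      bilinAt _ _ (invDiff φ z (1, 0)) (invDiff φ z (Complex.I, 0)) = _
  simp only [hval, hker]
  ring

/-- The orientation of the kernel of `df` does not depend on the adapted charts. -/
theorem AdaptedCharts.exists_pos_ratio {φ' : OpenPartialHomeomorph X (ℂ × ℂ)}
    {ψ' : OpenPartialHomeomorph Y (ℂ × ℂ)} {g' : ℂ × ℂ → ℂ × ℂ}
    (h : AdaptedCharts o ωY f φ ψ) (h' : AdaptedCharts o ωY f φ' ψ')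
    (hf : ContMDiff (𝓡 4) (𝓡 4) ∞ f) (hg : ∀ z ∈ φ.target, ψ (f (φ.symm z)) = g z)
    (D : ModelData g) (hg' : ∀ z ∈ φ'.target, ψ' (f (φ'.symm z)) = g' z) (D' : ModelData g')
    {z z' : ℂ × ℂ} (hz : z ∈ φ.target) (hz' : z' ∈ φ'.target) (hzz' : φ.symm z = φ'.symm z')
    (hw' : D'.w z' = 0) :
    D.w z = 0 ∧ ∃ c > 0, ∀ α : Form R4 X 2,
      chartValue φ' α z' (1, 0) (Complex.I, 0) = c * chartValue φ α z (1, 0) (Complex.I, 0) := by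
  -- Otherwise `df` would be injective at the common point, although the second chart exhibits a
  -- kernel vector.
  have hw : D.w z = 0 := by
    have h1 : mfderiv (𝓡 4) (𝓡 4) f (φ'.symm z') (invDiff φ' z' (1, 0)) = 0 := by
      rw [h'.mfderiv_eq_zero_iff hf hg' D' hz']
      simp [hw']
    have h2 := h'.chart_source.mfderiv_invDiff hz' (1, 0)
    have key : ∀ (p : X) (u : R4), φ.symm z = p →
        (mfderiv (𝓡 4) (𝓡 4) f p : R4 →L[ℝ] R4) u = 0 → D.w z ≠ 0 → u = 0 := by
      rintro p u rfl hu hw0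
      have h3 := h.chart_source.invDiff_mfderiv hz u
      rw [← h3] at hu
      have h4 := (h.mfderiv_eq_zero_iff hf hg D hz _).1 hu
      rw [← h3]
      have h5 : (mfderiv (𝓡 4) 𝓘(ℝ, ℂ × ℂ) φ (φ.symm z) u : ℂ × ℂ) = 0 :=
        Prod.ext ((mul_eq_zero.1 h4.1).resolve_left hw0) h4.2
      rw [h5]
      exact map_zero _
    by_contra hw0
    have h3 := key _ _ hzz' h1 hw0
    rw [h3] at h2
    have h4 : (0 : ℂ × ℂ) = (1, 0) := (map_zero _).symm.trans h2
    simp [Prod.ext_iff] at h4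
  refine ⟨hw, ?_⟩
  obtain ⟨c, hc, hcα⟩ := h.wedgeAt_frame hf hg D hz hw
  obtain ⟨c', hc', hcα'⟩ := h'.wedgeAt_frame hf hg' D' hz' hw'
  have key : ∀ (p p' : X) (v v' : Fin 4 → R4), p = p' → IsPositiveFrame (V := R4) (o.at_point p) v →
      IsPositiveFrame (V := R4) (o.at_point p') v' → ∃ d > 0, ∀ α : Form R4 X 2,
        wedgeAt (pullback f ωY) α p' v' = d * wedgeAt (pullback f ωY) α p v := by
    rintro p _ v v' rfl hv hv'
    obtain ⟨d, hd, hdτ⟩ := exists_pos_ratio_of_isPositiveFrame hv hv'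
    exact ⟨d, hd, fun α => hdτ _⟩
  obtain ⟨d, hd, hdα⟩ := key _ _ _ _ hzz' (h.orientation_source z hz)
    (h'.orientation_source z' hz')
  -- Both frames are positive, so the two evaluations of `f^*ωY ∧ α` differ by `d`: `c'` times the
  -- second kernel value is `d c` times the first.
  refine ⟨d * c / c', by positivity, fun α => ?_⟩
  have h1 := hdα α
  rw [hcα, hcα'] at h1
  field_simp
  linarith

end KernelSign

/-! ### Forms on a vector space and the area form of the plane. -/

section FormsOnVectorSpaces

variable {F : Type*} [NormedAddCommGroup F] [NormedSpace ℝ F] {k : ℕ}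

theorem coordRep_refl (σ : Form F F k) : coordRep (OpenPartialHomeomorph.refl F) σ = σ :=
  pullback_id σ

theorem isSmooth_of_contDiff {σ : F → F [⋀^Fin k]→L[ℝ] ℝ} (hσ : ContDiff ℝ ∞ σ) :
    IsSmooth (E := F) (M := F) σ := by
  intro e he
  rw [chartedSpaceSelf_atlas] at he
  rw [he]
  have h : coordRep (OpenPartialHomeomorph.refl F) (σ : Form F F k) = σ := coordRep_refl _
  exact (h ▸ hσ.contDiffOn : ContDiffOn ℝ ∞ (coordRep (OpenPartialHomeomorph.refl F)
    (σ : Form F F k)) _)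

theorem extD_self (σ : Form F F k) (y : F) : extD σ y = extDeriv (E := F) σ y := by
  have h : extD σ y = pullback (E := F) (M := F) (N := F) (id : F → F)
      (extDeriv (coordRep (OpenPartialHomeomorph.refl F) σ)) y := rfl
  rw [h, coordRep_refl]
  exact congrFun (pullback_id (E := F) (M := F) (extDeriv (E := F) σ)) y

/-- The `1`-form `x dy` on the plane. -/
def areaPrimitive : ℝ × ℝ →L[ℝ] (ℝ × ℝ) [⋀^Fin 1]→L[ℝ] ℝ :=
  (ContinuousLinearMap.fst ℝ ℝ ℝ).smulRight
    (ContinuousAlternatingMap.ofSubsingletonLIE (𝕜 := ℝ) (E := ℝ × ℝ) (F := ℝ) (0 : Fin 1)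
      (ContinuousLinearMap.snd ℝ ℝ ℝ))

theorem areaPrimitive_apply (y b : ℝ × ℝ) : areaPrimitive y ![b] = y.1 * b.2 := rfl

theorem extDeriv_areaPrimitive (y a b : ℝ × ℝ) :
    extDeriv areaPrimitive y ![a, b] = a.1 * b.2 - b.1 * a.2 := by
  rw [extDeriv_oneForm_apply, ContinuousLinearMap.fderiv, areaPrimitive_apply, areaPrimitive_apply]

end FormsOnVectorSpaces

/-! ### Exact forms on `X` built from functions supported in a chart. -/

section ExtendZero

variable {X : Type*} [TopologicalSpace X]
  {φ : OpenPartialHomeomorph X (ℂ × ℂ)} {F : Type*} [NormedAddCommGroup F]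

open Classical in
/-- The function `G ∘ φ` extended by zero outside the domain of `φ`. -/
def extendZero (φ : OpenPartialHomeomorph X (ℂ × ℂ)) (G : ℂ × ℂ → F) (x : X) : F :=
  if x ∈ φ.source then G (φ x) else 0

theorem extendZero_of_mem (G : ℂ × ℂ → F) {x : X} (hx : x ∈ φ.source) :
    extendZero φ G x = G (φ x) := if_pos hx

variable [T2Space X] {G : ℂ × ℂ → F} {K : Set (ℂ × ℂ)}

theorem extendZero_eventuallyEq_zero (hK : IsCompact K) (hKφ : K ⊆ φ.target)
    (hG : ∀ z ∉ K, G z = 0) {x : X} (hx : x ∉ φ.source) :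
    extendZero φ G =ᶠ[𝓝 x] fun _ => 0 := by
  have hc : IsCompact (φ.symm '' K) := hK.image_of_continuousOn (φ.continuousOn_symm.mono hKφ)
  have hxc : x ∉ φ.symm '' K := by
    rintro ⟨z, hz, rfl⟩
    exact hx (φ.map_target (hKφ hz))
  filter_upwards [hc.isClosed.isOpen_compl.mem_nhds hxc] with y hy
  by_cases hys : y ∈ φ.source
  · rw [extendZero_of_mem G hys]
    exact hG _ fun h => hy ⟨_, h, φ.left_inv hys⟩
  · exact if_neg hys

variable [ChartedSpace R4 X] [NormedSpace ℝ F]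

theorem contMDiff_extendZero (hφ : IsComplexChart φ) (hGs : ContDiff ℝ ∞ G) (hK : IsCompact K)
    (hKφ : K ⊆ φ.target) (hG : ∀ z ∉ K, G z = 0) :
    ContMDiff (𝓡 4) 𝓘(ℝ, F) ∞ (extendZero φ G) := by
  intro x
  by_cases hx : x ∈ φ.source
  · refine (hGs.contMDiff.contMDiffAt.comp x (hφ.contMDiffAt hx)).congr_of_eventuallyEq ?_
    filter_upwards [φ.open_source.mem_nhds hx] with y hy
    exact extendZero_of_mem G hy
  · exact contMDiffAt_const.congr_of_eventuallyEq (extendZero_eventuallyEq_zero hK hKφ hG hx)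

theorem mfderiv_extendZero (hφ : IsComplexChart φ) (hGs : ContDiff ℝ ∞ G) (hK : IsCompact K)
    (hKφ : K ⊆ φ.target) (hG : ∀ z ∉ K, G z = 0) {z : ℂ × ℂ} (hz : z ∈ φ.target) (v : ℂ × ℂ) :
    (mfderiv (𝓡 4) 𝓘(ℝ, F) (extendZero φ G) (φ.symm z) (invDiff φ z v) : F) = fderiv ℝ G z v := by
  have h := mfderiv_comp (I := 𝓘(ℝ, ℂ × ℂ)) (I' := 𝓡 4) (I'' := 𝓘(ℝ, F)) (f := φ.symm)
    (g := extendZero φ G) z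
    ((contMDiff_extendZero hφ hGs hK hKφ hG).contMDiffAt.mdifferentiableAt (by simp))
    ((hφ.contMDiffAt_symm hz).mdifferentiableAt (by simp))
  have h2 : extendZero φ G ∘ φ.symm =ᶠ[𝓝 z] G := by
    filter_upwards [φ.open_target.mem_nhds hz] with y hy
    rw [Function.comp_apply, extendZero_of_mem G (φ.map_target hy), φ.right_inv hy]
  have h3 : (mfderiv 𝓘(ℝ, ℂ × ℂ) 𝓘(ℝ, F) (extendZero φ G ∘ φ.symm) z : ℂ × ℂ →L[ℝ] F) =
      mfderiv 𝓘(ℝ, ℂ × ℂ) 𝓘(ℝ, F) G z := h2.mfderiv_eq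
  rw [← mfderiv_eq_fderiv]
  exact congrArg (fun A : ℂ × ℂ →L[ℝ] F => A v) (h.symm.trans h3)

/-- The value of `dp ∧ dq` on the frame `(1, 0), (i, 0)`. -/
def jacobian (p q : ℂ × ℂ → ℝ) (z : ℂ × ℂ) : ℝ :=
  fderiv ℝ p z (1, 0) * fderiv ℝ q z (Complex.I, 0) -
    fderiv ℝ p z (Complex.I, 0) * fderiv ℝ q z (1, 0)

/-- Functions `p`, `q` with compact support in a chart yield the exact form `dp ∧ dq` on `X`. -/
theorem exists_primitive_of_chart [IsManifold (𝓡 4) ∞ X] (hφ : IsComplexChart φ)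
    {p q : ℂ × ℂ → ℝ} (hp : ContDiff ℝ ∞ p) (hq : ContDiff ℝ ∞ q) (hK : IsCompact K)
    (hKφ : K ⊆ φ.target) (hp0 : ∀ z ∉ K, p z = 0) (hq0 : ∀ z ∉ K, q z = 0) :
    ∃ β : Form R4 X 1, IsSmooth β ∧
      (∀ z ∈ φ.target, chartValue φ (extD β) z (1, 0) (Complex.I, 0) = jacobian p q z) ∧
      ∀ x ∉ φ.source, extD β x = 0 := by
  have hGs : ContDiff ℝ ∞ fun z => (p z, q z) := hp.prodMk hq
  have hG0 : ∀ z ∉ K, (p z, q z) = 0 := fun z hz => Prod.ext (hp0 z hz) (hq0 z hz)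
  -- The primitive is the pullback of `x dy` by the global map `H = (p, q)`, so exactness on `X` is
  -- automatic.
  set H : X → ℝ × ℝ := extendZero φ fun z => (p z, q z) with hHdef
  have hH : ContMDiff (𝓡 4) 𝓘(ℝ, ℝ × ℝ) ∞ H := contMDiff_extendZero hφ hGs hK hKφ hG0
  have hθ : IsSmooth (E := ℝ × ℝ) (M := ℝ × ℝ) areaPrimitive :=
    isSmooth_of_contDiff areaPrimitive.contDiff
  have hval : ∀ (x : X) (a b : R4),
      (extD (pullback (E := R4) H (areaPrimitive : Form (ℝ × ℝ) (ℝ × ℝ) 1)) x :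
        R4 [⋀^Fin 2]→L[ℝ] ℝ) ![a, b] =
      (mfderiv (𝓡 4) 𝓘(ℝ, ℝ × ℝ) H x a : ℝ × ℝ).1 * (mfderiv (𝓡 4) 𝓘(ℝ, ℝ × ℝ) H x b : ℝ × ℝ).2 -
        (mfderiv (𝓡 4) 𝓘(ℝ, ℝ × ℝ) H x b : ℝ × ℝ).1 *
          (mfderiv (𝓡 4) 𝓘(ℝ, ℝ × ℝ) H x a : ℝ × ℝ).2 := by
    intro x a b
    have h1 := pullback_pair (E := R4) H (extD (areaPrimitive : Form (ℝ × ℝ) (ℝ × ℝ) 1)) x a b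
    rw [extD_pullback hH hθ]
    refine h1.trans ?_
    exact (congrArg (fun η : (ℝ × ℝ) [⋀^Fin 2]→L[ℝ] ℝ =>
      η ![mfderiv (𝓡 4) 𝓘(ℝ, ℝ × ℝ) H x a, mfderiv (𝓡 4) 𝓘(ℝ, ℝ × ℝ) H x b])
        (extD_self (areaPrimitive : Form (ℝ × ℝ) (ℝ × ℝ) 1) (H x))).trans
      (extDeriv_areaPrimitive _ _ _)
  refine ⟨pullback H (areaPrimitive : Form (ℝ × ℝ) (ℝ × ℝ) 1), hθ.pullback hH, fun z hz => ?_,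
    fun x hx => ?_⟩
  · have h1 := hval (φ.symm z) (invDiff φ z (1, 0)) (invDiff φ z (Complex.I, 0))
    have hd : ∀ v, (mfderiv (𝓡 4) 𝓘(ℝ, ℝ × ℝ) H (φ.symm z) (invDiff φ z v) : ℝ × ℝ) =
        (fderiv ℝ p z v, fderiv ℝ q z v) := by
      intro v
      refine (mfderiv_extendZero hφ hGs hK hKφ hG0 hz v).trans ?_
      rw [((hp.differentiable (by simp) z).hasFDerivAt.prodMk
        (hq.differentiable (by simp) z).hasFDerivAt).fderiv]
      rfl
    have key : ∀ A B A' B' : ℝ × ℝ, A = A' → B = B' →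
        A.1 * B.2 - B.1 * A.2 = A'.1 * B'.2 - B'.1 * A'.2 := by
      rintro A B _ _ rfl rfl
      rfl
    exact h1.trans (key _ _ _ _ (hd (1, 0)) (hd (Complex.I, 0)))
  · have h0 : ∀ a : R4, (mfderiv (𝓡 4) 𝓘(ℝ, ℝ × ℝ) H x : R4 →L[ℝ] ℝ × ℝ) a = 0 := by
      intro a
      have h1 : (mfderiv (𝓡 4) 𝓘(ℝ, ℝ × ℝ) H x : R4 →L[ℝ] ℝ × ℝ) =
          mfderiv (𝓡 4) 𝓘(ℝ, ℝ × ℝ) (fun _ : X => (0 : ℝ × ℝ)) x :=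
        (extendZero_eventuallyEq_zero hK hKφ hG0 hx).mfderiv_eq
      rw [h1, mfderiv_const]
      rfl
    refine twoForm_ext (E := R4) fun a b => (hval x a b).trans ?_
    have key : ∀ A B : ℝ × ℝ, A = 0 → A.1 * B.2 - B.1 * A.2 = 0 := by
      rintro A B rfl
      simp
    exact key _ _ (h0 a)

end ExtendZero

/-! ### Exact forms with compact support that are nonnegative on the kernel. -/

section LocalPositivity

/-- Near each point the kernel of a local model carries a nonnegative exact form with compact
support, positive near the point. -/
theorem ModelData.exists_jacobian_pos {g : ℂ × ℂ → ℂ × ℂ} (D : ModelData g) {T : Set (ℂ × ℂ)}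
    (hT : IsOpen T) {z₀ : ℂ × ℂ} (hz₀ : z₀ ∈ T) :
    ∃ (K : Set (ℂ × ℂ)) (p₁ q₁ p₂ q₂ : ℂ × ℂ → ℝ), IsCompact K ∧ K ⊆ T ∧
      (ContDiff ℝ ∞ p₁ ∧ ContDiff ℝ ∞ q₁ ∧ ContDiff ℝ ∞ p₂ ∧ ContDiff ℝ ∞ q₂) ∧
      (∀ z ∉ K, p₁ z = 0 ∧ q₁ z = 0 ∧ p₂ z = 0 ∧ q₂ z = 0) ∧
      (∀ z, D.w z = 0 → 0 ≤ jacobian p₁ q₁ z + jacobian p₂ q₂ z) ∧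
      ∀ᶠ z in 𝓝 z₀, D.w z = 0 → 0 < jacobian p₁ q₁ z + jacobian p₂ q₂ z := by
  obtain ⟨ρ, hρ, hball⟩ := Metric.eventually_nhds_iff_ball.1
    ((eventually_nhdsWithin_iff.1 (D.isolated z₀)).and (hT.eventually_mem hz₀))
  -- All cutoffs live in the ball of radius `3r < ρ`, in which `T` and the isolation of the common
  -- zeros of `w` and `wu` are available.
  set r := ρ / 4 with hr
  have hr0 : 0 < r := by positivity
  let χ : ContDiffBump z₀ := ⟨r, 2 * r, hr0, by linarith⟩
  -- `χ'` equals 1 wherever `χ` is nonzero, so it gives `q₁, q₂` compact support without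
  -- contributing a derivative.
  let χ' : ContDiffBump z₀ := ⟨2 * r, 3 * r, by positivity, by linarith⟩
  have hχs : ContDiff ℝ ∞ χ := χ.contDiff
  have hχs' : ContDiff ℝ ∞ χ' := χ'.contDiff
  have hχd : ∀ z, HasFDerivAt χ (fderiv ℝ χ z) z := fun z =>
    (hχs.differentiable (by simp) z).hasFDerivAt
  have hχ0 : ∀ z, 2 * r ≤ dist z z₀ → χ z = 0 := fun z hz => χ.zero_of_le_dist hz
  have hχ0' : ∀ z, 3 * r ≤ dist z z₀ → χ' z = 0 := fun z hz => χ'.zero_of_le_dist hz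
  have hχd0 : ∀ z, χ z = 0 → fderiv ℝ χ z = 0 := fun z hz =>
    IsLocalMin.fderiv_eq_zero (Filter.Eventually.of_forall fun y => by rw [hz]; exact χ.nonneg)
  have hχd1 : ∀ z, dist z z₀ < r → χ z = 1 ∧ fderiv ℝ χ z = 0 := fun z hz => by
    have h1 : (χ : ℂ × ℂ → ℝ) =ᶠ[𝓝 z] fun _ => 1 := χ.eventuallyEq_one_of_mem_ball hz
    exact ⟨h1.self_of_nhds, by rw [h1.fderiv_eq]; simp⟩
  let x : ℂ × ℂ →L[ℝ] ℝ := Complex.reCLM ∘L ContinuousLinearMap.fst ℝ ℂ ℂ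
  let y : ℂ × ℂ →L[ℝ] ℝ := Complex.imCLM ∘L ContinuousLinearMap.fst ℝ ℂ ℂ
  have hDre : ContDiff ℝ ∞ fun z => (D.w z).re := Complex.reCLM.contDiff.comp D.smooth_w
  have hDim : ContDiff ℝ ∞ fun z => (D.w z).im := Complex.imCLM.contDiff.comp D.smooth_w
  have hwd : ∀ z, HasFDerivAt D.w (fderiv ℝ D.w z) z := fun z =>
    (D.smooth_w.differentiable (by simp) z).hasFDerivAt
  have hre : ∀ z, HasFDerivAt (fun z => (D.w z).re) (Complex.reCLM ∘L fderiv ℝ D.w z) z :=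
    fun z => Complex.reCLM.hasFDerivAt.comp z (hwd z)
  have him : ∀ z, HasFDerivAt (fun z => (D.w z).im) (Complex.imCLM ∘L fderiv ℝ D.w z) z :=
    fun z => Complex.imCLM.hasFDerivAt.comp z (hwd z)
  -- The part of the curve where `χ` may vary. It is compact and avoids `z₀`, so `wu` has no zero on
  -- it even if `z₀` is a cusp.
  set S : Set (ℂ × ℂ) := (Metric.closedBall z₀ (2 * r) \ Metric.ball z₀ r) ∩ {z | D.w z = 0} with hS
  have hSc : IsCompact S :=
    ((isCompact_closedBall z₀ (2 * r)).diff Metric.isOpen_ball).inter_right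
      (isClosed_eq D.smooth_w.continuous continuous_const)
  have hSwu : ∀ z ∈ S, Complex.normSq (D.wu z) ≠ 0 := by
    rintro z ⟨⟨hz1, hz2⟩, hz3⟩
    have hz4 : z ∈ Metric.ball z₀ ρ := by
      rw [Metric.mem_closedBall] at hz1
      rw [Metric.mem_ball]
      linarith
    have hz5 : z ≠ z₀ := by
      rintro rfl
      exact hz2 (Metric.mem_ball_self hr0)
    exact (map_ne_zero Complex.normSq).2 ((hball z hz4).1 hz5 hz3)
  have hcont : ContinuousOn (fun z => 2 * fderiv ℝ χ z (1, 0) * (x z - x z₀) /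
      Complex.normSq (D.wu z)) S := by
    refine ContinuousOn.div (Continuous.continuousOn ?_)
      (Complex.continuous_normSq.comp D.continuous_wu).continuousOn hSwu
    have h1 : Continuous fun z => fderiv ℝ χ z (1, 0) :=
      (hχs.continuous_fderiv (by simp)).clm_apply continuous_const
    exact (continuous_const.mul h1).mul (x.continuous.sub continuous_const)
  obtain ⟨C, hC⟩ := hSc.exists_bound_of_continuousOn hcont
  -- `c |wu|²` dominates the error `2 χ_x (x - x₀)` on `S`; nonnegativity of `c` keeps the
  -- correction harmless near `z₀`.
  set c := max C 0 with hc
  have hp₁d : ∀ z, HasFDerivAt (fun z => χ z ^ 2 * (x z - x z₀))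
      (χ z ^ 2 • x + (x z - x z₀) • ((2 * χ z) • fderiv ℝ χ z)) z := fun z => by
    have h1 := ((hχd z).pow 2).mul (x.hasFDerivAt.sub_const (x z₀))
    refine h1.congr_fderiv ?_
    simp
  have hp₂d : ∀ z, HasFDerivAt (fun z => c * χ z * (D.w z).re)
      ((c * χ z) • (Complex.reCLM ∘L fderiv ℝ D.w z) + (D.w z).re • (c • fderiv ℝ χ z)) z :=
    fun z => ((hχd z).const_mul c).mul (hre z)
  have hq : ∀ z (s : ℂ × ℂ → ℝ), dist z z₀ < 2 * r →
      (fun z => χ' z * s z) =ᶠ[𝓝 z] s := fun z s hz => by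
    have h1 : (χ' : ℂ × ℂ → ℝ) =ᶠ[𝓝 z] 1 := χ'.eventuallyEq_one_of_mem_ball hz
    filter_upwards [h1] with u hu
    rw [hu, Pi.one_apply, one_mul]
  have hout : ∀ z, 2 * r ≤ dist z z₀ → jacobian (fun z => χ z ^ 2 * (x z - x z₀))
      (fun z => χ' z * y z) z + jacobian (fun z => c * χ z * (D.w z).re)
      (fun z => χ' z * (D.w z).im) z = 0 := by
    intro z hz
    have h1 := hχ0 z hz
    have h2 := hχd0 z h1
    simp [jacobian, (hp₁d z).fderiv, (hp₂d z).fderiv, h1, h2]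
  -- Squaring `χ` in `p₁` puts a factor `χ` in the error term, matching the factor in the
  -- correction. The correction is `c χ |wu|²` by the Cauchy–Riemann equations, the term with `dχ`
  -- dropping out because `w = 0`.
  have hin : ∀ z, dist z z₀ < 2 * r → D.w z = 0 → jacobian (fun z => χ z ^ 2 * (x z - x z₀))
      (fun z => χ' z * y z) z + jacobian (fun z => c * χ z * (D.w z).re)
      (fun z => χ' z * (D.w z).im) z = χ z * (χ z + 2 * fderiv ℝ χ z (1, 0) * (x z - x z₀) +
        c * Complex.normSq (D.wu z)) := by
    intro z hz hw
    have h1 : fderiv ℝ (fun z => χ' z * y z) z = y := by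
      rw [(hq z y hz).fderiv_eq]
      exact y.fderiv
    have h2 : fderiv ℝ (fun z => χ' z * (D.w z).im) z = Complex.imCLM ∘L fderiv ℝ D.w z := by
      rw [(hq z _ hz).fderiv_eq]
      exact (him z).fderiv
    have hx1 : x (1, 0) = 1 := rfl
    have hxI : x (Complex.I, 0) = 0 := rfl
    have hy1 : y (1, 0) = 0 := rfl
    have hyI : y (Complex.I, 0) = 1 := rfl
    simp only [jacobian, h1, h2, (hp₁d z).fderiv, (hp₂d z).fderiv, hw, hx1, hy1, hyI,
      D.fderiv_w_one, D.fderiv_w_I, add_apply, smul_apply,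
      ContinuousLinearMap.comp_apply, Complex.reCLM_apply, Complex.imCLM_apply, smul_eq_mul,
      Complex.normSq_apply, Complex.zero_re, Complex.I_mul_re, Complex.I_mul_im]
    ring
  have hinner : ∀ z, dist z z₀ < r → D.w z = 0 → 0 < jacobian (fun z => χ z ^ 2 * (x z - x z₀))
      (fun z => χ' z * y z) z + jacobian (fun z => c * χ z * (D.w z).re)
      (fun z => χ' z * (D.w z).im) z := by
    intro z hz hw
    rw [hin z (by linarith) hw, (hχd1 z hz).1, (hχd1 z hz).2]
    have h1 : 0 ≤ c * Complex.normSq (D.wu z) :=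
      mul_nonneg (le_max_right _ _) (Complex.normSq_nonneg _)
    simp only [zero_apply]
    linarith
  refine ⟨Metric.closedBall z₀ (3 * r), fun z => χ z ^ 2 * (x z - x z₀), fun z => χ' z * y z,
    fun z => c * χ z * (D.w z).re, fun z => χ' z * (D.w z).im, isCompact_closedBall _ _,
    fun z hz => ?_, ⟨(hχs.pow 2).mul (x.contDiff.sub contDiff_const), hχs'.mul y.contDiff,
      (contDiff_const.mul hχs).mul hDre, hχs'.mul hDim⟩, fun z hz => ?_, fun z hw => ?_, ?_⟩
  · refine (hball z ?_).2
    rw [Metric.mem_closedBall] at hz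
    rw [Metric.mem_ball]
    linarith
  · rw [Metric.mem_closedBall, not_le] at hz
    have h1 := hχ0 z (by linarith)
    have h2 := hχ0' z hz.le
    simp [h1, h2]
  · rcases le_or_gt (2 * r) (dist z z₀) with hz | hz
    · exact (hout z hz).ge
    · rcases lt_or_ge (dist z z₀) r with hz' | hz'
      · exact (hinner z hz' hw).le
      · have hzS : z ∈ S := ⟨⟨Metric.mem_closedBall.2 hz.le, by
          rw [Metric.mem_ball]; exact not_lt.2 hz'⟩, hw⟩
        rw [hin z hz hw]
        refine mul_nonneg χ.nonneg ?_
        have h1 := (abs_le.1 ((hC z hzS).trans (le_max_left C 0))).1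
        have h2 : 0 < Complex.normSq (D.wu z) :=
          (Complex.normSq_nonneg _).lt_of_ne (hSwu z hzS).symm
        rw [le_div_iff₀ h2] at h1
        have h3 : 0 ≤ χ z := χ.nonneg
        linarith
  · filter_upwards [Metric.ball_mem_nhds z₀ hr0] with z hz hw
    exact hinner z hz hw

end LocalPositivity

/-! ### Existence of admissible exact forms. -/

section Existence

variable {X : Type*} [TopologicalSpace X] [ChartedSpace R4 X]
  {Y : Type*} [TopologicalSpace Y] [ChartedSpace R4 Y]
  {o : ManifoldOrientation X} {ωY : Form R4 Y 2} {f : X → Y}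

/-- `α` is nonnegative on the kernel of `df` at `x`, in all adapted charts. -/
def KernelNonneg (o : ManifoldOrientation X) (ωY : Form R4 Y 2) (f : X → Y) (α : Form R4 X 2)
    (x : X) : Prop :=
  ∀ φ ψ, AdaptedCharts o ωY f φ ψ → ∀ z ∈ φ.target, φ.symm z = x →
    mfderiv (𝓡 4) (𝓡 4) f (φ.symm z) (invDiff φ z (1, 0)) = 0 →
      0 ≤ chartValue φ α z (1, 0) (Complex.I, 0)

/-- `α` is positive on the kernel of `df` at `x`, in all adapted charts. -/
def KernelPos (o : ManifoldOrientation X) (ωY : Form R4 Y 2) (f : X → Y) (α : Form R4 X 2)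
    (x : X) : Prop :=
  ∀ φ ψ, AdaptedCharts o ωY f φ ψ → ∀ z ∈ φ.target, φ.symm z = x →
    mfderiv (𝓡 4) (𝓡 4) f (φ.symm z) (invDiff φ z (1, 0)) = 0 →
      0 < chartValue φ α z (1, 0) (Complex.I, 0)

theorem chartValue_add (φ : OpenPartialHomeomorph X (ℂ × ℂ)) (α η : Form R4 X 2)
    (z a b : ℂ × ℂ) : chartValue φ (α + η) z a b = chartValue φ α z a b + chartValue φ η z a b :=
  rfl

theorem chartValue_eq_zero (φ : OpenPartialHomeomorph X (ℂ × ℂ)) {α : Form R4 X 2}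
    {z : ℂ × ℂ} (h : α (φ.symm z) = 0) (a b : ℂ × ℂ) : chartValue φ α z a b = 0 := by
  rw [chartValue, h]
  rfl

/-- `(u, iu)` is obtained from `(1, i)` by a real matrix of determinant `|u|²`. So positivity on the
kernel line need only be tested on one vector. -/
theorem chartValue_line (φ : OpenPartialHomeomorph X (ℂ × ℂ)) (α : Form R4 X 2)
    (z : ℂ × ℂ) (u : ℂ) : chartValue φ α z (u, 0) (Complex.I • (u, 0)) =
      Complex.normSq u * chartValue φ α z (1, 0) (Complex.I, 0) := by
  have h1 : ((u, 0) : ℂ × ℂ) = u.re • ((1 : ℂ), (0 : ℂ)) + u.im • (Complex.I, (0 : ℂ)) := by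
    ext <;> simp
  have h2 : (Complex.I • (u, 0) : ℂ × ℂ) =
      (-u.im) • ((1 : ℂ), (0 : ℂ)) + u.re • (Complex.I, (0 : ℂ)) := by
    refine Prod.ext (Complex.ext ?_ ?_) ?_ <;> simp
  rw [h2, h1]
  simp only [chartValue_eq_toBilin]
  set B := toBilin (ℂ × ℂ) (chartRep φ α z)
  have hB : ∀ a b, B a b = -B b a := toBilin_swap _
  have h3 := hB (1, 0) (1, 0)
  have h4 := hB (Complex.I, 0) (Complex.I, 0)
  have h5 := hB (Complex.I, 0) (1, 0)
  have h3' : B (1, 0) (1, 0) = 0 := by linarith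
  have h4' : B (Complex.I, 0) (Complex.I, 0) = 0 := by linarith
  simp only [map_add, map_smul, add_apply, smul_apply,
    smul_eq_mul, h3', h4', h5, Complex.normSq_apply]
  ring

theorem isPositiveOnKernel_of_kernelPos (hf : ContMDiff (𝓡 4) (𝓡 4) ∞ f) {α : Form R4 X 2}
    (h : ∀ x, KernelPos o ωY f α x) : IsPositiveOnKernel o ωY f α := by
  intro φ ψ hφψ z hz _ v hv hker
  obtain ⟨g, hgm, hg⟩ := hφψ.model
  obtain ⟨D⟩ := exists_modelData hgm
  obtain ⟨h1, h2⟩ := (hφψ.mfderiv_eq_zero_iff hf hg D hz v).1 hker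
  have hv1 : v.1 ≠ 0 := fun h0 => hv (Prod.ext h0 h2)
  have hw : D.w z = 0 := (mul_eq_zero.1 h1).resolve_right hv1
  have hve : v = (v.1, 0) := Prod.ext rfl h2
  have h3 := h (φ.symm z) φ ψ hφψ z hz rfl
    ((hφψ.mfderiv_eq_zero_iff hf hg D hz (1, 0)).2 ⟨by rw [hw, zero_mul], rfl⟩)
  change 0 < chartValue φ α z v (Complex.I • v)
  rw [hve, chartValue_line]
  exact mul_pos (Complex.normSq_pos.2 hv1) h3

theorem KernelNonneg.add {α η : Form R4 X 2} {x : X} (h₁ : KernelNonneg o ωY f α x)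
    (h₂ : KernelNonneg o ωY f η x) : KernelNonneg o ωY f (α + η) x :=
  fun φ ψ h z hz hx hker => add_nonneg (h₁ φ ψ h z hz hx hker) (h₂ φ ψ h z hz hx hker)

theorem KernelPos.add {α η : Form R4 X 2} {x : X} (h₁ : KernelPos o ωY f α x)
    (h₂ : KernelNonneg o ωY f η x) : KernelPos o ωY f (α + η) x :=
  fun φ ψ h z hz hx hker =>
    add_pos_of_pos_of_nonneg (h₁ φ ψ h z hz hx hker) (h₂ φ ψ h z hz hx hker)

variable [T2Space X] [IsManifold (𝓡 4) ∞ X]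

/-- Around each point there is an exact form, nonnegative on the kernel of `df`, and positive on
it near the point. -/
theorem AdaptedCharts.exists_primitive {φ : OpenPartialHomeomorph X (ℂ × ℂ)}
    {ψ : OpenPartialHomeomorph Y (ℂ × ℂ)} (h : AdaptedCharts o ωY f φ ψ)
    (hf : ContMDiff (𝓡 4) (𝓡 4) ∞ f) {p : X} (hp : p ∈ φ.source) :
    ∃ β : Form R4 X 1, IsSmooth β ∧ (∀ x, KernelNonneg o ωY f (extD β) x) ∧
      ∀ᶠ x in 𝓝 p, KernelPos o ωY f (extD β) x := by
  obtain ⟨g, hgm, hg⟩ := h.model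
  obtain ⟨D⟩ := exists_modelData hgm
  obtain ⟨K, p₁, q₁, p₂, q₂, hK, hKφ, ⟨hp₁, hq₁, hp₂, hq₂⟩, h0, hnn, hpos⟩ :=
    D.exists_jacobian_pos φ.open_target (φ.map_source hp)
  obtain ⟨β₁, hβ₁, hv₁, hz₁⟩ := exists_primitive_of_chart h.chart_source hp₁ hq₁ hK hKφ
    (fun z hz => (h0 z hz).1) (fun z hz => (h0 z hz).2.1)
  obtain ⟨β₂, hβ₂, hv₂, hz₂⟩ := exists_primitive_of_chart h.chart_source hp₂ hq₂ hK hKφ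
    (fun z hz => (h0 z hz).2.2.1) (fun z hz => (h0 z hz).2.2.2)
  have hext := extD_add hβ₁ hβ₂
  have hval : ∀ z ∈ φ.target, chartValue φ (extD (β₁ + β₂)) z (1, 0) (Complex.I, 0) =
      jacobian p₁ q₁ z + jacobian p₂ q₂ z := fun z hz => by
    rw [hext, chartValue_add, hv₁ z hz, hv₂ z hz]
  -- The construction controls the sign in `φ` only, whereas the conditions quantify over all
  -- adapted charts.
  have hcompare : ∀ x ∈ φ.source, ∀ φ' ψ', AdaptedCharts o ωY f φ' ψ' → ∀ z' ∈ φ'.target,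
      φ'.symm z' = x → mfderiv (𝓡 4) (𝓡 4) f (φ'.symm z') (invDiff φ' z' (1, 0)) = 0 →
      D.w (φ x) = 0 ∧ ∃ c > 0, chartValue φ' (extD (β₁ + β₂)) z' (1, 0) (Complex.I, 0) =
        c * (jacobian p₁ q₁ (φ x) + jacobian p₂ q₂ (φ x)) := by
    intro x hx φ' ψ' h' z' hz' hzx hker
    obtain ⟨g', hgm', hg'⟩ := h'.model
    obtain ⟨D'⟩ := exists_modelData hgm'
    have hw' : D'.w z' = 0 := by
      simpa using ((h'.mfderiv_eq_zero_iff hf hg' D' hz' (1, 0)).1 hker).1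
    obtain ⟨hw, c, hc, hcα⟩ := h.exists_pos_ratio h' hf hg D hg' D' (φ.map_source hx) hz'
      ((φ.left_inv hx).trans hzx.symm) hw'
    exact ⟨hw, c, hc, by rw [hcα, hval _ (φ.map_source hx)]⟩
  refine ⟨β₁ + β₂, hβ₁.add hβ₂, fun x => ?_, ?_⟩
  · intro φ' ψ' h' z' hz' hzx hker
    by_cases hx : x ∈ φ.source
    · obtain ⟨hw, c, hc, hcv⟩ := hcompare x hx φ' ψ' h' z' hz' hzx hker
      rw [hcv]
      exact mul_nonneg hc.le (hnn _ hw)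
    · refine (chartValue_eq_zero φ' ?_ _ _).ge
      rw [hzx, hext, Pi.add_apply, hz₁ x hx, hz₂ x hx, add_zero]
  · filter_upwards [φ.open_source.mem_nhds hp, (φ.continuousAt hp).eventually hpos] with x hx hxp
    intro φ' ψ' h' z' hz' hzx hker
    obtain ⟨hw, c, hc, hcv⟩ := hcompare x hx φ' ψ' h' z' hz' hzx hker
    rw [hcv]
    exact mul_pos hc (hxp hw)

/-- Since each local form is nonnegative on the kernel everywhere, adding forms never destroys
positivity already obtained. Compactness then gives a finite sum positive along the whole curve,
exact because no function multiplies the summands. -/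
theorem admissibleForms_nonempty [CompactSpace X] {ωY : SymplecticForm R4 Y}
    (f : C^∞⟮𝓡 4, X; 𝓡 4, Y⟯) (hf : IsSymplecticBranchedCover o ωY f) :
    (admissibleForms o ωY.form f).Nonempty := by
  have key := (isCompact_univ (X := X)).induction_on
    (p := fun S => ∃ β : Form R4 X 1, IsSmooth β ∧
      (∀ x, KernelNonneg o ωY.form f (extD β) x) ∧ ∀ x ∈ S, KernelPos o ωY.form f (extD β) x)
    ⟨0, isSmooth_zero, fun x φ ψ _ z _ _ _ => by
      rw [extD_zero]
      exact (chartValue_eq_zero φ rfl _ _).ge, by simp⟩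
    (fun S T hST ⟨β, hβ, h1, h2⟩ => ⟨β, hβ, h1, fun x hx => h2 x (hST hx)⟩)
    (by
      rintro S T ⟨β, hβ, h1, h2⟩ ⟨γ, hγ, h3, h4⟩
      refine ⟨β + γ, hβ.add hγ, fun x => ?_, fun x hx => ?_⟩
      · rw [extD_add hβ hγ]
        exact (h1 x).add (h3 x)
      · rw [extD_add hβ hγ]
        rcases hx with hx | hx
        · exact (h2 x hx).add (h3 x)
        · rw [add_comm]
          exact (h4 x hx).add (h1 x))
    (by
      intro p _
      obtain ⟨φ, ψ, hp, h⟩ := hf p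
      obtain ⟨β, hβ, h1, h2⟩ := h.exists_primitive f.contMDiff hp
      exact ⟨_, mem_nhdsWithin_of_mem_nhds h2, β, hβ, h1, fun x hx => hx⟩)
  obtain ⟨β, hβ, -, hpos⟩ := key
  exact ⟨extD β, ⟨β, hβ, rfl⟩,
    isPositiveOnKernel_of_kernelPos f.contMDiff fun x => hpos x (Set.mem_univ x)⟩

end Existence

/-! ### Induced symplectic forms: cohomology class, existence and uniqueness. -/

section InducedForms

variable {X : Type*} [TopologicalSpace X] [ChartedSpace R4 X] [IsManifold (𝓡 4) ∞ X]
  {Y : Type*} [TopologicalSpace Y] [ChartedSpace R4 Y] [IsManifold (𝓡 4) ∞ Y]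
  {o : ManifoldOrientation X} {ωY : SymplecticForm R4 Y}

theorem IsInducedForm.cohomologyClass_eq {f : C^∞⟮𝓡 4, X; 𝓡 4, Y⟯} {ωX : SymplecticForm R4 X}
    (h : IsInducedForm o ωY f ωX) :
    ωX.cohomologyClass = cohomologyPullback f ωY.cohomologyClass := by
  obtain ⟨α, ⟨hα, -⟩, ε, -, hform, -⟩ := h
  refine (Submodule.Quotient.eq _).2 ?_
  change ωX.form - pullback f ωY.form ∈ exactForms R4 X 1
  rw [hform, add_sub_cancel_left]
  exact Submodule.smul_mem _ ε hα

theorem isSmooth_pullback_add (f : C^∞⟮𝓡 4, X; 𝓡 4, Y⟯) {β : Form R4 X 1} (hβ : IsSmooth β)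
    (t : ℝ) : IsSmooth (pullback f ωY.form + t • extD β) :=
  (ωY.smooth.pullback f.contMDiff).add (hβ.extD.smul t)

theorem extD_pullback_add (f : C^∞⟮𝓡 4, X; 𝓡 4, Y⟯) {β : Form R4 X 1} (hβ : IsSmooth β)
    (t : ℝ) : extD (pullback f ωY.form + t • extD β) = 0 := by
  rw [extD_add (ωY.smooth.pullback f.contMDiff) (hβ.extD.smul t),
    extD_pullback f.contMDiff ωY.smooth, ωY.closed, extD_smul, extD_extD hβ, smul_zero, add_zero]
  rfl

theorem exists_symplectic_of_admissible [CompactSpace X] (f : C^∞⟮𝓡 4, X; 𝓡 4, Y⟯)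
    (hf : IsSymplecticBranchedCover o ωY f) {α : Form R4 X 2}
    (hα : α ∈ admissibleForms o ωY.form f) :
    ∃ ε₀ > (0 : ℝ), ∀ ε ∈ Set.Ioc 0 ε₀,
      ∃ ωX : SymplecticForm R4 X, ωX.form = pullback f ωY.form + ε • α := by
  obtain ⟨⟨β, hβ, rfl⟩, hpos⟩ := hα
  obtain ⟨ε₀, hε₀, h⟩ := exists_tamed f hf hβ.extD hβ.extD hpos hpos
  refine ⟨ε₀, hε₀, fun ε hε => ⟨⟨_, isSmooth_pullback_add f hβ ε, extD_pullback_add f hβ ε,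
    fun x v hv => ?_⟩, rfl⟩⟩
  obtain ⟨A, hA, h1, -⟩ := h ε hε x
  exact h1.nondegenerate hA v hv

variable [T2Space X] [CompactSpace X]

/-- Scaling the perturbation does not change the induced form up to diffeomorphism. -/
theorem diffeoEquiv_of_scale (f : C^∞⟮𝓡 4, X; 𝓡 4, Y⟯) {β : Form R4 X 1} (hβ : IsSmooth β)
    {ε ε' : ℝ} (hε : 0 < ε) (hεε' : ε ≤ ε')
    (h : ∀ t ∈ Set.Ioc 0 ε', ∃ η : SymplecticForm R4 X,
      η.form = pullback f ωY.form + t • extD β) :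
    DiffeoEquiv (pullback f ωY.form + ε • extD β) (pullback f ωY.form + ε' • extD β) := by
  have h1 := moser (isSmooth_pullback_add (ωY := ωY) f hβ ε) (extD_pullback_add f hβ ε)
    (hβ.smul (ε' - ε)) (fun t ht => by
      obtain ⟨η, hη⟩ := h (ε + t * (ε' - ε)) ⟨by nlinarith [ht.1], by nlinarith [ht.2]⟩
      rw [extD_smul, add_assoc, smul_smul, ← add_smul, ← hη]
      exact η.nondegenerate)
  rwa [extD_smul, add_assoc, ← add_smul, add_sub_cancel] at h1

/-- Any two induced forms are diffeomorphic. -/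
theorem IsInducedForm.diffeoEquiv (f : C^∞⟮𝓡 4, X; 𝓡 4, Y⟯)
    (hf : IsSymplecticBranchedCover o ωY f) {ω₁ ω₂ : SymplecticForm R4 X}
    (h₁ : IsInducedForm o ωY f ω₁) (h₂ : IsInducedForm o ωY f ω₂) :
    DiffeoEquiv ω₁.form ω₂.form := by
  obtain ⟨_, ⟨⟨β₁, hβ₁, rfl⟩, hpos₁⟩, ε₁, hε₁, hform₁, hs₁⟩ := h₁
  obtain ⟨_, ⟨⟨β₂, hβ₂, rfl⟩, hpos₂⟩, ε₂, hε₂, hform₂, hs₂⟩ := h₂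
  obtain ⟨ε₀, hε₀, htame⟩ := exists_tamed f hf hβ₁.extD hβ₂.extD hpos₁ hpos₂
  -- Small enough for taming and within both ranges in which the scaled forms are symplectic, so
  -- that both given forms can be moved to this common `ε`.
  set ε := min ε₀ (min ε₁ ε₂) with hε
  have hεpos : 0 < ε := lt_min hε₀ (lt_min hε₁ hε₂)
  have hle₁ : ε ≤ ε₁ := (min_le_right _ _).trans (min_le_left _ _)
  have hle₂ : ε ≤ ε₂ := (min_le_right _ _).trans (min_le_right _ _)
  have hmid : DiffeoEquiv (pullback f ωY.form + ε • extD β₁)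
      (pullback f ωY.form + ε • extD β₂) := by
    have hβ : IsSmooth (ε • β₂ + (-ε) • β₁) := (hβ₂.smul ε).add (hβ₁.smul (-ε))
    have hd : extD (ε • β₂ + (-ε) • β₁) = ε • extD β₂ + (-ε) • extD β₁ := by
      rw [extD_add (hβ₂.smul ε) (hβ₁.smul (-ε)), extD_smul, extD_smul]
    have h1 := moser (isSmooth_pullback_add (ωY := ωY) f hβ₁ ε) (extD_pullback_add f hβ₁ ε) hβ
      (fun t ht => by
        intro x v hv
        obtain ⟨A, hA, ht₁, ht₂⟩ := htame ε ⟨hεpos, min_le_left _ _⟩ x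
        refine (ht₁.convex ht₂ ht).nondegenerate hA v fun w => ?_
        -- The Moser segment with primitive `ε(β₂ - β₁)` is the convex combination of the two forms,
        -- tamed at `x` by the common `A`.
        have e : ((1 - t) • (pullback f ωY.form x + ε • extD β₁ x) +
            t • (pullback f ωY.form x + ε • extD β₂ x)) =
            (pullback f ωY.form + ε • extD β₁ + t • extD (ε • β₂ + (-ε) • β₁) : Form R4 X 2) x := by
          rw [hd]
          simp only [Pi.add_apply, Pi.smul_apply]
          module
        exact (congrArg (fun η : R4 [⋀^Fin 2]→L[ℝ] ℝ => η ![v, w]) e).trans (hv w))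
    have e : pullback f ωY.form + ε • extD β₁ + (ε • extD β₂ + (-ε) • extD β₁) =
        pullback f ωY.form + ε • extD β₂ := by
      module
    rwa [hd, e] at h1
  rw [hform₁, hform₂]
  exact (diffeoEquiv_of_scale f hβ₁ hεpos hle₁ hs₁).symm.trans
    (hmid.trans (diffeoEquiv_of_scale f hβ₂ hεpos hle₂ hs₂))

end InducedForms

end SymplecticCover

end

/-! ### The four assertions assembled. -/

theorem mainTheorem4 {X Y : Type*}
    [TopologicalSpace X] [T2Space X] [CompactSpace X] [ChartedSpace R4 X] [IsManifold (𝓡 4) ∞ X]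
    [TopologicalSpace Y] [T2Space Y] [CompactSpace Y] [ChartedSpace R4 Y] [IsManifold (𝓡 4) ∞ Y]
    (o : ManifoldOrientation X) (ωY : SymplecticForm R4 Y) (f : C^∞⟮𝓡 4, X; 𝓡 4, Y⟯)
    (hf : IsSymplecticBranchedCover o ωY f) :
    (∃ ωX : SymplecticForm R4 X, IsInducedForm o ωY f ωX) ∧
    (∀ ωX : SymplecticForm R4 X, IsInducedForm o ωY f ωX →
      ωX.cohomologyClass = cohomologyPullback f ωY.cohomologyClass) ∧
    (∀ α ∈ admissibleForms o ωY.form f, ∃ ε₀ > (0 : ℝ), ∀ ε ∈ Set.Ioc 0 ε₀,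
      ∃ ωX : SymplecticForm R4 X, ωX.form = pullback f ωY.form + ε • α) ∧
    (∀ ω₁ ω₂ : SymplecticForm R4 X, IsInducedForm o ωY f ω₁ → IsInducedForm o ωY f ω₂ →
      ∃ Φ : X ≃ₘ^∞⟮𝓡 4, 𝓡 4⟯ X, pullback Φ ω₂.form = ω₁.form) := by
  have hsymp := fun α hα => exists_symplectic_of_admissible f hf (α := α) hα
  refine ⟨?_, fun _ h => h.cohomologyClass_eq, hsymp, fun _ _ h₁ h₂ => h₁.diffeoEquiv f hf h₂⟩
  obtain ⟨α, hα⟩ := admissibleForms_nonempty f hf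
  obtain ⟨ε, hε, h⟩ := hsymp α hα
  obtain ⟨ωX, hωX⟩ := h ε ⟨hε, le_rfl⟩
  exact ⟨ωX, α, hα, ε, hε, hωX, h⟩
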